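/- Let $\hbar,m,e>0$, let $T_2=\mathbb R^3/\mathbb Z^2=\mathbb T^2\times\mathbb R$ with points $x=(x_1,x_2,x_3)$, and let the ion charge density per cell be a real function $\sigma\in L^1(T_2)\cap L^2(T_2)$ with $\int_{T_2}\sigma\,dx=eZ$, $Z>0$. For $f\in L^1(T_2)$ put $$\hat f(\mathbf k,\xi)=\frac1{\sqrt{2\pi}}\int_{T_2}e^{i(\mathbf k_1x_1+\mathbf k_2x_2+\xi x_3)}f(x)\,dx,\qquad (\mathbf k,\xi)\in\Sigma_2=2\pi\mathbb Z^2\times\mathbb R;$$ this transform extends to a unitary operator $F:L^2(T_2)\to L^2(\Sigma_2)$, where $\Sigma_2$ carries counting measure in $\mathbf k$ times Lebesgue measure in $\xi$. For $f\in L^1\cap L^2$ put $\Lambda f=F^{-1}\big(\hat f/\sqrt{\mathbf k^2+\xi^2}\big)$ whenever the quotient lies in $L^2(\Sigma_2)$. Assume Condition II: $$\frac{\hat\sigma(0,\xi)-eZ/\sqrt{2\pi}}{|\xi|}\in L^2(-1,1).$$ For $\psi\in H^1(T_2)$ (complex valued) the energy per cell is $$\mathcal E(\psi)=\int_{T_2}\Big[\frac{\hbar^2}{2m}|\nabla\psi|^2+\frac12|\Lambda\rho|^2\Big]dx,\qquad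 \rho=\sigma-e|\psi|^2,$$ with $\mathcal E(\psi)=+\infty$ if $\Lambda\rho$ is not defined. Let $M_2=\{\psi\in H^1(T_2):\int_{T_2}|\psi|^2dx=Z\}$. Then there exists $\psi^0\in M_2$ such that: (i) $\mathcal E(\psi^0)=\inf_{\psi\in M_2}\mathcal E(\psi)<\infty$; (ii) $\psi^0\in H^2_{\rm loc}(T_2)$, and there are a real continuous potential $\phi^0\in H^2_{\rm loc}(T_2)$ and $\omega^0\in\mathbb R$ such that, on $T_2$, with derivatives in the sense of distributions, $$\hbar\omega^0\psi^0=-\frac{\hbar^2}{2m}\Delta\psi^0-e\phi^0\psi^0,\qquad -\Delta\phi^0=\sigma-e|\psi^0|^2,\qquad 0=-\int_{T_2}\nabla\phi^0(x)\,\sigma(x)\,dx,$$ the last integral being absolutely convergent; (iii) for some constant $C$, $|\phi^0(x)|\le C(1+|x_3|)^{1/2}$ for all $x\in T_2$. -/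

import Mathlib

open MeasureTheory
open scoped ENNReal

noncomputable section

/-- The cylindrical cell `T₂ = ℝ³ / ℤ² = 𝕋² × ℝ`, with `𝕋 = ℝ / ℤ`. Its `volume` is Lebesgue measure
(the two circle factors have length one). -/
abbrev CylCell : Type := UnitAddCircle × UnitAddCircle × ℝ

namespace CylCell

/-- The quotient map `ℝ³ → T₂`. -/
def proj (x : Fin 3 → ℝ) : CylCell := ((x 0 : UnitAddCircle), (x 1 : UnitAddCircle), x 2)

/-- The test functions `C₀^∞(T₂)`: complex functions with compact support whose lift to `ℝ³` is smooth. -/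
structure IsTest (τ : CylCell → ℂ) : Prop where
  smooth : ContDiff ℝ ((⊤ : ℕ∞) : WithTop ℕ∞) (fun x : Fin 3 → ℝ => τ (proj x))
  compact : HasCompactSupport τ

/-- The classical partial derivative `∂_j f`. -/
def partialD (j : Fin 3) (f : CylCell → ℂ) (x : CylCell) : ℂ :=
  deriv (fun t : ℝ => f (x + proj (Pi.single j t))) 0

/-- `∂_j f = g` in the sense of distributions, for locally integrable `f` and `g`. -/
structure HasWeakPartial (j : Fin 3) (f g : CylCell → ℂ) : Prop where
  left : LocallyIntegrable f
  right : LocallyIntegrable g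
  eq : ∀ τ : CylCell → ℂ, IsTest τ → ∫ x, f x * partialD j τ x = -∫ x, g x * τ x

/-- `Δ f = h` in the sense of distributions, for locally integrable `f` and `h`. -/
structure HasWeakLaplacian (f h : CylCell → ℂ) : Prop where
  left : LocallyIntegrable f
  right : LocallyIntegrable h
  eq : ∀ τ : CylCell → ℂ, IsTest τ →
    ∫ x, f x * (∑ j : Fin 3, partialD j (partialD j τ) x) = ∫ x, h x * τ x

/-- The Sobolev space `H¹(T₂)`. -/
structure MemH1 (f : CylCell → ℂ) : Prop where
  memLp : MemLp f 2
  grad : ∀ j : Fin 3, ∃ g : CylCell → ℂ, HasWeakPartial j f g ∧ MemLp g 2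

/-- The space `L²_loc(T₂)`. -/
def MemL2loc (f : CylCell → ℂ) : Prop :=
  ∀ K : Set CylCell, IsCompact K → MemLp f 2 (volume.restrict K)

/-- The Sobolev space `H²_loc(T₂)`. -/
structure MemH2loc (f : CylCell → ℂ) : Prop where
  memL2loc : MemL2loc f
  grad : ∀ j : Fin 3, ∃ g : CylCell → ℂ, HasWeakPartial j f g ∧ MemL2loc g ∧
    ∀ i : Fin 3, ∃ h : CylCell → ℂ, HasWeakPartial i g h ∧ MemL2loc h

/-- The Dirichlet integral `∫ |∇ψ|²`, with value `∞` if there is no locally integrable weak gradient.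
The weak gradient is unique almost everywhere, so the infimum is over one class only. -/
def dirichlet (ψ : CylCell → ℂ) : ℝ≥0∞ :=
  ⨅ (g : Fin 3 → CylCell → ℂ) (_ : ∀ j, HasWeakPartial j ψ (g j)),
    ∑ j : Fin 3, ∫⁻ x, ‖g j x‖ₑ ^ 2

/-- The frequency space `Σ₂ = (2πℤ)² × ℝ`; a point `(n₁, n₂, ξ)` stands for the frequency
`(𝐤, ξ) = (2π n₁, 2π n₂, ξ)`. -/
abbrev Freq : Type := ℤ × ℤ × ℝ

/-- Counting measure in `𝐤` times Lebesgue measure in `ξ`. -/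
def freqMeasure : Measure Freq :=
  (Measure.count : Measure ℤ).prod ((Measure.count : Measure ℤ).prod (volume : Measure ℝ))

/-- `√(𝐤² + ξ²)`. -/
def freqNorm (p : Freq) : ℝ :=
  Real.sqrt ((2 * Real.pi * p.1) ^ 2 + (2 * Real.pi * p.2.1) ^ 2 + p.2.2 ^ 2)

/-- The Fourier transform of an integrable function on `T₂`,
`(2π)^(-1/2) ∫ e^{i(k₁x₁ + k₂x₂ + ξx₃)} f(x) dx`. -/
def fourierT (f : CylCell → ℂ) (p : Freq) : ℂ :=
  ((1 / Real.sqrt (2 * Real.pi) : ℝ) : ℂ) *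
    ∫ x : CylCell, fourier p.1 x.1 * fourier p.2.1 x.2.1 *
      Complex.exp (Complex.I * (p.2.2 * x.2.2 : ℝ)) * f x

/-- `g = F⁻¹ q`, where `F⁻¹ : L²(Σ₂) → L²(T₂)` is the inverse of the unitary extension of the Fourier
transform: `⟨g, τ⟩ = ⟨q, F τ⟩` for all test functions `τ`. -/
structure IsInvFourier (q : Freq → ℂ) (g : CylCell → ℂ) : Prop where
  left : MemLp q 2 freqMeasure
  right : MemLp g 2
  eq : ∀ τ : CylCell → ℂ, IsTest τ →
    ∫ x, g x * starRingEnd ℂ (τ x) = ∫ p, q p * starRingEnd ℂ (fourierT τ p) ∂freqMeasure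

/-- `g = Λ f`, where `Λ = (-Δ)^(-1/2)` is defined for those `f ∈ L¹ ∩ L²` for which
`F f / √(𝐤² + ξ²)` lies in `L²(Σ₂)`, by `Λ f = F⁻¹ (F f / √(𝐤² + ξ²))`. -/
structure IsLambda (f g : CylCell → ℂ) : Prop where
  integrable : Integrable f
  memLp : MemLp f 2
  inv : IsInvFourier (fun p => fourierT f p / (freqNorm p : ℂ)) g

/-- The Coulomb integral `∫ |Λ f|²`, with value `∞` if `Λ f` is not defined.
`Λ f` is unique almost everywhere, so the infimum is over one class only. -/
def coulomb (f : CylCell → ℂ) : ℝ≥0∞ :=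
  ⨅ (g : CylCell → ℂ) (_ : IsLambda f g), ∫⁻ x, ‖g x‖ₑ ^ 2

/-- The total charge density `σ - e |ψ|²`. -/
def charge (e : ℝ) (σ : CylCell → ℝ) (ψ : CylCell → ℂ) (x : CylCell) : ℝ :=
  σ x - e * ‖ψ x‖ ^ 2

/-- The energy per cell `∫ [ħ²/(2m) |∇ψ|² + ½ |Λρ|²]` with `ρ = σ - e |ψ|²`. -/
def energy (ħ m e : ℝ) (σ : CylCell → ℝ) (ψ : CylCell → ℂ) : ℝ≥0∞ :=
  ENNReal.ofReal (ħ ^ 2 / (2 * m)) * dirichlet ψ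
    + (1 / 2) * coulomb (fun x => (charge e σ ψ x : ℂ))

/-- The neutral manifold `M₂`: the `ψ ∈ H¹(T₂)` with `∫ |ψ|² = Z`. -/
def neutralManifold (Z : ℝ) : Set (CylCell → ℂ) :=
  {ψ | MemH1 ψ ∧ ∫ x, ‖ψ x‖ ^ 2 = Z}

/-- The stationary Schrödinger–Poisson–Newton system for one ion at the origin of the cell, with ion
density `σ`, wave function `ψ`, real potential `φ` and real frequency `ω`:
`ħωψ = -ħ²/(2m) Δψ - eφψ`, `-Δφ = σ - e|ψ|²`, `0 = -⟨∇φ, σ⟩`. -/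
structure IsStationary (ħ m e : ℝ) (σ : CylCell → ℝ) (ψ : CylCell → ℂ) (φ : CylCell → ℝ) (ω : ℝ) :
    Prop where
  schrodinger : ∃ L : CylCell → ℂ, HasWeakLaplacian ψ L ∧
    ∀ᵐ x, ((ħ * ω : ℝ) : ℂ) * ψ x = -((ħ ^ 2 / (2 * m) : ℝ) : ℂ) * L x - ((e * φ x : ℝ) : ℂ) * ψ x
  poisson : ∃ L : CylCell → ℂ, HasWeakLaplacian (fun x => (φ x : ℂ)) L ∧
    ∀ᵐ x, -L x = (charge e σ ψ x : ℂ)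
  newton : ∀ j : Fin 3, ∃ g : CylCell → ℂ, HasWeakPartial j (fun x => (φ x : ℂ)) g ∧
    Integrable (fun x => g x * (σ x : ℂ)) ∧ 0 = -∫ x, g x * (σ x : ℂ)

end CylCell

end

/-! The minimizer comes from the direct method, carried out on the Fourier side. The mass is fixed,
so along a minimizing sequence `ψ_n`, `∇ψ_n` and the fields `Λρ_n` are bounded in `L²`, and a common
subsequence converges weakly in each component. Squared norms are weakly lower semicontinuous. What
remains is that the limit is admissible and that the limit of `Λρ_n` is the field of the limit
density (`IsState.of_weakTendsto`). Since `Λ` is characterized by pairings with test functions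
(`isLambda_of_forall_test`), it is enough that `|ψ_n|²` converges against test functions. This
follows from a Rellich theorem with a decaying weight (`tendsto_lintegral_weight_mul`). Densities
are square integrable because `H¹` embeds into `L⁴` (`MemH1.lintegral_norm_pow_four_lt_top`).

The cell is unbounded in `x₃`, so mass might escape to infinity. The Coulomb energy forbids it: if
`ρ ∈ L¹` had nonzero total charge, then `ρ̂(0,ξ)/|ξ|` would behave like `1/|ξ|` near zero and would
not be square integrable. Any limit with a finite field is therefore neutral, and its mass is `Z`
(`IsLambda.integral_eq_zero`). Condition II is what makes the set of finite-energy states nonempty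
(`exists_isState`).

The potential should be the inverse transform of `ρ̂/|p|²`, but this symbol is too singular at `p =
0`. Subtracting from the kernel its value at `x = 0` on the low frequencies changes the potential
formally by a constant and gains a factor `|ξ||x₃|`, so only `ρ̂/|p| ∈ L²` is needed. Cauchy–Schwarz
then yields growth of order `|x₃|^(1/2)` (`exists_norm_potential_le`). Against neutral densities of
bounded support the subtraction is invisible, so `⟨φ, f⟩ = ⟨Λρ, Λf⟩` for them, and Poisson's
equation holds.

Renormalizing `ψ + εη` to mass `Z` and differentiating the energy at `ε = 0` gives the weak
Schrödinger equation, with the Lagrange multiplier as frequency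
(`IsMinimalState.exists_re_weak_schrodinger`). The right side `φψ` may lose decay, but after
multiplication by `(1 + x₃²)⁻¹` it is in `L²`, so the weighted wave function is in `H²` and `ψ` is
in `H²_loc` (`memH2loc_of_hasWeakLaplacian`).

For Newton's equation, `∫ ∇φ ρ = 0` by oddness in frequency, and `∫ ∇φ |ψ|² = 0` because translating
`ψ` with `σ` held fixed cannot lower the energy. As `σ = ρ + e|ψ|²`, the force on the ion vanishes
too (`IsMinimalState.newton`). -/

noncomputable section

/-! ### Square integrable functions -/

section SquareIntegrable

variable {X : Type*} [MeasurableSpace X] {μ : Measure X}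

theorem eLpNorm_two_sq {E : Type*} [NormedAddCommGroup E] (f : X → E) :
    eLpNorm f 2 μ ^ 2 = ∫⁻ x, ‖f x‖ₑ ^ 2 ∂μ := by
  rw [eLpNorm_eq_lintegral_rpow_enorm_toReal two_ne_zero ENNReal.ofNat_ne_top]
  simp only [ENNReal.toReal_ofNat, ENNReal.rpow_ofNat]
  rw [← ENNReal.rpow_natCast, ← ENNReal.rpow_mul]
  norm_num

theorem memLp_two_iff_lintegral {E : Type*} [NormedAddCommGroup E] {f : X → E} :
    MemLp f 2 μ ↔ AEStronglyMeasurable f μ ∧ ∫⁻ x, ‖f x‖ₑ ^ 2 ∂μ < ∞ := by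
  rw [MemLp, ← eLpNorm_two_sq]
  simp [ENNReal.pow_lt_top_iff]

theorem MeasureTheory.MemLp.lintegral_sq_lt_top {E : Type*} [NormedAddCommGroup E] {f : X → E}
    (hf : MemLp f 2 μ) : ∫⁻ x, ‖f x‖ₑ ^ 2 ∂μ < ∞ :=
  (memLp_two_iff_lintegral.1 hf).2

theorem ofReal_norm_toLp_sq {f : X → ℂ} (hf : MemLp f 2 μ) :
    ENNReal.ofReal (‖hf.toLp f‖ ^ 2) = ∫⁻ x, ‖f x‖ₑ ^ 2 ∂μ := by
  rw [Lp.norm_toLp, ← eLpNorm_two_sq, ENNReal.ofReal_pow ENNReal.toReal_nonneg,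
    ENNReal.ofReal_toReal hf.eLpNorm_ne_top]

theorem lintegral_sq_eq_ofReal_integral {f : X → ℂ} (hf : MemLp f 2 μ) :
    ∫⁻ x, ‖f x‖ₑ ^ 2 ∂μ = ENNReal.ofReal (∫ x, ‖f x‖ ^ 2 ∂μ) := by
  rw [ofReal_integral_eq_lintegral_ofReal hf.norm.integrable_sq
    (Filter.Eventually.of_forall fun x => by positivity)]
  refine lintegral_congr fun x => ?_
  rw [ENNReal.ofReal_pow (norm_nonneg _), ofReal_norm]

end SquareIntegrable

/-! ### Plancherel kernels -/

/-- A bounded kernel `k` whose integral operator preserves the `L²` norm of functions in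
`L¹ ∩ L²`. -/
structure IsPlancherelKernel {P X : Type*} [MeasurableSpace P] [MeasurableSpace X]
    (k : P → X → ℂ) (ν : Measure P) (μ : Measure X) : Prop where
  measurable : Measurable (Function.uncurry k)
  bounded : ∃ C : ℝ, ∀ p x, ‖k p x‖ ≤ C
  plancherel : ∀ f : X → ℂ, Integrable f μ → MemLp f 2 μ →
    ∫⁻ p, ‖∫ x, k p x * f x ∂μ‖ₑ ^ 2 ∂ν = ∫⁻ x, ‖f x‖ₑ ^ 2 ∂μ

namespace IsPlancherelKernel

variable {P X Q Y : Type*} [MeasurableSpace P] [MeasurableSpace X] [MeasurableSpace Q]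
  [MeasurableSpace Y] {k : P → X → ℂ} {l : Q → Y → ℂ} {ν : Measure P} {μ : Measure X}
  {ν' : Measure Q} {μ' : Measure Y}

/-- Tonelli reduces the claim to Plancherel for `k` in the first variable, for almost every `y`,
followed by Plancherel for `l` applied to the partial transform, for almost every `p`. Boundedness
of the kernels keeps all sections integrable; the first step shows that almost all partial
transforms are square integrable. -/
theorem prod [SFinite ν] [SFinite μ] [SFinite ν'] [SFinite μ']
    (hk : IsPlancherelKernel k ν μ) (hl : IsPlancherelKernel l ν' μ') :
    IsPlancherelKernel (fun (p : P × Q) (x : X × Y) => k p.1 x.1 * l p.2 x.2)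
      (ν.prod ν') (μ.prod μ') := by
  obtain ⟨C, hC⟩ := hk.bounded
  obtain ⟨D, hD⟩ := hl.bounded
  have hkm : ∀ p, Measurable (k p) := fun p => hk.measurable.comp measurable_prodMk_left
  have hlm : ∀ p, Measurable (l p) := fun p => hl.measurable.comp measurable_prodMk_left
  refine ⟨?_, ⟨C * D, fun p x => ?_⟩, ?_⟩
  · exact (hk.measurable.comp ((measurable_fst.comp measurable_fst).prodMk
      (measurable_fst.comp measurable_snd))).mul (hl.measurable.comp
      ((measurable_snd.comp measurable_fst).prodMk (measurable_snd.comp measurable_snd)))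
  · rw [norm_mul]
    exact mul_le_mul (hC _ _) (hD _ _) (norm_nonneg _) ((norm_nonneg _).trans (hC p.1 x.1))
  -- Sections of an almost-everywhere measurable function need not be measurable, so `f` is first
  -- replaced by a strongly measurable representative.
  suffices H : ∀ f : X × Y → ℂ, StronglyMeasurable f → Integrable f (μ.prod μ') →
      MemLp f 2 (μ.prod μ') → ∫⁻ p, ‖∫ x, k p.1 x.1 * l p.2 x.2 * f x ∂μ.prod μ'‖ₑ ^ 2 ∂ν.prod ν'
        = ∫⁻ x, ‖f x‖ₑ ^ 2 ∂μ.prod μ' by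
    intro f hf1 hf2
    have e := hf1.aestronglyMeasurable.ae_eq_mk
    have := H _ hf1.aestronglyMeasurable.stronglyMeasurable_mk (hf1.congr e) (hf2.ae_eq e)
    rw [lintegral_congr_ae (g := fun x => ‖f x‖ₑ ^ 2)
      (by filter_upwards [e] with x hx; rw [hx])] at this
    rw [← this]
    refine lintegral_congr fun p => ?_
    congr 2
    exact integral_congr_ae (by filter_upwards [e] with x hx; rw [hx])
  intro f hfm hf1 hf2
  set h : P → Y → ℂ := fun p y => ∫ x, k p x * f (x, y) ∂μ with hh
  have hkf : StronglyMeasurable fun z : (P × Y) × X => k z.1.1 z.2 * f (z.2, z.1.2) :=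
    (hk.measurable.comp ((measurable_fst.comp measurable_fst).prodMk
      measurable_snd)).stronglyMeasurable.mul
      (hfm.comp_measurable (measurable_snd.prodMk (measurable_snd.comp measurable_fst)))
  have hhm : StronglyMeasurable (Function.uncurry h) := hkf.integral_prod_right
  have hsq : Measurable fun z : X × Y => ‖f z‖ₑ ^ 2 := hfm.measurable.enorm.pow_const 2
  have hksec : ∀ p, Integrable (fun z : X × Y => k p z.1 * f z) (μ.prod μ') := fun p =>
    hf1.bdd_mul ((hkm p).comp measurable_fst).aestronglyMeasurable
      (Filter.Eventually.of_forall fun z => hC p z.1)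
  have h1 : ∀ p, Integrable (h p) μ' := fun p => (hksec p).integral_prod_right
  have hsec : ∀ᵐ y ∂μ', ∫⁻ p, ‖h p y‖ₑ ^ 2 ∂ν = ∫⁻ x, ‖f (x, y)‖ₑ ^ 2 ∂μ := by
    have hfin : ∀ᵐ y ∂μ', ∫⁻ x, ‖f (x, y)‖ₑ ^ 2 ∂μ < ∞ := by
      refine ae_lt_top hsq.lintegral_prod_left' ?_
      rw [← lintegral_prod_symm' _ hsq]
      exact hf2.lintegral_sq_lt_top.ne
    filter_upwards [hf1.prod_left_ae, hfin] with y hy1 hy2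
    exact hk.plancherel _ hy1 (memLp_two_iff_lintegral.2 ⟨hy1.aestronglyMeasurable, hy2⟩)
  have htot : ∫⁻ p, ∫⁻ y, ‖h p y‖ₑ ^ 2 ∂μ' ∂ν = ∫⁻ x, ‖f x‖ₑ ^ 2 ∂μ.prod μ' := by
    rw [lintegral_lintegral_swap (hhm.measurable.enorm.pow_const 2).aemeasurable,
      lintegral_congr_ae hsec, lintegral_prod_symm' _ hsq]
  have h2 : ∀ᵐ p ∂ν, MemLp (h p) 2 μ' := by
    have : ∀ᵐ p ∂ν, ∫⁻ y, ‖h p y‖ₑ ^ 2 ∂μ' < ∞ := by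
      refine ae_lt_top (hhm.measurable.enorm.pow_const 2).lintegral_prod_right' ?_
      rw [htot]
      exact hf2.lintegral_sq_lt_top.ne
    filter_upwards [this] with p hp
    exact memLp_two_iff_lintegral.2 ⟨(h1 p).aestronglyMeasurable, hp⟩
  have hfub : ∀ p q, ∫ x, k p x.1 * l q x.2 * f x ∂μ.prod μ' = ∫ y, l q y * h p y ∂μ' := by
    intro p q
    have : Integrable (fun z : X × Y => l q z.2 * (k p z.1 * f z)) (μ.prod μ') :=
      (hksec p).bdd_mul ((hlm q).comp measurable_snd).aestronglyMeasurable
        (Filter.Eventually.of_forall fun z => hD q z.2)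
    rw [← integral_congr_ae (Filter.Eventually.of_forall fun z => by ring :
      (fun z : X × Y => l q z.2 * (k p z.1 * f z)) =ᵐ[μ.prod μ']
        fun z => k p z.1 * l q z.2 * f z), integral_prod_symm _ this]
    refine integral_congr_ae (Filter.Eventually.of_forall fun y => ?_)
    simp only [hh, integral_const_mul]
  have hlh : StronglyMeasurable fun z : (P × Q) × Y => l z.1.2 z.2 * h z.1.1 z.2 :=
    (hl.measurable.comp ((measurable_snd.comp measurable_fst).prodMk
      measurable_snd)).stronglyMeasurable.mul (hhm.comp_measurable
      ((measurable_fst.comp measurable_fst).prodMk measurable_snd))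
  simp only [hfub]
  rw [lintegral_prod _ (hlh.integral_prod_right.measurable.enorm.pow_const 2).aemeasurable, ← htot]
  refine lintegral_congr_ae ?_
  filter_upwards [h2] with p hp
  exact hl.plancherel _ (h1 p) hp

/-- This is Parseval for Fourier series. The kernel carries `e^{+2πinx}` while `fourierCoeff` uses
the opposite sign, hence the reindexing by `n ↦ -n`. -/
theorem circle : IsPlancherelKernel (fun (n : ℤ) (x : UnitAddCircle) => (fourier n x : ℂ))
    Measure.count volume := by
  refine ⟨measurable_from_prod_countable_right fun n => (fourier n).continuous.measurable,
    ⟨1, fun n x => (Circle.norm_coe _).le⟩, fun f hf1 hf2 => ?_⟩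
  have hv : (volume : Measure UnitAddCircle) = AddCircle.haarAddCircle := by
    rw [AddCircle.volume_eq_smul_haarAddCircle]; simp
  have hf2' : MemLp f 2 AddCircle.haarAddCircle := by rwa [hv] at hf2
  have hc : ∀ n, ∫ x, fourier n x * f x = fourierCoeff (hf2'.toLp f) (-n) := by
    intro n
    rw [fourierCoeff, neg_neg, hv]
    refine integral_congr_ae ?_
    filter_upwards [hf2'.coeFn_toLp] with x hx
    rw [hx, smul_eq_mul]
  have hs := hasSum_sq_fourierCoeff (hf2'.toLp f)
  rw [← (Equiv.neg ℤ).hasSum_iff] at hs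
  simp only [hc]
  rw [lintegral_count, lintegral_sq_eq_ofReal_integral hf2, hv]
  have e : ∫ t, ‖f t‖ ^ 2 ∂AddCircle.haarAddCircle
      = ∫ t, ‖hf2'.toLp f t‖ ^ 2 ∂AddCircle.haarAddCircle :=
    integral_congr_ae (by filter_upwards [hf2'.coeFn_toLp] with x hx; rw [hx])
  rw [e, ← hs.tsum_eq, ENNReal.ofReal_tsum_of_nonneg (fun _ => by
    simp only [Function.comp]; exact sq_nonneg _) hs.summable]
  refine tsum_congr fun n => ?_
  simp only [Function.comp, Equiv.neg_apply]
  rw [ENNReal.ofReal_pow (norm_nonneg _), ofReal_norm]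

end IsPlancherelKernel

-- The `L²` Fourier transform is an isometry by construction, so it suffices to identify it almost
-- everywhere with the integral transform of `f`. Both satisfy `∫ s · 𝓕f = ∫ 𝓕s · f` for smooth
-- compactly supported `s`, and such `s` separate locally integrable functions.
open FourierTransform in
theorem lintegral_fourier_sq {f : ℝ → ℂ} (hf1 : Integrable f) (hf2 : MemLp f 2) :
    ∫⁻ ξ, ‖𝓕 f ξ‖ₑ ^ 2 = ∫⁻ x, ‖f x‖ₑ ^ 2 := by
  set g : Lp ℂ 2 (volume : Measure ℝ) := 𝓕 (hf2.toLp f) with hg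
  have hc : Continuous (𝓕 f) := VectorFourier.fourierIntegral_continuous Real.continuous_fourierChar
    (by exact continuous_inner) hf1
  have key : (𝓕 f : ℝ → ℂ) =ᵐ[volume] g := by
    refine ae_eq_of_integral_contDiff_smul_eq hc.locallyIntegrable
      ((Lp.memLp g).locallyIntegrable (by norm_num)) fun χ hχ hχc => ?_
    have hχ' : ContDiff ℝ ((⊤ : ℕ∞) : WithTop ℕ∞) (fun x => (χ x : ℂ)) :=
      Complex.ofRealCLM.contDiff.comp hχ
    let s : SchwartzMap ℝ ℂ := (hχc.comp_left (g := fun t : ℝ => (t : ℂ)) (by simp)).toSchwartzMap hχ'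
    have h2 : ∫ x, s x * g x = ∫ x, (𝓕 s) x * f x := by
      have := congr($(Lp.fourier_toTemperedDistribution_eq (hf2.toLp f)) s)
      rw [TemperedDistribution.fourier_apply, Lp.toTemperedDistribution_apply,
        Lp.toTemperedDistribution_apply] at this
      simp only [smul_eq_mul] at this
      rw [hg, ← this]
      refine integral_congr_ae ?_
      filter_upwards [hf2.coeFn_toLp] with x hx
      rw [hx]
    have h3 : ∫ x, s x * 𝓕 f x = ∫ x, (𝓕 s) x * f x := by
      have := VectorFourier.integral_fourierIntegral_smul_eq_flip (μ := volume) (ν := volume)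
        (L := innerₗ ℝ) Real.continuous_fourierChar (by exact continuous_inner) s.integrable hf1
      simp only [smul_eq_mul, flip_innerₗ] at this
      exact this.symm
    have e : ∀ x, s x = (χ x : ℂ) := fun x => rfl
    simp only [e] at h2 h3
    simp only [Complex.real_smul]
    rw [h2, h3]
  calc ∫⁻ ξ, ‖𝓕 f ξ‖ₑ ^ 2 = ∫⁻ ξ, ‖g ξ‖ₑ ^ 2 :=
        lintegral_congr_ae (by filter_upwards [key] with x hx; rw [hx])
    _ = ENNReal.ofReal (‖g‖ ^ 2) := by
        rw [← ofReal_norm_toLp_sq (Lp.memLp g), Lp.toLp_coeFn]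
    _ = _ := by rw [hg, Lp.norm_fourier_eq, ofReal_norm_toLp_sq]

-- The kernel `e^{-2πixξ}` becomes `e^{ixξ}` under `ξ ↦ -ξ/(2π)`; the Jacobian `2π` cancels the
-- square of the prefactor `(2π)^(-1/2)`.
open FourierTransform in
theorem IsPlancherelKernel.line : IsPlancherelKernel
    (fun ξ x : ℝ => ((1 / Real.sqrt (2 * Real.pi) : ℝ) : ℂ) *
      Complex.exp (Complex.I * (ξ * x : ℝ))) volume volume := by
  refine ⟨by fun_prop, ⟨1 / Real.sqrt (2 * Real.pi), fun p x => ?_⟩, fun f hf1 hf2 => ?_⟩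
  · rw [norm_mul, mul_comm Complex.I, Complex.norm_exp_ofReal_mul_I, mul_one, Complex.norm_real,
      Real.norm_of_nonneg (by positivity)]
  have hpi : 0 < 2 * Real.pi := by positivity
  have h : ∀ ξ : ℝ, ∫ x, ((1 / Real.sqrt (2 * Real.pi) : ℝ) : ℂ) *
      Complex.exp (Complex.I * (ξ * x : ℝ)) * f x
      = ((1 / Real.sqrt (2 * Real.pi) : ℝ) : ℂ) * 𝓕 f (-(2 * Real.pi)⁻¹ * ξ) := by
    intro ξ
    rw [Real.fourier_real_eq_integral_exp_smul]
    simp only [mul_assoc, integral_const_mul, smul_eq_mul]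
    congr 2
    ext x
    congr 2
    push_cast
    field_simp
  simp only [h]
  rw [← lintegral_fourier_sq hf1 hf2]
  have hc : Continuous (𝓕 f) := VectorFourier.fourierIntegral_continuous Real.continuous_fourierChar
    (by exact continuous_inner) hf1
  have hm : Measurable fun ξ => ‖𝓕 f ξ‖ₑ ^ 2 := (hc.measurable.enorm).pow_const 2
  have hne : -(2 * Real.pi)⁻¹ ≠ 0 := by simp
  have := lintegral_map (μ := volume) hm (measurable_const_mul (-(2 * Real.pi)⁻¹))
  rw [Real.map_volume_mul_left hne, lintegral_smul_measure] at this
  simp only [enorm_mul, mul_pow]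
  rw [lintegral_const_mul (f := fun ξ => ‖𝓕 f (-(2 * Real.pi)⁻¹ * ξ)‖ₑ ^ 2) _
    (hm.comp (measurable_const_mul _)), ← this, smul_eq_mul, ← mul_assoc]
  have e : ‖((1 / Real.sqrt (2 * Real.pi) : ℝ) : ℂ)‖ₑ ^ 2
      * ENNReal.ofReal |(-(2 * Real.pi)⁻¹)⁻¹| = 1 := by
    rw [← ofReal_norm, Complex.norm_real, Real.norm_of_nonneg (by positivity),
      ← ENNReal.ofReal_pow (by positivity), ← ENNReal.ofReal_mul (by positivity), div_pow,
      Real.sq_sqrt hpi.le, inv_neg, inv_inv, abs_neg, abs_of_pos hpi, one_pow,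
      one_div_mul_cancel hpi.ne', ENNReal.ofReal_one]
  rw [e, one_mul]

namespace CylCell

/-! ### The Fourier transform on the cell -/

/-- The kernel `(2π)^(-1/2) e^{ip·x}` of the Fourier transform. -/
def wave (p : Freq) (x : CylCell) : ℂ :=
  fourier p.1 x.1 * (fourier p.2.1 x.2.1 * (((1 / Real.sqrt (2 * Real.pi) : ℝ) : ℂ) *
    Complex.exp (Complex.I * (p.2.2 * x.2.2 : ℝ))))

theorem isPlancherelKernel_wave : IsPlancherelKernel wave freqMeasure volume :=
  IsPlancherelKernel.circle.prod (IsPlancherelKernel.circle.prod IsPlancherelKernel.line)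

theorem fourierT_eq (f : CylCell → ℂ) (p : Freq) : fourierT f p = ∫ x, wave p x * f x := by
  rw [fourierT, ← integral_const_mul]
  congr 1
  ext x
  rw [wave]
  ring

theorem norm_wave (p : Freq) (x : CylCell) : ‖wave p x‖ = 1 / Real.sqrt (2 * Real.pi) := by
  rw [wave, norm_mul, norm_mul, norm_mul, mul_comm Complex.I, Complex.norm_exp_ofReal_mul_I,
    Complex.norm_real, Real.norm_of_nonneg (by positivity)]
  have h (n : ℤ) (y : UnitAddCircle) : ‖(fourier n y : ℂ)‖ = 1 := Circle.norm_coe _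
  rw [h, h]
  ring

theorem norm_wave_le_one (p : Freq) (x : CylCell) : ‖wave p x‖ ≤ 1 := by
  rw [norm_wave, div_le_one (by positivity), Real.one_le_sqrt]
  linarith [Real.pi_gt_three]

theorem continuous_wave (p : Freq) : Continuous (wave p) := by
  unfold wave
  fun_prop

theorem measurable_wave : Measurable (Function.uncurry wave) := isPlancherelKernel_wave.measurable

theorem lintegral_fourierT_sq {f : CylCell → ℂ} (hf1 : Integrable f) (hf2 : MemLp f 2) :
    ∫⁻ p, ‖fourierT f p‖ₑ ^ 2 ∂freqMeasure = ∫⁻ x, ‖f x‖ₑ ^ 2 := by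
  simp only [fourierT_eq]
  exact isPlancherelKernel_wave.plancherel f hf1 hf2

theorem integrable_wave_mul {f : CylCell → ℂ} (hf : Integrable f) (p : Freq) :
    Integrable fun x => wave p x * f x :=
  hf.bdd_mul (continuous_wave p).aestronglyMeasurable
    (Filter.Eventually.of_forall (norm_wave_le_one p))

theorem norm_fourierT_le (f : CylCell → ℂ) (p : Freq) : ‖fourierT f p‖ ≤ ∫ x, ‖f x‖ := by
  rw [fourierT_eq]
  by_cases hf : Integrable f
  · refine (norm_integral_le_integral_norm _).trans ?_
    refine integral_mono (integrable_wave_mul hf p).norm hf.norm fun x => ?_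
    simp only [norm_mul]
    exact mul_le_of_le_one_left (norm_nonneg _) (norm_wave_le_one p x)
  -- For non-integrable `f` both integrals take the default value zero: the wave has constant
  -- nonzero modulus, so integrability of the product would force that of `f`.
  · rw [integral_undef]
    · simp only [norm_zero]; positivity
    · intro h
      apply hf
      have h2 : Integrable fun x => (wave p x)⁻¹ * (wave p x * f x) := by
        refine h.bdd_mul (c := Real.sqrt (2 * Real.pi)) ?_ (Filter.Eventually.of_forall fun x => ?_)
        · exact ((continuous_wave p).measurable.inv).aestronglyMeasurable
        · rw [norm_inv, norm_wave]; simp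
      refine h2.congr (Filter.Eventually.of_forall fun x => ?_)
      have : wave p x ≠ 0 := by rw [← norm_pos_iff, norm_wave]; positivity
      field_simp

theorem fourierT_add {f g : CylCell → ℂ} (hf : Integrable f) (hg : Integrable g) (p : Freq) :
    fourierT (fun x => f x + g x) p = fourierT f p + fourierT g p := by
  simp only [fourierT_eq, mul_add]
  exact integral_add (integrable_wave_mul hf p) (integrable_wave_mul hg p)

theorem fourierT_sub {f g : CylCell → ℂ} (hf : Integrable f) (hg : Integrable g) (p : Freq) :
    fourierT (fun x => f x - g x) p = fourierT f p - fourierT g p := by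
  simp only [fourierT_eq, mul_sub]
  exact integral_sub (integrable_wave_mul hf p) (integrable_wave_mul hg p)

theorem fourierT_const_mul (c : ℂ) (f : CylCell → ℂ) (p : Freq) :
    fourierT (fun x => c * f x) p = c * fourierT f p := by
  simp only [fourierT_eq, mul_left_comm _ c, integral_const_mul]

theorem fourierT_congr_ae {f g : CylCell → ℂ} (h : f =ᵐ[volume] g) (p : Freq) :
    fourierT f p = fourierT g p := by
  simp only [fourierT_eq]
  exact integral_congr_ae (by filter_upwards [h] with x hx; rw [hx])

instance : SFinite freqMeasure := by unfold freqMeasure; infer_instance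

theorem stronglyMeasurable_fourierT {f : CylCell → ℂ} (hf : AEStronglyMeasurable f) :
    StronglyMeasurable (fourierT f) := by
  have e : fourierT f = fun p => ∫ x, wave p x * hf.mk f x := by
    ext p
    rw [fourierT_congr_ae hf.ae_eq_mk, fourierT_eq]
  rw [e]
  have : StronglyMeasurable fun z : Freq × CylCell => wave z.1 z.2 * hf.mk f z.2 :=
    measurable_wave.stronglyMeasurable.mul
      (hf.stronglyMeasurable_mk.comp_measurable measurable_snd)
  exact this.integral_prod_right

theorem memLp_fourierT {f : CylCell → ℂ} (hf1 : Integrable f) (hf2 : MemLp f 2) :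
    MemLp (fourierT f) 2 freqMeasure :=
  memLp_two_iff_lintegral.2 ⟨(stronglyMeasurable_fourierT hf1.aestronglyMeasurable).aestronglyMeasurable,
    by rw [lintegral_fourierT_sq hf1 hf2]; exact hf2.lintegral_sq_lt_top⟩

end CylCell

end

noncomputable section

namespace CylCell

/-! ### Smooth functions and test functions on the cell -/

/-- Translation invariance of the measure underlies integration by parts, and later the translation
argument for Newton's equation. -/
instance : (volume : Measure CylCell).IsAddHaarMeasure :=
  letI : (volume : Measure (UnitAddCircle × ℝ)).IsAddHaarMeasure :=
    Measure.prod.instIsAddHaarMeasure (volume : Measure UnitAddCircle) (volume : Measure ℝ)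
  Measure.prod.instIsAddHaarMeasure (volume : Measure UnitAddCircle)
    (volume : Measure (UnitAddCircle × ℝ))

theorem proj_zero : proj 0 = 0 := by
  simp [proj]

theorem proj_add (x y : Fin 3 → ℝ) : proj (x + y) = proj x + proj y := by
  simp [proj]

theorem continuous_proj : Continuous proj := by
  unfold proj
  fun_prop

theorem isOpenQuotientMap_proj : IsOpenQuotientMap proj := by
  have h1 : IsOpenQuotientMap (fun x : ℝ => (x : UnitAddCircle)) :=
    QuotientAddGroup.isOpenQuotientMap_mk
  let e : (Fin 3 → ℝ) ≃ₜ ℝ × ℝ × ℝ :=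
    { toFun := fun x => (x 0, x 1, x 2)
      invFun := fun y => ![y.1, y.2.1, y.2.2]
      left_inv := fun x => by ext i; fin_cases i <;> rfl
      right_inv := fun y => rfl
      continuous_toFun := by fun_prop
      continuous_invFun := by
        refine continuous_pi fun i => ?_
        fin_cases i <;> simp <;> fun_prop }
  exact (h1.prodMap (h1.prodMap IsOpenQuotientMap.id)).comp e.isOpenQuotientMap

theorem proj_surjective : Function.Surjective proj := isOpenQuotientMap_proj.surjective

/-- Functions on the cell with smooth lift to `ℝ³`. -/
def IsSmooth (a : CylCell → ℂ) : Prop :=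
  ContDiff ℝ ((⊤ : ℕ∞) : WithTop ℕ∞) (fun x : Fin 3 → ℝ => a (proj x))

namespace IsSmooth

variable {a b : CylCell → ℂ}

theorem continuous (ha : IsSmooth a) : Continuous a :=
  (isOpenQuotientMap_proj.continuous_comp_iff).1 (ContDiff.continuous ha)

theorem hasDerivAt (ha : IsSmooth a) (j : Fin 3) (x : CylCell) :
    HasDerivAt (fun t : ℝ => a (x + proj (Pi.single j t))) (partialD j a x) 0 := by
  obtain ⟨y, rfl⟩ := proj_surjective x
  have h1 : DifferentiableAt ℝ (fun z : Fin 3 → ℝ => a (proj z)) (y + Pi.single j 0) :=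
    (ContDiff.differentiable ha (by simp)) _
  have h2 : HasDerivAt (fun t : ℝ => y + Pi.single j t) (Pi.single j (1 : ℝ) : Fin 3 → ℝ) 0 :=
    (hasDerivAt_single j (0 : ℝ)).const_add y
  have h3 := h1.hasFDerivAt.comp_hasDerivAt (0 : ℝ) h2
  simp only [Function.comp_def, proj_add] at h3
  exact h3.differentiableAt.hasDerivAt

theorem partialD_proj (ha : IsSmooth a) (j : Fin 3) (y : Fin 3 → ℝ) :
    partialD j a (proj y) = fderiv ℝ (fun z : Fin 3 → ℝ => a (proj z)) y (Pi.single j 1) := by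
  have h1 : DifferentiableAt ℝ (fun z : Fin 3 → ℝ => a (proj z)) (y + Pi.single j 0) :=
    (ContDiff.differentiable ha (by simp)) _
  have h2 : HasDerivAt (fun t : ℝ => y + Pi.single j t) (Pi.single j (1 : ℝ) : Fin 3 → ℝ) 0 :=
    (hasDerivAt_single j (0 : ℝ)).const_add y
  have h3 := h1.hasFDerivAt.comp_hasDerivAt (0 : ℝ) h2
  simp only [Function.comp_def, proj_add, Pi.single_zero, add_zero] at h3
  exact h3.deriv

protected theorem partialD (ha : IsSmooth a) (j : Fin 3) : IsSmooth (partialD j a) := by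
  unfold IsSmooth
  simp only [ha.partialD_proj]
  exact (ContDiff.fderiv_right ha (by simp)).clm_apply contDiff_const

theorem hasDerivAt' (ha : IsSmooth a) (j : Fin 3) (x : CylCell) (t : ℝ) :
    HasDerivAt (fun t : ℝ => a (x + proj (Pi.single j t)))
      (partialD j a (x + proj (Pi.single j t))) t := by
  have h := ha.hasDerivAt j (x + proj (Pi.single j t))
  have h2 : HasDerivAt (fun s : ℝ => s - t) 1 t := (hasDerivAt_id t).sub_const t
  have h0 : (0 : ℝ) = t - t := by simp
  rw [h0] at h
  have h3 := HasDerivAt.scomp (h := fun s : ℝ => s - t) t h h2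
  simp only [one_smul, Function.comp_def] at h3
  refine h3.congr_of_eventuallyEq (Filter.Eventually.of_forall fun s => ?_)
  simp only
  rw [add_assoc, ← proj_add, ← Pi.single_add, add_sub_cancel]

theorem mul (ha : IsSmooth a) (hb : IsSmooth b) : IsSmooth fun x => a x * b x :=
  ContDiff.mul ha hb

theorem add (ha : IsSmooth a) (hb : IsSmooth b) : IsSmooth fun x => a x + b x :=
  ContDiff.add ha hb

theorem const (c : ℂ) : IsSmooth fun _ => c := contDiff_const

theorem star (ha : IsSmooth a) : IsSmooth fun x => starRingEnd ℂ (a x) :=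
  Complex.conjCLE.contDiff.comp ha

theorem partialD_mul (ha : IsSmooth a) (hb : IsSmooth b) (j : Fin 3) (x : CylCell) :
    partialD j (fun x => a x * b x) x = partialD j a x * b x + a x * partialD j b x := by
  have := ((ha.hasDerivAt j x).mul (hb.hasDerivAt j x)).deriv
  have e : x + proj (Pi.single j (0 : ℝ)) = x := by simp [proj]
  simp only [e] at this
  exact this

theorem partialD_star (ha : IsSmooth a) (j : Fin 3) (x : CylCell) :
    partialD j (fun x => starRingEnd ℂ (a x)) x = starRingEnd ℂ (partialD j a x) :=
  (Complex.conjCLE.toContinuousLinearMap.hasFDerivAt.comp_hasDerivAt (0 : ℝ)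
    (ha.hasDerivAt j x)).deriv

theorem comp_height {χ : ℝ → ℂ} (hχ : ContDiff ℝ ((⊤ : ℕ∞) : WithTop ℕ∞) χ) :
    IsSmooth fun x => χ x.2.2 :=
  hχ.comp (contDiff_apply ℝ ℝ (2 : Fin 3))

end IsSmooth

theorem partialD_const_mul (c : ℂ) (a : CylCell → ℂ) (j : Fin 3) (x : CylCell) :
    partialD j (fun x => c * a x) x = c * partialD j a x := by
  simp [partialD]

theorem partialD_comp_height (χ : ℝ → ℂ) (j : Fin 3) (x : CylCell) :
    partialD j (fun x => χ x.2.2) x = if j = 2 then deriv χ x.2.2 else 0 := by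
  unfold partialD
  split_ifs with h
  · subst h
    simp only [proj, Prod.snd_add, Pi.single_eq_same]
    rw [deriv_comp_const_add (f := χ), add_zero]
  · have : (2 : Fin 3) ≠ j := fun e => h e.symm
    simp [proj, Pi.single_eq_of_ne this]

/-- The set `|x₃| ≤ R`. -/
def slab (R : ℝ) : Set CylCell := {x | |x.2.2| ≤ R}

theorem isCompact_slab (R : ℝ) : IsCompact (slab R) := by
  have : slab R = Set.univ ×ˢ (Set.univ ×ˢ Set.Icc (-R) R) := by
    ext x; simp [slab, abs_le]
  rw [this]
  exact isCompact_univ.prod (isCompact_univ.prod isCompact_Icc)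

theorem exists_subset_slab {K : Set CylCell} (hK : IsCompact K) : ∃ R, 0 ≤ R ∧ K ⊆ slab R := by
  obtain ⟨C, hC⟩ := hK.exists_bound_of_continuousOn (f := fun x : CylCell => x.2.2)
    (by fun_prop)
  exact ⟨|C|, abs_nonneg C, fun x hx => (hC x hx).trans (le_abs_self C)⟩

namespace IsTest

variable {τ τ' a : CylCell → ℂ}

theorem isSmooth (h : IsTest τ) : IsSmooth τ := h.smooth

theorem continuous (h : IsTest τ) : Continuous τ := h.isSmooth.continuous

theorem exists_slab (h : IsTest τ) : ∃ R, 0 ≤ R ∧ ∀ x, R < |x.2.2| → τ x = 0 := by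
  obtain ⟨R, hR0, hR⟩ := exists_subset_slab h.compact
  exact ⟨R, hR0, fun x hx => image_eq_zero_of_notMem_tsupport fun hx' => not_le.2 hx (hR hx')⟩

theorem of_slab (ha : IsSmooth τ) {R : ℝ} (h : ∀ x, R < |x.2.2| → τ x = 0) : IsTest τ :=
  ⟨ha, HasCompactSupport.intro (isCompact_slab R) fun x hx => h x (not_le.1 hx)⟩

protected theorem partialD (h : IsTest τ) (j : Fin 3) : IsTest (partialD j τ) := by
  refine ⟨h.isSmooth.partialD j, HasCompactSupport.intro h.compact fun x hx => ?_⟩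
  have h1 : τ =ᶠ[nhds x] 0 := notMem_tsupport_iff_eventuallyEq.1 hx
  have h2 : Filter.Tendsto (fun t : ℝ => x + proj (Pi.single j t)) (nhds 0) (nhds x) := by
    have : Continuous fun t : ℝ => x + proj (Pi.single j t) :=
      continuous_const.add (continuous_proj.comp (continuous_single (A := fun _ : Fin 3 => ℝ) j))
    convert! this.tendsto 0 using 2
    simp [proj]
  have h3 : (fun t : ℝ => τ (x + proj (Pi.single j t))) =ᶠ[nhds 0] fun _ => 0 := h2.eventually h1
  rw [partialD, h3.deriv_eq, deriv_const]

theorem memLp (h : IsTest τ) (p : ℝ≥0∞) : MemLp τ p :=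
  h.continuous.memLp_of_hasCompactSupport h.compact

theorem integrable (h : IsTest τ) : Integrable τ := h.continuous.integrable_of_hasCompactSupport h.compact

theorem exists_bound (h : IsTest τ) : ∃ C, ∀ x, ‖τ x‖ ≤ C :=
  h.compact.exists_bound_of_continuous h.continuous

theorem smooth_mul (ha : IsSmooth a) (h : IsTest τ) : IsTest fun x => a x * τ x :=
  ⟨ha.mul h.isSmooth, h.compact.mul_left⟩

theorem add (h : IsTest τ) (h' : IsTest τ') : IsTest fun x => τ x + τ' x :=
  ⟨h.isSmooth.add h'.isSmooth, h.compact.add h'.compact⟩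

theorem const_mul (c : ℂ) (h : IsTest τ) : IsTest fun x => c * τ x :=
  h.smooth_mul (.const c)

theorem star (h : IsTest τ) : IsTest fun x => starRingEnd ℂ (τ x) :=
  ⟨h.isSmooth.star, h.compact.comp_left (map_zero _)⟩

/-- The integral of `τ(x + t e_j)` does not depend on `t`, by translation invariance; its derivative
at `t = 0`, taken under the integral sign, is the integral of the partial derivative. -/
theorem integral_partialD (h : IsTest τ) (j : Fin 3) : ∫ x, partialD j τ x = 0 := by
  obtain ⟨R, -, hR⟩ := (h.partialD j).exists_slab
  obtain ⟨C, hC⟩ := (h.partialD j).exists_bound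
  have hC0 : 0 ≤ C := (norm_nonneg _).trans (hC 0)
  have hconst : (fun t : ℝ => ∫ x, τ (x + proj (Pi.single j t))) = fun _ => ∫ x, τ x := by
    ext t
    exact integral_add_right_eq_self _ _
  have hd := hasDerivAt_integral_of_dominated_loc_of_deriv_le (μ := (volume : Measure CylCell))
    (F := fun (t : ℝ) x => τ (x + proj (Pi.single j t)))
    (F' := fun (t : ℝ) x => partialD j τ (x + proj (Pi.single j t))) (x₀ := 0)
    -- For `|t| < 1` a translation changes the height by less than one, so all the derivatives
    -- vanish outside the slab enlarged by one.
    (bound := (slab (R + 1)).indicator fun _ => C) (Metric.ball_mem_nhds 0 one_pos)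
    (Filter.Eventually.of_forall fun t =>
      (h.continuous.comp (continuous_add_const _)).aestronglyMeasurable)
    (by simpa [proj_zero] using h.integrable)
    (((h.partialD j).continuous.comp (continuous_add_const _)).aestronglyMeasurable)
    (Filter.Eventually.of_forall fun x t ht => ?_)
    ((integrableOn_const (isCompact_slab _).measure_lt_top.ne).integrable_indicator
      (isCompact_slab _).measurableSet)
    (Filter.Eventually.of_forall fun x t ht => h.isSmooth.hasDerivAt' j x t)
  · rw [hconst] at hd
    have := hd.2.unique (hasDerivAt_const 0 _)
    simpa [proj_zero] using this
  · by_cases hx : x ∈ slab (R + 1)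
    · rw [Set.indicator_of_mem hx]; exact hC _
    · rw [Set.indicator_of_notMem hx, hR, norm_zero]
      have hx' : R + 1 < |x.2.2| := not_le.1 hx
      have ht' : |t| < 1 := by simpa using ht
      have h3 : |(proj (Pi.single j t)).2.2| ≤ |t| := by
        simp only [proj]
        by_cases e : j = 2
        · subst e; simp
        · rw [Pi.single_eq_of_ne (fun e' => e e'.symm)]; simp
      have : |x.2.2| ≤ |(x + proj (Pi.single j t)).2.2| + |(proj (Pi.single j t)).2.2| := by
        have := abs_sub (x + proj (Pi.single j t)).2.2 (proj (Pi.single j t)).2.2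
        simpa using this
      linarith

end IsTest

theorem integral_smooth_mul_partialD {a τ : CylCell → ℂ} (ha : IsSmooth a) (h : IsTest τ)
    (j : Fin 3) : ∫ x, a x * partialD j τ x = -∫ x, partialD j a x * τ x := by
  have h0 := (h.smooth_mul ha).integral_partialD j
  simp only [ha.partialD_mul h.isSmooth] at h0
  rw [integral_add ((h.smooth_mul (ha.partialD j)).integrable)
    (((h.partialD j).smooth_mul ha).integrable)] at h0
  linear_combination h0

/-! ### Plane waves -/

/-- The frequency vector `(𝐤, ξ)`. -/
def freqVec (p : Freq) : Fin 3 → ℝ := ![2 * Real.pi * p.1, 2 * Real.pi * p.2.1, p.2.2]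

theorem freqNorm_sq (p : Freq) : freqNorm p ^ 2 = ∑ j, freqVec p j ^ 2 := by
  rw [freqNorm, Real.sq_sqrt (by positivity)]
  simp [freqVec, Fin.sum_univ_three]

theorem freqNorm_nonneg (p : Freq) : 0 ≤ freqNorm p := Real.sqrt_nonneg _

theorem abs_freqVec_le (p : Freq) (j : Fin 3) : |freqVec p j| ≤ freqNorm p := by
  apply abs_le_of_sq_le_sq _ (freqNorm_nonneg p)
  rw [freqNorm_sq]
  exact Finset.single_le_sum (f := fun j => freqVec p j ^ 2) (fun _ _ => sq_nonneg _)
    (Finset.mem_univ j)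

theorem measurable_freqVec (j : Fin 3) : Measurable fun p => freqVec p j := by
  fin_cases j <;> simp only [freqVec, Fin.mk_one, Fin.isValue, Fin.zero_eta, Fin.reduceFinMk,
    Matrix.cons_val] <;> fun_prop

theorem measurable_freqNorm : Measurable freqNorm := by
  unfold freqNorm
  fun_prop

theorem wave_proj (p : Freq) (y : Fin 3 → ℝ) :
    wave p (proj y) = ((1 / Real.sqrt (2 * Real.pi) : ℝ) : ℂ) *
      Complex.exp (Complex.I * ((∑ j, freqVec p j * y j : ℝ) : ℂ)) := by
  have e1 : (Complex.I * ((∑ j, freqVec p j * y j : ℝ) : ℂ)) =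
      2 * Real.pi * Complex.I * p.1 * y 0 / (1 : ℝ) + (2 * Real.pi * Complex.I * p.2.1 * y 1 / (1 : ℝ)
        + Complex.I * (p.2.2 * y 2 : ℝ)) := by
    simp [freqVec, Fin.sum_univ_three]
    ring
  rw [e1, Complex.exp_add, Complex.exp_add, wave]
  simp only [proj]
  rw [fourier_coe_apply, fourier_coe_apply]
  ring

theorem isSmooth_wave (p : Freq) : IsSmooth (wave p) := by
  unfold IsSmooth
  simp only [wave_proj]
  have h : ContDiff ℝ ((⊤ : ℕ∞) : WithTop ℕ∞) fun y : Fin 3 → ℝ => ∑ j, freqVec p j * y j :=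
    ContDiff.sum fun j _ => contDiff_const.mul (contDiff_apply ℝ ℝ j)
  exact contDiff_const.mul (Complex.contDiff_exp.comp (contDiff_const.mul
    (Complex.ofRealCLM.contDiff.comp h)))

theorem wave_add (p : Freq) (x : CylCell) (y : Fin 3 → ℝ) : wave p (x + proj y) =
    Complex.exp (Complex.I * ((∑ j, freqVec p j * y j : ℝ) : ℂ)) * wave p x := by
  obtain ⟨x, rfl⟩ := proj_surjective x
  rw [← proj_add, wave_proj, wave_proj, mul_left_comm, ← Complex.exp_add, ← mul_add,
    ← Complex.ofReal_add, ← Finset.sum_add_distrib]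
  simp only [Pi.add_apply, mul_add, add_comm]

theorem partialD_wave (p : Freq) (j : Fin 3) (x : CylCell) :
    partialD j (wave p) x = Complex.I * freqVec p j * wave p x := by
  have h : ∀ t : ℝ, wave p (x + proj (Pi.single j t))
      = Complex.exp ((t : ℂ) * (Complex.I * freqVec p j)) * wave p x := by
    intro t
    rw [wave_add]
    congr 2
    simp only [Pi.single_apply, mul_ite, mul_zero, Finset.sum_ite_eq', Finset.mem_univ, if_true]
    push_cast
    ring
  unfold partialD
  simp only [h]
  have h1 : HasDerivAt (fun t : ℝ => (t : ℂ) * (Complex.I * freqVec p j))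
      (1 * (Complex.I * freqVec p j)) 0 := (Complex.ofRealCLM.hasDerivAt).mul_const _
  have h2 := (h1.cexp.mul_const (wave p x)).deriv
  rw [h2]
  simp

/-- Integration by parts moves the derivative onto the wave. The kernel is `e^{+ip·x}`, which is why
`∂_j` has the symbol `-i p_j` throughout. -/
theorem fourierT_partialD {τ : CylCell → ℂ} (h : IsTest τ) (j : Fin 3) (p : Freq) :
    fourierT (partialD j τ) p = -(Complex.I * freqVec p j) * fourierT τ p := by
  rw [fourierT_eq, fourierT_eq, integral_smooth_mul_partialD (isSmooth_wave p) h,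
    ← integral_const_mul, ← integral_neg]
  congr 1
  ext x
  rw [partialD_wave]
  ring

theorem fourierT_laplacian {τ : CylCell → ℂ} (h : IsTest τ) (p : Freq) :
    fourierT (fun x => ∑ j, partialD j (partialD j τ) x) p
      = -((freqNorm p ^ 2 : ℝ) : ℂ) * fourierT τ p := by
  have : fourierT (fun x => ∑ j, partialD j (partialD j τ) x) p
      = ∑ j, fourierT (partialD j (partialD j τ)) p := by
    simp only [fourierT_eq, Finset.mul_sum]
    exact integral_finsetSum _ fun j _ => integrable_wave_mul ((h.partialD j).partialD j).integrable p
  rw [this, freqNorm_sq]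
  push_cast
  rw [← Finset.sum_neg_distrib, Finset.sum_mul]
  refine Finset.sum_congr rfl fun j _ => ?_
  rw [fourierT_partialD (h.partialD j), fourierT_partialD h]
  linear_combination -(freqVec p j : ℂ) ^ 2 * fourierT τ p * (-Complex.I_sq)

end CylCell

end

/-! ### Uniqueness: transforms of test functions separate functions of frequency -/

noncomputable section

theorem inner_toLp {X : Type*} [MeasurableSpace X] {μ : Measure X} {f g : X → ℂ}
    (hf : MemLp f 2 μ) (hg : MemLp g 2 μ) :
    inner ℂ (hf.toLp f) (hg.toLp g) = ∫ x, g x * starRingEnd ℂ (f x) ∂μ := by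
  rw [L2.inner_def]
  refine integral_congr_ae ?_
  filter_upwards [hf.coeFn_toLp, hg.coeFn_toLp] with x h1 h2
  rw [h1, h2]
  simp

theorem integrable_mul_star {X : Type*} [MeasurableSpace X] {μ : Measure X} {f g : X → ℂ}
    (hf : MemLp f 2 μ) (hg : MemLp g 2 μ) : Integrable (fun x => f x * starRingEnd ℂ (g x)) μ :=
  hf.integrable_mul hg.star

theorem continuous_integral_exp {f : ℝ → ℂ} (hf : Integrable f) :
    Continuous fun ξ : ℝ => ∫ x : ℝ, Complex.exp (Complex.I * (ξ * x : ℝ)) * f x := by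
  refine continuous_of_dominated (bound := fun x => ‖f x‖) (fun ξ => ?_) (fun ξ => ?_) hf.norm ?_
  · exact (by fun_prop : Continuous fun x : ℝ =>
      Complex.exp (Complex.I * (ξ * x : ℝ))).aestronglyMeasurable.mul hf.aestronglyMeasurable
  · refine Filter.Eventually.of_forall fun x => ?_
    rw [norm_mul, mul_comm Complex.I, Complex.norm_exp_ofReal_mul_I, one_mul]
  · exact Filter.Eventually.of_forall fun x => by fun_prop

-- The transform of a test function is a Schwartz function; its decay of orders 0 and 4 suffices
-- because `(1 + ξ²)² ≤ 2 + 2ξ⁴`.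
open FourierTransform in
theorem exists_decay_integral_exp {χ : ℝ → ℂ} (hχ : ContDiff ℝ ((⊤ : ℕ∞) : WithTop ℕ∞) χ)
    (hc : HasCompactSupport χ) : ∃ C : ℝ, 0 ≤ C ∧
      ∀ ξ : ℝ, ‖∫ x : ℝ, Complex.exp (Complex.I * (ξ * x : ℝ)) * χ x‖ * (1 + ξ ^ 2) ^ 2 ≤ C := by
  let s : SchwartzMap ℝ ℂ := 𝓕 (hc.toSchwartzMap hχ)
  obtain ⟨C0, hC0, h0⟩ := s.decay 0 0
  obtain ⟨C4, hC4, h4⟩ := s.decay 4 0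
  simp only [norm_iteratedFDeriv_zero, pow_zero, one_mul] at h0 h4
  have hpi : 0 < 2 * Real.pi := by positivity
  have e : ∀ ξ : ℝ, ∫ x : ℝ, Complex.exp (Complex.I * (ξ * x : ℝ)) * χ x
      = s (-(2 * Real.pi)⁻¹ * ξ) := by
    intro ξ
    simp only [s, SchwartzMap.fourier_coe]
    rw [Real.fourier_real_eq_integral_exp_smul]
    congr 1
    ext x
    simp only [smul_eq_mul, HasCompactSupport.toSchwartzMap_toFun]
    congr 2
    push_cast
    field_simp
  refine ⟨2 * C0 + 2 * ((2 * Real.pi) ^ 4 * C4), by positivity, fun ξ => ?_⟩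
  rw [e]
  have h1 := h0 (-(2 * Real.pi)⁻¹ * ξ)
  have h2 := h4 (-(2 * Real.pi)⁻¹ * ξ)
  set v := ‖s (-(2 * Real.pi)⁻¹ * ξ)‖
  have hv : 0 ≤ v := norm_nonneg _
  have h3 : ξ ^ 4 * v ≤ (2 * Real.pi) ^ 4 * C4 := by
    calc ξ ^ 4 * v = (2 * Real.pi) ^ 4 * (‖-(2 * Real.pi)⁻¹ * ξ‖ ^ 4 * v) := by
          rw [Real.norm_eq_abs, Even.pow_abs (by decide)]
          field_simp
      _ ≤ _ := by gcongr
  nlinarith [mul_nonneg hv (sq_nonneg (ξ ^ 2 - 1))]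

/-- A function of at most quadratic growth (in the `L²` sense) on the line vanishes if it is
orthogonal to the Fourier transforms of all test functions. -/
theorem ae_eq_zero_of_integral_exp_eq_zero {h : ℝ → ℂ}
    (h2 : MemLp (fun ξ : ℝ => h ξ / ((1 + ξ ^ 2 : ℝ) : ℂ)) 2)
    (H : ∀ χ : ℝ → ℂ, ContDiff ℝ ((⊤ : ℕ∞) : WithTop ℕ∞) χ → HasCompactSupport χ →
      ∫ ξ : ℝ, h ξ * starRingEnd ℂ (∫ x : ℝ, Complex.exp (Complex.I * (ξ * x : ℝ)) * χ x) = 0) :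
    h =ᵐ[volume] 0 := by
  -- Let `X` be the transform of `χ`. Testing with the translates of `χ` says that the Fourier
  -- transform of `h · conj X` vanishes at every point. The decay of `X` puts this product in `L¹ ∩
  -- L²`, so Plancherel makes it zero.
  have key : ∀ χ : ℝ → ℂ, ContDiff ℝ ((⊤ : ℕ∞) : WithTop ℕ∞) χ → HasCompactSupport χ →
      ∀ᵐ ξ, h ξ * starRingEnd ℂ (∫ x : ℝ, Complex.exp (Complex.I * (ξ * x : ℝ)) * χ x) = 0 := by
    intro χ hχ hc
    have hχi : Integrable χ := hχ.continuous.integrable_of_hasCompactSupport hc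
    set X : ℝ → ℂ := fun ξ => ∫ x : ℝ, Complex.exp (Complex.I * (ξ * x : ℝ)) * χ x with hX
    have hXc : Continuous X := continuous_integral_exp hχi
    obtain ⟨C, hC0, hC⟩ := exists_decay_integral_exp hχ hc
    have hpos : ∀ ξ : ℝ, 0 < 1 + ξ ^ 2 := fun ξ => by positivity
    set Y : ℝ → ℂ := fun ξ => ((1 + ξ ^ 2 : ℝ) : ℂ) * starRingEnd ℂ (X ξ) with hY
    have hYc : Continuous Y := by
      have := Complex.continuous_conj.comp hXc
      exact (by fun_prop : Continuous fun ξ : ℝ => ((1 + ξ ^ 2 : ℝ) : ℂ)).mul this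
    have hYn : ∀ ξ, ‖Y ξ‖ ≤ C * (1 + ξ ^ 2)⁻¹ := by
      intro ξ
      rw [hY]
      simp only [norm_mul, RCLike.norm_conj, Complex.norm_real, Real.norm_of_nonneg (hpos ξ).le]
      rw [← div_eq_mul_inv, le_div_iff₀ (hpos ξ)]
      calc _ = ‖X ξ‖ * (1 + ξ ^ 2) ^ 2 := by ring
        _ ≤ C := hC ξ
    have hYb : ∀ ξ, ‖Y ξ‖ ≤ C := fun ξ => (hYn ξ).trans
      (mul_le_of_le_one_right hC0 (inv_le_one_of_one_le₀ (by nlinarith [sq_nonneg ξ])))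
    have hYi : Integrable Y := (integrable_inv_one_add_sq.const_mul C).mono' hYc.aestronglyMeasurable
      (Filter.Eventually.of_forall hYn)
    have hY2 : MemLp Y 2 := by
      rw [memLp_two_iff_integrable_sq_norm hYc.aestronglyMeasurable]
      refine (hYi.norm.const_mul C).mono' (hYc.norm.pow 2).aestronglyMeasurable
        (Filter.Eventually.of_forall fun ξ => ?_)
      rw [Real.norm_of_nonneg (by positivity), sq]
      exact mul_le_mul_of_nonneg_right (hYb ξ) (norm_nonneg _)
    have heq : (fun ξ => h ξ * starRingEnd ℂ (X ξ)) = fun ξ => h ξ / ((1 + ξ ^ 2 : ℝ) : ℂ) * Y ξ := by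
      ext ξ
      have : ((1 + ξ ^ 2 : ℝ) : ℂ) ≠ 0 := by exact_mod_cast (hpos ξ).ne'
      rw [hY]
      field_simp
    have hF1 : Integrable fun ξ => h ξ * starRingEnd ℂ (X ξ) := by
      rw [heq]; exact h2.integrable_mul hY2
    have hF2 : MemLp (fun ξ => h ξ * starRingEnd ℂ (X ξ)) 2 := by
      rw [heq]
      refine (h2.const_mul (C : ℂ)).mono (h2.1.mul hYc.aestronglyMeasurable)
        (Filter.Eventually.of_forall fun ξ => ?_)
      rw [norm_mul, norm_mul (C : ℂ), mul_comm, Complex.norm_real, Real.norm_of_nonneg hC0]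
      exact mul_le_mul_of_nonneg_right (hYb ξ) (norm_nonneg _)
    have hz : ∀ s : ℝ, ∫ ξ : ℝ, ((1 / Real.sqrt (2 * Real.pi) : ℝ) : ℂ) *
        Complex.exp (Complex.I * (s * ξ : ℝ)) * (h ξ * starRingEnd ℂ (X ξ)) = 0 := by
      intro s
      have := H (fun x => χ (x + s)) (hχ.comp (contDiff_id.add contDiff_const))
        (hc.comp_homeomorph (Homeomorph.addRight s))
      have e : ∀ ξ : ℝ, ∫ x : ℝ, Complex.exp (Complex.I * (ξ * x : ℝ)) * χ (x + s)
          = Complex.exp (-(Complex.I * (s * ξ : ℝ))) * X ξ := by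
        intro ξ
        rw [hX, ← integral_const_mul, ← integral_add_right_eq_self (fun x : ℝ =>
          Complex.exp (-(Complex.I * (s * ξ : ℝ))) *
            (Complex.exp (Complex.I * (ξ * x : ℝ)) * χ x)) s]
        refine integral_congr_ae (Filter.Eventually.of_forall fun x => ?_)
        simp only
        rw [← mul_assoc, ← Complex.exp_add]
        congr 2
        push_cast
        ring
      simp only [mul_assoc, integral_const_mul]
      rw [← mul_zero ((1 / Real.sqrt (2 * Real.pi) : ℝ) : ℂ), ← this]
      congr 1
      refine integral_congr_ae (Filter.Eventually.of_forall fun ξ => ?_)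
      simp only [e, map_mul, ← Complex.exp_conj, map_neg, Complex.conj_I, Complex.conj_ofReal]
      simp only [neg_mul, neg_neg]
      ring
    have hP := IsPlancherelKernel.line.plancherel _ hF1 hF2
    simp only [hz, enorm_zero, ne_eq, OfNat.ofNat_ne_zero, not_false_eq_true, zero_pow,
      lintegral_const, zero_mul] at hP
    rw [eq_comm, lintegral_eq_zero_iff' (hF1.aestronglyMeasurable.enorm.pow_const 2)] at hP
    filter_upwards [hP] with ξ hξ
    exact enorm_eq_zero.1 (pow_eq_zero_iff two_ne_zero |>.1 hξ)
  -- It remains to find enough `χ` with nonvanishing transform. The transform of a bump is nonzero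
  -- near 0, since its integral is positive. Modulation by rational frequencies `q` moves this
  -- neighbourhood to cover the line, with only countably many null sets.
  let B : ContDiffBump (0 : ℝ) := ⟨1, 2, one_pos, one_lt_two⟩
  have hB1 : ContDiff ℝ ((⊤ : ℕ∞) : WithTop ℕ∞) fun x => (B x : ℂ) :=
    Complex.ofRealCLM.contDiff.comp B.contDiff
  have hB2 : HasCompactSupport fun x => (B x : ℂ) :=
    B.hasCompactSupport.comp_left (g := fun t : ℝ => (t : ℂ)) (by simp)
  have hBi : Integrable fun x => (B x : ℂ) := hB1.continuous.integrable_of_hasCompactSupport hB2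
  set X : ℝ → ℂ := fun ξ => ∫ x : ℝ, Complex.exp (Complex.I * (ξ * x : ℝ)) * B x with hX
  have hXc : Continuous X := continuous_integral_exp hBi
  have hX0 : X 0 ≠ 0 := by
    simp only [hX, zero_mul, Complex.ofReal_zero, mul_zero, Complex.exp_zero, one_mul]
    rw [integral_complex_ofReal]
    exact_mod_cast (B.integral_pos (μ := volume)).ne'
  obtain ⟨δ, hδ, hball⟩ := Metric.mem_nhds_iff.1 (hXc.continuousAt.eventually_ne hX0)
  have hq : ∀ q : ℚ, ∀ᵐ ξ, h ξ * starRingEnd ℂ (X (ξ - q)) = 0 := by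
    intro q
    have := key (fun x => Complex.exp (Complex.I * (-q * x : ℝ)) * B x)
      (ContDiff.mul (Complex.contDiff_exp.comp (contDiff_const.mul
        (Complex.ofRealCLM.contDiff.comp (contDiff_const.mul contDiff_id)))) hB1) hB2.mul_left
    filter_upwards [this] with ξ hξ
    rw [hX]
    convert hξ using 3
    refine integral_congr_ae (Filter.Eventually.of_forall fun x => ?_)
    simp only
    rw [← mul_assoc, ← Complex.exp_add]
    congr 2
    push_cast
    ring
  filter_upwards [ae_all_iff.2 hq] with ξ hξ
  obtain ⟨q, hq1, hq2⟩ := exists_rat_btwn (show ξ - δ < ξ by linarith)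
  have hne : X (ξ - q) ≠ 0 := hball (by
    rw [Metric.mem_ball, dist_zero_right, Real.norm_eq_abs, abs_lt]
    constructor <;> linarith)
  simpa [hne] using hξ q

namespace CylCell

/-! ### Sections of the frequency space -/

theorem measurableEmbedding_section (n₁ n₂ : ℤ) :
    MeasurableEmbedding fun ξ : ℝ => ((n₁, n₂, ξ) : Freq) :=
  (measurableEmbedding_prodMk_left n₁).comp (measurableEmbedding_prodMk_left n₂)

theorem freqMeasure_restrict (n₁ n₂ : ℤ) :
    freqMeasure.restrict ({n₁} ×ˢ ({n₂} ×ˢ Set.univ))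
      = (volume : Measure ℝ).map fun ξ => ((n₁, n₂, ξ) : Freq) := by
  rw [freqMeasure, ← Measure.prod_restrict, ← Measure.prod_restrict, Measure.restrict_univ,
    Measure.restrict_singleton, Measure.restrict_singleton]
  simp only [Measure.count_singleton, one_smul, Measure.dirac_prod]
  rw [Measure.map_map measurable_prodMk_left measurable_prodMk_left]
  rfl

theorem ae_freqMeasure_iff {P : Freq → Prop} :
    (∀ᵐ p ∂freqMeasure, P p) ↔ ∀ n₁ n₂ : ℤ, ∀ᵐ ξ : ℝ, P (n₁, n₂, ξ) := by
  have hU : (⋃ n : ℤ × ℤ, ({n.1} ×ˢ ({n.2} ×ˢ Set.univ) : Set Freq)) = Set.univ := by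
    ext ⟨a, b, c⟩; simp
  have h1 : (∀ᵐ p ∂freqMeasure, P p) ↔
      ∀ n : ℤ × ℤ, ∀ᵐ p ∂freqMeasure.restrict ({n.1} ×ˢ ({n.2} ×ˢ Set.univ)), P p := by
    rw [← ae_restrict_iUnion_iff, hU, Measure.restrict_univ]
  rw [h1, Prod.forall]
  refine forall_congr' fun n₁ => forall_congr' fun n₂ => ?_
  rw [freqMeasure_restrict, (measurableEmbedding_section n₁ n₂).ae_map_iff]

theorem MemLp.section {q : Freq → ℂ} (hq : MemLp q 2 freqMeasure) (n₁ n₂ : ℤ) :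
    MemLp (fun ξ : ℝ => q (n₁, n₂, ξ)) 2 := by
  have := hq.restrict ({n₁} ×ˢ ({n₂} ×ˢ Set.univ))
  rw [freqMeasure_restrict, (measurableEmbedding_section n₁ n₂).memLp_map_measure_iff] at this
  exact this

theorem integral_section {q : Freq → ℂ} (n₁ n₂ : ℤ)
    (h : ∀ p : Freq, ¬ (p.1 = n₁ ∧ p.2.1 = n₂) → q p = 0) :
    ∫ p, q p ∂freqMeasure = ∫ ξ : ℝ, q (n₁, n₂, ξ) := by
  rw [← setIntegral_eq_integral_of_forall_compl_eq_zero (s := {n₁} ×ˢ ({n₂} ×ˢ Set.univ)),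
    freqMeasure_restrict, (measurableEmbedding_section n₁ n₂).integral_map]
  intro p hp
  apply h
  simpa using hp

theorem integral_fourier_mul_fourier_neg (m n : ℤ) :
    ∫ x : UnitAddCircle, (fourier m x : ℂ) * fourier (-n) x = if m = n then 1 else 0 := by
  have hv : (volume : Measure UnitAddCircle) = AddCircle.haarAddCircle := by
    rw [AddCircle.volume_eq_smul_haarAddCircle]; simp
  have := (orthonormal_iff_ite.1 (orthonormal_fourier (T := 1))) n m
  rw [ContinuousMap.inner_toLp] at this
  simp only [← fourier_neg] at this
  rw [hv, this]
  simp [eq_comm]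

theorem isTest_tensor (n₁ n₂ : ℤ) {χ : ℝ → ℂ} (hχ : ContDiff ℝ ((⊤ : ℕ∞) : WithTop ℕ∞) χ)
    (hc : HasCompactSupport χ) :
    IsTest fun x => fourier (-n₁) x.1 * (fourier (-n₂) x.2.1 * χ x.2.2) := by
  have hs : ∀ x : CylCell, fourier (-n₁) x.1 * (fourier (-n₂) x.2.1 * χ x.2.2)
      = ((Real.sqrt (2 * Real.pi) : ℝ) : ℂ) * wave (-n₁, -n₂, 0) x * χ x.2.2 := by
    intro x
    have : ((Real.sqrt (2 * Real.pi) : ℝ) : ℂ) ≠ 0 := by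
      exact_mod_cast (by positivity : Real.sqrt (2 * Real.pi) ≠ 0)
    rw [wave]
    simp only [zero_mul, Complex.ofReal_zero, mul_zero, Complex.exp_zero, mul_one]
    push_cast
    field_simp
  simp only [hs]
  obtain ⟨R, hR⟩ := hc.isCompact.isBounded.subset_closedBall 0
  refine IsTest.of_slab (R := R) (((IsSmooth.const _).mul (isSmooth_wave _)).mul
    (IsSmooth.comp_height hχ)) fun x hx => ?_
  have : χ x.2.2 = 0 := image_eq_zero_of_notMem_tsupport fun hx' => by
    have := hR hx'
    rw [mem_closedBall_zero_iff, Real.norm_eq_abs] at this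
    linarith
  rw [this, mul_zero]

/-- By orthogonality of characters, such a test function sees only one line of the frequency space.
This reduces uniqueness on `Σ₂` to uniqueness on `ℝ`. -/
theorem fourierT_tensor (n₁ n₂ : ℤ) (χ : ℝ → ℂ) (p : Freq) :
    fourierT (fun x => fourier (-n₁) x.1 * (fourier (-n₂) x.2.1 * χ x.2.2)) p
      = if p.1 = n₁ ∧ p.2.1 = n₂ then ((1 / Real.sqrt (2 * Real.pi) : ℝ) : ℂ) *
        ∫ x : ℝ, Complex.exp (Complex.I * (p.2.2 * x : ℝ)) * χ x else 0 := by
  rw [fourierT_eq]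
  have e : ∀ x : CylCell, wave p x * (fourier (-n₁) x.1 * (fourier (-n₂) x.2.1 * χ x.2.2))
      = (fourier p.1 x.1 * fourier (-n₁) x.1) * ((fourier p.2.1 x.2.1 * fourier (-n₂) x.2.1) *
        (((1 / Real.sqrt (2 * Real.pi) : ℝ) : ℂ) *
          (Complex.exp (Complex.I * (p.2.2 * x.2.2 : ℝ)) * χ x.2.2))) := by
    intro x; rw [wave]; ring
  simp only [e]
  have h1 := integral_prod_mul (μ := (volume : Measure UnitAddCircle))
    (ν := (volume : Measure (UnitAddCircle × ℝ)))
    (fun x => (fourier p.1 x : ℂ) * fourier (-n₁) x)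
    (fun y => (fourier p.2.1 y.1 * fourier (-n₂) y.1) *
        (((1 / Real.sqrt (2 * Real.pi) : ℝ) : ℂ) *
          (Complex.exp (Complex.I * (p.2.2 * y.2 : ℝ)) * χ y.2)))
  have h2 := integral_prod_mul (μ := (volume : Measure UnitAddCircle)) (ν := (volume : Measure ℝ))
    (fun x => (fourier p.2.1 x : ℂ) * fourier (-n₂) x)
    (fun y => (((1 / Real.sqrt (2 * Real.pi) : ℝ) : ℂ) *
          (Complex.exp (Complex.I * (p.2.2 * y : ℝ)) * χ y)))
  refine h1.trans ?_
  rw [show (volume : Measure (UnitAddCircle × ℝ)) = (volume : Measure UnitAddCircle).prod volume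
    from rfl, h2, integral_fourier_mul_fourier_neg, integral_fourier_mul_fourier_neg,
    integral_const_mul]
  by_cases a : p.1 = n₁ <;> by_cases b : p.2.1 = n₂ <;> simp [a, b]

/-- A function of at most quadratic growth (in the `L²` sense) on the frequency space vanishes if it
is orthogonal to the Fourier transforms of all test functions. -/
theorem ae_eq_zero_of_integral_fourierT_eq_zero {h : Freq → ℂ}
    (h2 : MemLp (fun p => h p / ((1 + freqNorm p ^ 2 : ℝ) : ℂ)) 2 freqMeasure)
    (H : ∀ τ, IsTest τ → ∫ p, h p * starRingEnd ℂ (fourierT τ p) ∂freqMeasure = 0) :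
    h =ᵐ[freqMeasure] 0 := by
  have hpos : ∀ p, 0 < 1 + freqNorm p ^ 2 := fun p => by positivity
  refine ae_freqMeasure_iff.2 fun n₁ n₂ => ?_
  have hs := MemLp.section h2 n₁ n₂
  have hN : Measurable fun ξ : ℝ => freqNorm (n₁, n₂, ξ) :=
    measurable_freqNorm.comp (measurableEmbedding_section n₁ n₂).measurable
  set K : ℝ := (2 * Real.pi * n₁) ^ 2 + (2 * Real.pi * n₂) ^ 2 with hK
  have hK0 : 0 ≤ K := by positivity
  have hN2 : ∀ ξ : ℝ, freqNorm (n₁, n₂, ξ) ^ 2 = K + ξ ^ 2 := fun ξ => by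
    rw [freqNorm, Real.sq_sqrt (by positivity)]
  have hm : AEStronglyMeasurable fun ξ : ℝ => h (n₁, n₂, ξ) := by
    have : (fun ξ : ℝ => h (n₁, n₂, ξ)) = fun ξ : ℝ =>
        h (n₁, n₂, ξ) / ((1 + freqNorm (n₁, n₂, ξ) ^ 2 : ℝ) : ℂ) *
          ((1 + freqNorm (n₁, n₂, ξ) ^ 2 : ℝ) : ℂ) := by
      ext ξ
      rw [div_mul_cancel₀]
      exact_mod_cast (hpos _).ne'
    rw [this]
    refine hs.1.mul (Measurable.aestronglyMeasurable ?_)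
    fun_prop
  refine ae_eq_zero_of_integral_exp_eq_zero ?_ fun χ hχ hc => ?_
  · refine (hs.const_mul ((1 + K : ℝ) : ℂ)).mono (hm.mul (Measurable.aestronglyMeasurable
      (by fun_prop : Measurable fun ξ : ℝ => (((1 + ξ ^ 2 : ℝ) : ℂ))⁻¹)))
      (Filter.Eventually.of_forall fun ξ => ?_)
    have h0 : 0 < 1 + ξ ^ 2 := by positivity
    rw [norm_mul, norm_div, norm_div, Complex.norm_real, Complex.norm_real, Complex.norm_real,
      Real.norm_of_nonneg h0.le, Real.norm_of_nonneg (by positivity : 0 ≤ 1 + K),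
      Real.norm_of_nonneg (hpos _).le, hN2, mul_div_assoc', div_le_div_iff₀ h0 (by positivity)]
    have : 1 + (K + ξ ^ 2) ≤ (1 + K) * (1 + ξ ^ 2) := by nlinarith [mul_nonneg hK0 (sq_nonneg ξ)]
    nlinarith [norm_nonneg (h (n₁, n₂, ξ))]
  · have h3 := H _ (isTest_tensor n₁ n₂ hχ hc)
    rw [integral_section n₁ n₂ (fun p hp => by rw [fourierT_tensor, if_neg hp]; simp)] at h3
    simp only [fourierT_tensor, and_self, if_true, map_mul, Complex.conj_ofReal,
      mul_left_comm _ ((1 / Real.sqrt (2 * Real.pi) : ℝ) : ℂ), integral_const_mul] at h3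
    refine (mul_eq_zero.1 h3).resolve_left ?_
    exact_mod_cast (by positivity : (1 / Real.sqrt (2 * Real.pi)) ≠ 0)

end CylCell

end

noncomputable section

namespace CylCell

/-! ### The unitary Fourier transform -/

/-- The functions in `L¹ ∩ L²`. -/
def integrableSq : Submodule ℂ (CylCell → ℂ) where
  carrier := {f | Integrable f volume ∧ MemLp f 2 volume}
  add_mem' hf hg := ⟨hf.1.add hg.1, hf.2.add hg.2⟩
  zero_mem' := ⟨integrable_zero _ _ _, MemLp.zero⟩
  smul_mem' c _ hf := ⟨Integrable.smul c hf.1, MemLp.const_smul hf.2 c⟩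

/-- The inclusion of `L¹ ∩ L²` into `L²`. -/
def integrableSqToLp : integrableSq →ₗ[ℂ] Lp ℂ 2 (volume : Measure CylCell) where
  toFun f := f.2.2.toLp f
  map_add' f g := MemLp.toLp_add f.2.2 g.2.2
  map_smul' c f := MemLp.toLp_const_smul c f.2.2

/-- The Fourier transform on `L¹ ∩ L²`. -/
def fourierSq : integrableSq →ₗ[ℂ] Lp ℂ 2 freqMeasure where
  toFun f := (memLp_fourierT f.2.1 f.2.2).toLp (fourierT f)
  map_add' f g := by
    rw [← MemLp.toLp_add]
    exact MemLp.toLp_congr _ _ (Filter.Eventually.of_forall (fourierT_add f.2.1 g.2.1))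
  map_smul' c f := by
    rw [RingHom.id_apply, ← MemLp.toLp_const_smul]
    exact MemLp.toLp_congr _ _ (Filter.Eventually.of_forall fun p => fourierT_const_mul c f p)

theorem norm_fourierSq (f : integrableSq) : ‖fourierSq f‖ = ‖integrableSqToLp f‖ := by
  rw [← sq_eq_sq₀ (norm_nonneg _) (norm_nonneg _),
    ← ENNReal.ofReal_eq_ofReal_iff (sq_nonneg _) (sq_nonneg _)]
  refine (ofReal_norm_toLp_sq (memLp_fourierT f.2.1 f.2.2)).trans ((lintegral_fourierT_sq f.2.1 f.2.2).trans ?_)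
  exact (ofReal_norm_toLp_sq f.2.2).symm

theorem denseRange_integrableSqToLp : DenseRange integrableSqToLp := by
  rw [Metric.denseRange_iff]
  intro f r hr
  obtain ⟨g, hg1, hg2, hg3, hg4⟩ := (Lp.memLp f).exists_hasCompactSupport_eLpNorm_sub_le
    ENNReal.ofNat_ne_top (ε := ENNReal.ofReal (r / 2)) (by simpa using hr)
  refine ⟨⟨g, hg3.integrable_of_hasCompactSupport hg1, hg4⟩, ?_⟩
  have e : integrableSqToLp ⟨g, hg3.integrable_of_hasCompactSupport hg1, hg4⟩ = hg4.toLp g := rfl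
  rw [e, dist_eq_norm, ← Lp.toLp_coeFn f (Lp.memLp f), ← MemLp.toLp_sub, Lp.norm_toLp]
  refine lt_of_le_of_lt (ENNReal.toReal_le_of_le_ofReal (by positivity) hg2) (by linarith)

/-- The unitary extension of the Fourier transform. -/
def fourierL : Lp ℂ 2 (volume : Measure CylCell) →ₗᵢ[ℂ] Lp ℂ 2 freqMeasure where
  toLinearMap := fourierSq.extendOfNorm integrableSqToLp
  norm_map' f := by
    refine denseRange_integrableSqToLp.induction_on
      (p := fun f => ‖fourierSq.extendOfNorm integrableSqToLp f‖ = ‖f‖) f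
      (isClosed_eq (by fun_prop) (by fun_prop)) fun g => ?_
    rw [LinearMap.extendOfNorm_eq denseRange_integrableSqToLp
      ⟨1, fun x => by rw [one_mul, norm_fourierSq]⟩, norm_fourierSq]

theorem fourierL_toLp {f : CylCell → ℂ} (hf1 : Integrable f) (hf2 : MemLp f 2) :
    fourierL (hf2.toLp f) = (memLp_fourierT hf1 hf2).toLp (fourierT f) :=
  LinearMap.extendOfNorm_eq denseRange_integrableSqToLp
      ⟨1, fun x => by rw [one_mul, norm_fourierSq]⟩ (⟨f, hf1, hf2⟩ : integrableSq)

theorem memLp_div_of_memLp {q : Freq → ℂ} (hq : MemLp q 2 freqMeasure) :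
    MemLp (fun p => q p / ((1 + freqNorm p ^ 2 : ℝ) : ℂ)) 2 freqMeasure := by
  have hm := measurable_freqNorm
  refine hq.mono (hq.1.mul (by fun_prop : Measurable fun p : Freq =>
    (((1 + freqNorm p ^ 2 : ℝ) : ℂ))⁻¹).aestronglyMeasurable) (Filter.Eventually.of_forall fun p => ?_)
  rw [norm_div, Complex.norm_real, Real.norm_of_nonneg (by positivity)]
  exact div_le_self (norm_nonneg _) (by nlinarith [sq_nonneg (freqNorm p)])

/-- The pairing with test functions determines `q` because their transforms separate `L²(Σ₂)`.
Through this equivalence the definition by testing inherits linearity, Parseval and uniqueness from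
the isometry `fourierL`. -/
theorem isInvFourier_iff {q : Freq → ℂ} {f : CylCell → ℂ} (hq : MemLp q 2 freqMeasure)
    (hf : MemLp f 2) : IsInvFourier q f ↔ fourierL (hf.toLp f) = hq.toLp q := by
  have key : ∀ τ, (h : IsTest τ) → ∫ x, f x * starRingEnd ℂ (τ x)
      = inner ℂ ((memLp_fourierT h.integrable (h.memLp 2)).toLp (fourierT τ))
        (fourierL (hf.toLp f)) := fun τ h => by
    rw [← inner_toLp (h.memLp 2) hf, ← fourierL.inner_map_map, fourierL_toLp h.integrable]
  constructor
  · intro H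
    have h0 := ae_eq_zero_of_integral_fourierT_eq_zero
      (h := fun p => q p - fourierL (hf.toLp f) p)
      (memLp_div_of_memLp (hq.sub (Lp.memLp _))) fun τ hτ => ?_
    · refine Lp.ext ?_
      filter_upwards [h0, hq.coeFn_toLp] with p h1 h2
      rw [h2]
      exact (sub_eq_zero.1 h1).symm
    · have hF := memLp_fourierT hτ.integrable (hτ.memLp 2)
      simp only [sub_mul]
      rw [integral_sub (integrable_mul_star hq hF) (integrable_mul_star (Lp.memLp _) hF),
        ← H.eq τ hτ, key τ hτ, sub_eq_zero]
      nth_rw 1 [← Lp.toLp_coeFn (fourierL (hf.toLp f)) (Lp.memLp _)]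
      rw [inner_toLp]
  · intro H
    refine ⟨hq, hf, fun τ hτ => ?_⟩
    rw [key τ hτ, H, inner_toLp]

/-- The adjoint of the isometry satisfies the defining pairing for every `q`. Together with
`isInvFourier_iff` this is the surjectivity of the Fourier transform. -/
theorem exists_isInvFourier_of_freq {q : Freq → ℂ} (hq : MemLp q 2 freqMeasure) :
    ∃ f, IsInvFourier q f := by
  let f := fourierL.toContinuousLinearMap.adjoint (hq.toLp q)
  refine ⟨f, hq, Lp.memLp f, fun τ hτ => ?_⟩
  rw [← inner_toLp (hτ.memLp 2) (Lp.memLp f), Lp.toLp_coeFn,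
    ContinuousLinearMap.adjoint_inner_right, LinearIsometry.coe_toContinuousLinearMap,
    fourierL_toLp hτ.integrable, inner_toLp]

theorem exists_isInvFourier {f : CylCell → ℂ} (hf : MemLp f 2) : ∃ q, IsInvFourier q f :=
  ⟨fourierL (hf.toLp f), (isInvFourier_iff (Lp.memLp _) hf).2 (by rw [Lp.toLp_coeFn])⟩

theorem isInvFourier_fourierT {f : CylCell → ℂ} (hf1 : Integrable f) (hf2 : MemLp f 2) :
    IsInvFourier (fourierT f) f :=
  (isInvFourier_iff (memLp_fourierT hf1 hf2) hf2).2 (fourierL_toLp hf1 hf2)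

namespace IsInvFourier

variable {q q' : Freq → ℂ} {f f' : CylCell → ℂ}

theorem fourierL_eq (h : IsInvFourier q f) : fourierL (h.right.toLp f) = h.left.toLp q :=
  (isInvFourier_iff h.left h.right).1 h

theorem parseval (h : IsInvFourier q f) (h' : IsInvFourier q' f') :
    ∫ x, f x * starRingEnd ℂ (f' x) = ∫ p, q p * starRingEnd ℂ (q' p) ∂freqMeasure := by
  rw [← inner_toLp h'.right h.right, ← fourierL.inner_map_map, h.fourierL_eq, h'.fourierL_eq,
    inner_toLp]

theorem lintegral_sq (h : IsInvFourier q f) :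
    ∫⁻ x, ‖f x‖ₑ ^ 2 = ∫⁻ p, ‖q p‖ₑ ^ 2 ∂freqMeasure := by
  rw [← ofReal_norm_toLp_sq h.right, ← ofReal_norm_toLp_sq h.left, ← h.fourierL_eq,
    LinearIsometry.norm_map]

theorem congr_freq (h : IsInvFourier q f) (e : q =ᵐ[freqMeasure] q') : IsInvFourier q' f :=
  ⟨h.left.ae_eq e, h.right, fun τ hτ => by
    rw [h.eq τ hτ]; exact integral_congr_ae (by filter_upwards [e] with p hp; rw [hp])⟩

theorem space_unique (h : IsInvFourier q f) (h' : IsInvFourier q f') : f =ᵐ[volume] f' := by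
  rw [← MemLp.toLp_eq_toLp_iff h.right h'.right]
  apply fourierL.injective
  rw [h.fourierL_eq, h'.fourierL_eq]

theorem add (h : IsInvFourier q f) (h' : IsInvFourier q' f') :
    IsInvFourier (fun p => q p + q' p) (fun x => f x + f' x) :=
  ⟨h.left.add h'.left, h.right.add h'.right, fun τ hτ => by
    have hF := memLp_fourierT hτ.integrable (hτ.memLp 2)
    simp only [add_mul]
    rw [integral_add (integrable_mul_star h.right (hτ.memLp 2))
      (integrable_mul_star h'.right (hτ.memLp 2)), integral_add (integrable_mul_star h.left hF)
      (integrable_mul_star h'.left hF), h.eq τ hτ, h'.eq τ hτ]⟩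

theorem const_mul (c : ℂ) (h : IsInvFourier q f) :
    IsInvFourier (fun p => c * q p) (fun x => c * f x) :=
  ⟨h.left.const_mul c, h.right.const_mul c, fun τ hτ => by
    simp only [mul_assoc, integral_const_mul, h.eq τ hτ]⟩

end IsInvFourier

/-! ### Weak derivatives as multipliers -/

theorem norm_freqVec_mul_le (p : Freq) (j : Fin 3) (z : ℂ) :
    ‖-(Complex.I * freqVec p j) * z‖ ≤ freqNorm p * ‖z‖ := by
  rw [norm_mul, norm_neg, norm_mul, Complex.norm_I, one_mul, Complex.norm_real]
  exact mul_le_mul_of_nonneg_right (abs_freqVec_le p j) (norm_nonneg _)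

/-- Two square integrable functions on the frequency space, one of them multiplied by a factor of
at most quadratic growth, agree if they have the same pairing with all test functions. -/
theorem ae_eq_mul_of_forall_test {q q' : Freq → ℂ} {m : Freq → ℂ} (hm : Measurable m)
    (hb : ∀ p, ‖m p‖ ≤ 1 + freqNorm p ^ 2) (hq : MemLp q 2 freqMeasure)
    (hq' : MemLp q' 2 freqMeasure)
    (hF : ∀ τ, IsTest τ → MemLp (fun p => starRingEnd ℂ (m p) * fourierT τ p) 2 freqMeasure)
    (H : ∀ τ, IsTest τ → ∫ p, q' p * starRingEnd ℂ (fourierT τ p) ∂freqMeasure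
      = ∫ p, q p * starRingEnd ℂ (starRingEnd ℂ (m p) * fourierT τ p) ∂freqMeasure) :
    q' =ᵐ[freqMeasure] fun p => m p * q p := by
  have hN := measurable_freqNorm
  have h0 := ae_eq_zero_of_integral_fourierT_eq_zero (h := fun p => q' p - m p * q p) ?_ ?_
  · filter_upwards [h0] with p hp
    exact sub_eq_zero.1 hp
  · simp only [sub_div]
    refine (memLp_div_of_memLp hq').sub (hq.mono ?_ (Filter.Eventually.of_forall fun p => ?_))
    · exact (hm.aestronglyMeasurable.mul hq.1).mul (by fun_prop : Measurable fun p : Freq =>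
        (((1 + freqNorm p ^ 2 : ℝ) : ℂ))⁻¹).aestronglyMeasurable
    · rw [norm_div, norm_mul, Complex.norm_real, Real.norm_of_nonneg (by positivity),
        div_le_iff₀ (by positivity), mul_comm]
      exact mul_le_mul_of_nonneg_left (hb p) (norm_nonneg _)
  · intro τ hτ
    have h1 := H τ hτ
    have h2 := integrable_mul_star hq (hF τ hτ)
    have e : ∀ p, q p * starRingEnd ℂ (starRingEnd ℂ (m p) * fourierT τ p)
        = m p * q p * starRingEnd ℂ (fourierT τ p) := fun p => by
      simp only [map_mul, Complex.conj_conj]; ring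
    simp only [e] at h1 h2
    simp only [sub_mul]
    rw [integral_sub (integrable_mul_star hq' (memLp_fourierT hτ.integrable (hτ.memLp 2))) h2, h1,
      sub_self]

/-- Testing identifies the transform of `g` with `-i p_j q`. The latter is not known in advance to
be square integrable, which is why the uniqueness theorem allows quadratic growth. -/
theorem HasWeakPartial.isInvFourier {j : Fin 3} {f g : CylCell → ℂ} {q : Freq → ℂ}
    (h : HasWeakPartial j f g) (hg : MemLp g 2) (hq : IsInvFourier q f) :
    IsInvFourier (fun p => -(Complex.I * freqVec p j) * q p) g := by
  obtain ⟨q', hq'⟩ := exists_isInvFourier hg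
  have hv := measurable_freqVec j
  refine hq'.congr_freq (ae_eq_mul_of_forall_test (m := fun p => -(Complex.I * freqVec p j))
    (by fun_prop) (fun p => ?_) hq.left hq'.left (fun τ hτ => ?_) fun τ hτ => ?_)
  · have := norm_freqVec_mul_le p j 1
    rw [mul_one, norm_one, mul_one] at this
    nlinarith [sq_nonneg (freqNorm p - 1)]
  · have := (memLp_fourierT (hτ.partialD j).integrable ((hτ.partialD j).memLp 2)).const_mul (-1)
    refine this.ae_eq (Filter.Eventually.of_forall fun p => ?_)
    simp only [fourierT_partialD hτ, map_neg, map_mul, Complex.conj_I, Complex.conj_ofReal]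
    ring
  · rw [← hq'.eq τ hτ]
    have h1 := h.eq _ hτ.star
    simp only [hτ.isSmooth.partialD_star, hq.eq _ (hτ.partialD j)] at h1
    rw [← neg_eq_iff_eq_neg] at h1
    rw [← h1, ← integral_neg]
    refine integral_congr_ae (Filter.Eventually.of_forall fun p => ?_)
    simp only [fourierT_partialD hτ, map_neg, map_mul, Complex.conj_I, Complex.conj_ofReal]
    ring

theorem locallyIntegrable_of_memLp_two {f : CylCell → ℂ} (hf : MemLp f 2) : LocallyIntegrable f :=
  hf.locallyIntegrable one_le_two

theorem IsInvFourier.hasWeakPartial {j : Fin 3} {f g : CylCell → ℂ} {q : Freq → ℂ}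
    (hq : IsInvFourier q f) (hg : IsInvFourier (fun p => -(Complex.I * freqVec p j) * q p) g) :
    HasWeakPartial j f g := by
  refine ⟨locallyIntegrable_of_memLp_two hq.right, locallyIntegrable_of_memLp_two hg.right,
    fun τ hτ => ?_⟩
  have h1 := hg.eq _ hτ.star
  have h2 := hq.eq _ (hτ.partialD j).star
  simp only [Complex.conj_conj] at h1 h2
  rw [h1, h2, ← integral_neg]
  refine integral_congr_ae (Filter.Eventually.of_forall fun p => ?_)
  have e : (fun x => starRingEnd ℂ (partialD j τ x)) = partialD j fun x => starRingEnd ℂ (τ x) :=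
    funext fun x => (hτ.isSmooth.partialD_star j x).symm
  simp only [e, fourierT_partialD hτ.star, map_neg, map_mul, Complex.conj_I, Complex.conj_ofReal]
  ring

theorem IsTest.laplacian {τ : CylCell → ℂ} (hτ : IsTest τ) :
    IsTest fun x => ∑ j, partialD j (partialD j τ) x := by
  simp only [Fin.sum_univ_three]
  exact (((hτ.partialD 0).partialD 0).add ((hτ.partialD 1).partialD 1)).add
    ((hτ.partialD 2).partialD 2)

theorem HasWeakLaplacian.isInvFourier {f g : CylCell → ℂ} {q : Freq → ℂ}
    (h : HasWeakLaplacian f g) (hg : MemLp g 2) (hq : IsInvFourier q f) :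
    IsInvFourier (fun p => -((freqNorm p ^ 2 : ℝ) : ℂ) * q p) g := by
  obtain ⟨q', hq'⟩ := exists_isInvFourier hg
  have hv := measurable_freqNorm
  refine hq'.congr_freq (ae_eq_mul_of_forall_test (m := fun p => -((freqNorm p ^ 2 : ℝ) : ℂ))
    (by fun_prop) (fun p => ?_) hq.left hq'.left (fun τ hτ => ?_) fun τ hτ => ?_)
  · rw [norm_neg, Complex.norm_real, Real.norm_of_nonneg (by positivity)]
    linarith
  · refine (memLp_fourierT hτ.laplacian.integrable (hτ.laplacian.memLp 2)).ae_eq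
      (Filter.Eventually.of_forall fun p => ?_)
    simp only [fourierT_laplacian hτ, map_neg, Complex.conj_ofReal]
  · rw [← hq'.eq τ hτ]
    have h1 := h.eq _ hτ.star
    have e : ∀ x, ∑ j, partialD j (partialD j fun x => starRingEnd ℂ (τ x)) x
        = starRingEnd ℂ (∑ j, partialD j (partialD j τ) x) := fun x => by
      rw [map_sum]
      refine Finset.sum_congr rfl fun j _ => ?_
      rw [← (hτ.partialD j).isSmooth.partialD_star]
      congr 1
      exact funext fun x => hτ.isSmooth.partialD_star j x
    simp only [e, hq.eq _ hτ.laplacian] at h1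
    rw [← h1]
    refine integral_congr_ae (Filter.Eventually.of_forall fun p => ?_)
    simp only [fourierT_laplacian hτ, map_neg, Complex.conj_ofReal]

theorem locallyIntegrable_mul_continuous {a f : CylCell → ℂ} (ha : Continuous a)
    (hf : LocallyIntegrable f) : LocallyIntegrable fun x => a x * f x := by
  rw [locallyIntegrable_iff] at hf ⊢
  exact fun K hK => (hf K hK).continuousOn_mul ha.continuousOn hK

theorem integrable_mul_test {f τ : CylCell → ℂ} (hf : LocallyIntegrable f) (hτ : IsTest τ) :
    Integrable fun x => f x * τ x := by
  simpa only [smul_eq_mul, mul_comm] using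
    hf.integrable_smul_left_of_hasCompactSupport hτ.continuous hτ.compact

theorem HasWeakPartial.smooth_mul {j : Fin 3} {a f g : CylCell → ℂ} (ha : IsSmooth a)
    (h : HasWeakPartial j f g) :
    HasWeakPartial j (fun x => a x * f x) fun x => a x * g x + partialD j a x * f x := by
  refine ⟨locallyIntegrable_mul_continuous ha.continuous h.left,
    (locallyIntegrable_mul_continuous ha.continuous h.right).add
      (locallyIntegrable_mul_continuous (ha.partialD j).continuous h.left), fun τ hτ => ?_⟩
  have h1 := h.eq _ (hτ.smooth_mul ha)
  simp only [ha.partialD_mul hτ.isSmooth, mul_add] at h1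
  rw [integral_add (integrable_mul_test h.left (hτ.smooth_mul (ha.partialD j)))
    (integrable_mul_test h.left ((hτ.partialD j).smooth_mul ha))] at h1
  have e1 : ∫ x, a x * f x * partialD j τ x = ∫ x, f x * (a x * partialD j τ x) :=
    integral_congr_ae (Filter.Eventually.of_forall fun x => by ring)
  have e2 : ∫ x, (a x * g x + partialD j a x * f x) * τ x
      = (∫ x, g x * (a x * τ x)) + ∫ x, f x * (partialD j a x * τ x) := by
    rw [← integral_add (integrable_mul_test h.right (hτ.smooth_mul ha))
      (integrable_mul_test h.left (hτ.smooth_mul (ha.partialD j)))]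
    exact integral_congr_ae (Filter.Eventually.of_forall fun x => by ring)
  rw [e1, e2]
  linear_combination h1

theorem IsSmooth.hasWeakPartial {a : CylCell → ℂ} (ha : IsSmooth a) (j : Fin 3) :
    HasWeakPartial j a (partialD j a) :=
  ⟨ha.continuous.locallyIntegrable, (ha.partialD j).continuous.locallyIntegrable,
    fun _ hτ => integral_smooth_mul_partialD ha hτ j⟩

theorem HasWeakPartial.add {j : Fin 3} {f f' g g' : CylCell → ℂ} (h : HasWeakPartial j f g)
    (h' : HasWeakPartial j f' g') :
    HasWeakPartial j (fun x => f x + f' x) fun x => g x + g' x := by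
  refine ⟨h.left.add h'.left, h.right.add h'.right, fun τ hτ => ?_⟩
  simp only [add_mul]
  rw [integral_add (integrable_mul_test h.left (hτ.partialD j))
    (integrable_mul_test h'.left (hτ.partialD j)), integral_add (integrable_mul_test h.right hτ)
    (integrable_mul_test h'.right hτ), h.eq τ hτ, h'.eq τ hτ, neg_add]

theorem HasWeakPartial.const_mul {j : Fin 3} (c : ℂ) {f g : CylCell → ℂ}
    (h : HasWeakPartial j f g) : HasWeakPartial j (fun x => c * f x) fun x => c * g x :=
  ⟨h.left.smul c, h.right.smul c, fun τ hτ => by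
    simp only [mul_assoc, integral_const_mul, h.eq τ hτ, mul_neg]⟩

end CylCell

end

noncomputable section

namespace CylCell

/-! ### Integrability in frequency space -/

/-- The exponent 2 is split into three equal shares: `S⁻² = (S^(-2/3))³` with `S = 1 + |p|²`, and
each factor is bounded by the one involving a single coordinate. In one variable the decay exponent
is `4/3 > 1`, which is enough both for the sums and for the integral. -/
theorem integrable_one_add_freqNorm_sq_inv :
    Integrable (fun p : Freq => ((1 + freqNorm p ^ 2) ^ 2)⁻¹) freqMeasure := by
  have hR : Integrable (fun x : ℝ => (1 + x ^ 2) ^ (-(2 / 3) : ℝ)) := by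
    have := integrable_rpow_neg_one_add_norm_sq (E := ℝ) (μ := volume) (r := 4 / 3)
      (by simp; norm_num)
    simp only [Real.norm_eq_abs, sq_abs] at this
    convert this using 3
    norm_num
  have hZ : Integrable (fun n : ℤ => (1 + (2 * Real.pi * n) ^ 2) ^ (-(2 / 3) : ℝ)) Measure.count := by
    rw [integrable_count_iff]
    have h1 : Summable fun n : ℤ => |(n : ℝ)| ^ (-(4 / 3) : ℝ) + if n = 0 then 1 else 0 :=
      (Real.summable_abs_int_rpow (by norm_num)).add
        (summable_of_hasFiniteSupport ((Set.finite_singleton (0 : ℤ)).subset fun n hn => by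
          by_contra h
          exact hn (if_neg h)))
    refine Summable.of_norm_bounded h1 fun n => ?_
    rw [norm_norm, Real.norm_of_nonneg (by positivity)]
    by_cases hn : n = 0
    · subst hn; simp
    · rw [if_neg hn, add_zero]
      have hn' : 0 < |(n : ℝ)| := abs_pos.2 (by exact_mod_cast hn)
      have e : |(n : ℝ)| ^ (-(4 / 3) : ℝ) = (|(n : ℝ)| ^ 2) ^ (-(2 / 3) : ℝ) := by
        rw [← Real.rpow_natCast, ← Real.rpow_mul hn'.le]
        norm_num
      rw [e]
      refine Real.rpow_le_rpow_of_nonpos (by positivity) ?_ (by norm_num)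
      rw [sq_abs, mul_pow]
      have : 1 ≤ (2 * Real.pi) ^ 2 := by nlinarith [Real.pi_gt_three]
      nlinarith [sq_nonneg (n : ℝ)]
  have hp := hZ.mul_prod (hZ.mul_prod hR)
  have hN := measurable_freqNorm
  refine hp.mono' (by fun_prop : Measurable fun p : Freq =>
    ((1 + freqNorm p ^ 2) ^ 2)⁻¹).aestronglyMeasurable (Filter.Eventually.of_forall fun p => ?_)
  rw [Real.norm_of_nonneg (by positivity)]
  set S := 1 + freqNorm p ^ 2 with hS
  have hS2 : S = 1 + ((2 * Real.pi * p.1) ^ 2 + (2 * Real.pi * p.2.1) ^ 2 + p.2.2 ^ 2) := by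
    rw [hS, freqNorm, Real.sq_sqrt (by positivity)]
  have hS0 : 0 < S := by positivity
  have e : (S ^ 2)⁻¹ = S ^ (-(2 / 3) : ℝ) * (S ^ (-(2 / 3) : ℝ) * S ^ (-(2 / 3) : ℝ)) := by
    rw [← Real.rpow_add hS0, ← Real.rpow_add hS0, ← Real.rpow_natCast, ← Real.rpow_neg hS0.le]
    norm_num
  have hle : ∀ a : ℝ, 0 < a → a ≤ S → S ^ (-(2 / 3) : ℝ) ≤ a ^ (-(2 / 3) : ℝ) := fun a h0 h =>
    Real.rpow_le_rpow_of_nonpos h0 h (by norm_num)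
  rw [e]
  have hpi := sq_nonneg (2 * Real.pi * (p.1 : ℝ))
  have hpi' := sq_nonneg (2 * Real.pi * (p.2.1 : ℝ))
  have hxi := sq_nonneg p.2.2
  exact mul_le_mul (hle _ (by positivity) (by linarith))
    (mul_le_mul (hle _ (by positivity) (by linarith)) (hle _ (by positivity) (by linarith))
      (by positivity) (by positivity)) (by positivity) (by positivity)

theorem memLp_one_add_freqNorm_sq_inv :
    MemLp (fun p : Freq => (1 + freqNorm p ^ 2)⁻¹) 2 freqMeasure := by
  have hN := measurable_freqNorm
  rw [memLp_two_iff_integrable_sq (by fun_prop : Measurable fun p : Freq =>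
    (1 + freqNorm p ^ 2)⁻¹).aestronglyMeasurable]
  simpa only [inv_pow] using integrable_one_add_freqNorm_sq_inv

theorem freqMeasure_freqNorm_le_lt_top (R : ℝ) : freqMeasure {p | freqNorm p ≤ R} < ∞ := by
  have h := integrable_one_add_freqNorm_sq_inv.measure_norm_ge_lt_top
    (ε := ((1 + R ^ 2) ^ 2)⁻¹) (by positivity)
  refine lt_of_le_of_lt (measure_mono fun p hp => ?_) h
  have hp' : freqNorm p ≤ R := hp
  have h0 := freqNorm_nonneg p
  simp only [Set.mem_ofPred_eq]
  rw [Real.norm_of_nonneg (by positivity)]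
  gcongr

/-! ### Inversion for integrable symbols -/

theorem continuous_integral_wave {q : Freq → ℂ} (hq : Integrable q freqMeasure) :
    Continuous fun x => ∫ p, q p * starRingEnd ℂ (wave p x) ∂freqMeasure := by
  refine continuous_of_dominated (bound := fun p => ‖q p‖) (fun x => ?_) (fun x => ?_) hq.norm ?_
  · exact hq.1.mul (Complex.continuous_conj.measurable.comp
      (measurable_wave.comp measurable_prodMk_right)).aestronglyMeasurable
  · refine Filter.Eventually.of_forall fun p => ?_
    rw [norm_mul, RCLike.norm_conj]
    exact mul_le_of_le_one_right (norm_nonneg _) (norm_wave_le_one p x)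
  · exact Filter.Eventually.of_forall fun p =>
      continuous_const.mul (Complex.continuous_conj.comp (continuous_wave p))

theorem norm_integral_wave_le {q : Freq → ℂ} (hq : Integrable q freqMeasure) (x : CylCell) :
    ‖∫ p, q p * starRingEnd ℂ (wave p x) ∂freqMeasure‖ ≤ ∫ p, ‖q p‖ ∂freqMeasure := by
  refine norm_integral_le_of_norm_le hq.norm (Filter.Eventually.of_forall fun p => ?_)
  rw [norm_mul, RCLike.norm_conj]
  exact mul_le_of_le_one_right (norm_nonneg _) (norm_wave_le_one p x)

theorem integral_integral_wave_mul_star {q : Freq → ℂ} (hq : Integrable q freqMeasure)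
    {g : CylCell → ℂ} (hg : Integrable g) :
    ∫ x, (∫ p, q p * starRingEnd ℂ (wave p x) ∂freqMeasure) * starRingEnd ℂ (g x)
      = ∫ p, q p * starRingEnd ℂ (fourierT g p) ∂freqMeasure := by
  simp only [← integral_mul_const]
  rw [integral_integral_swap]
  · refine integral_congr_ae (Filter.Eventually.of_forall fun p => ?_)
    simp only [fourierT_eq, ← integral_conj, map_mul, mul_assoc, integral_const_mul]
  · have h1 : Integrable (fun z : CylCell × Freq => starRingEnd ℂ (g z.1) * q z.2)
        (volume.prod freqMeasure) :=
      Integrable.mul_prod (f := fun x => starRingEnd ℂ (g x))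
        (Complex.conjCLE.toContinuousLinearMap.integrable_comp hg) hq
    refine (h1.bdd_mul (f := fun z : CylCell × Freq => starRingEnd ℂ (wave z.2 z.1)) (c := 1) ?_
      (Filter.Eventually.of_forall fun z => ?_)).congr (Filter.Eventually.of_forall fun z => ?_)
    · exact (Complex.continuous_conj.measurable.comp
        (measurable_wave.comp measurable_swap)).aestronglyMeasurable
    · rw [RCLike.norm_conj]; exact norm_wave_le_one _ _
    · simp only [Function.uncurry]; ring

theorem memLp_indicator_slab {f : CylCell → ℂ} (hf : Continuous f) (R : ℝ) (p : ℝ≥0∞) :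
    MemLp ((slab R).indicator f) p := by
  obtain ⟨C, hC⟩ := (isCompact_slab R).exists_bound_of_continuousOn hf.continuousOn
  rw [memLp_indicator_iff_restrict (isCompact_slab R).measurableSet]
  have : IsFiniteMeasure ((volume : Measure CylCell).restrict (slab R)) :=
    ⟨by simpa using (isCompact_slab R).measure_lt_top⟩
  exact MemLp.of_bound hf.aestronglyMeasurable C
    ((ae_restrict_iff' (isCompact_slab R).measurableSet).2 (Filter.Eventually.of_forall hC))

theorem integrable_of_memLp_two_slab {f : CylCell → ℂ} {R : ℝ}
    (hf : MemLp ((slab R).indicator f) 2) : Integrable ((slab R).indicator f) := by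
  have h := hf.restrict (slab R)
  have : IsFiniteMeasure ((volume : Measure CylCell).restrict (slab R)) :=
    ⟨by simpa using (isCompact_slab R).measure_lt_top⟩
  have h1 := h.integrable one_le_two
  exact (integrableOn_iff_integrable_of_support_subset Set.support_indicator_subset).1 h1

theorem ae_eq_zero_of_integral_mul_star_self {X : Type*} [MeasurableSpace X] {μ : Measure X}
    {g : X → ℂ} (hg : MemLp g 2 μ) (h : ∫ x, g x * starRingEnd ℂ (g x) ∂μ = 0) : g =ᵐ[μ] 0 := by
  simp only [Complex.mul_conj, Complex.normSq_eq_norm_sq] at h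
  rw [integral_complex_ofReal, Complex.ofReal_eq_zero,
    integral_eq_zero_iff_of_nonneg (fun x => sq_nonneg _) hg.norm.integrable_sq] at h
  filter_upwards [h] with x hx
  simpa using hx

theorem ae_eq_of_forall_slab {f g : CylCell → ℂ}
    (h : ∀ R : ℕ, (slab R).indicator f =ᵐ[volume] (slab R).indicator g) : f =ᵐ[volume] g := by
  filter_upwards [ae_all_iff.2 h] with x hx
  obtain ⟨n, hn⟩ := exists_nat_ge |x.2.2|
  have := hx n
  rwa [Set.indicator_of_mem (show x ∈ slab n from hn),
    Set.indicator_of_mem (show x ∈ slab n from hn)] at this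

/-- The inversion integral `f₀` is bounded and continuous but not known to be in `L²`. So the
difference is cut off to a slab: with `g = 1_slab (f - f₀)`, Parseval and Fubini give the same value
for `⟨f, g⟩` and `⟨f₀, g⟩`, whence `∫ |g|² = 0`. -/
theorem IsInvFourier.ae_eq_integral_wave {q : Freq → ℂ} {f : CylCell → ℂ} (h : IsInvFourier q f)
    (hq : Integrable q freqMeasure) :
    f =ᵐ[volume] fun x => ∫ p, q p * starRingEnd ℂ (wave p x) ∂freqMeasure := by
  obtain ⟨f₀, hf₀⟩ : ∃ f₀ : CylCell → ℂ,
    f₀ = fun x => ∫ p, q p * starRingEnd ℂ (wave p x) ∂freqMeasure := ⟨_, rfl⟩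
  have hc : Continuous f₀ := hf₀ ▸ continuous_integral_wave hq
  have hb : ∀ x, ‖f₀ x‖ ≤ ∫ p, ‖q p‖ ∂freqMeasure := hf₀ ▸ norm_integral_wave_le hq
  rw [← hf₀]
  refine ae_eq_of_forall_slab fun R => ?_
  have hS := (isCompact_slab (R : ℝ)).measurableSet
  have h1 := memLp_indicator_slab hc R 2
  have h2 : MemLp ((slab (R : ℝ)).indicator f) 2 := h.right.indicator hS
  obtain ⟨g, hg⟩ : ∃ g : CylCell → ℂ,
    g = (slab (R : ℝ)).indicator f - (slab (R : ℝ)).indicator f₀ := ⟨_, rfl⟩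
  have hg2 : MemLp g 2 := hg ▸ h2.sub h1
  have hg1 : Integrable g := hg ▸ (integrable_of_memLp_two_slab h2).sub (integrable_of_memLp_two_slab h1)
  have e1 := h.parseval (isInvFourier_fourierT hg1 hg2)
  have e2 := integral_integral_wave_mul_star hq hg1
  have e3 : ∫ x, g x * starRingEnd ℂ (g x) = 0 := by
    have i1 : Integrable fun x => f x * starRingEnd ℂ (g x) := integrable_mul_star h.right hg2
    have i2 : Integrable fun x => f₀ x * starRingEnd ℂ (g x) :=
      (Complex.conjCLE.toContinuousLinearMap.integrable_comp hg1).bdd_mul hc.aestronglyMeasurable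
        (Filter.Eventually.of_forall hb)
    have e4 : ∫ x, f₀ x * starRingEnd ℂ (g x) = ∫ x, f x * starRingEnd ℂ (g x) := by
      rw [e1, ← e2, hf₀]
    rw [← sub_self (∫ x, f x * starRingEnd ℂ (g x))]
    nth_rw 2 [← e4]
    rw [← integral_sub i1 i2]
    refine integral_congr_ae (Filter.Eventually.of_forall fun x => ?_)
    simp only [hg, Pi.sub_apply]
    by_cases hx : x ∈ slab (R : ℝ)
    · simp only [Set.indicator_of_mem hx]
      ring
    · simp only [Set.indicator_of_notMem hx]
      simp
  filter_upwards [ae_eq_zero_of_integral_mul_star_self hg2 e3] with x hx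
  rw [hg] at hx
  exact sub_eq_zero.1 hx

/-! ### The Sobolev embedding into `L⁴` -/

theorem MemH1.memLp_freqNorm_mul {f : CylCell → ℂ} (hf : MemH1 f) {q : Freq → ℂ}
    (hq : IsInvFourier q f) : MemLp (fun p => (freqNorm p : ℂ) * q p) 2 freqMeasure := by
  have hN := measurable_freqNorm
  have h : ∀ j, MemLp (fun p => -(Complex.I * freqVec p j) * q p) 2 freqMeasure := fun j => by
    obtain ⟨g, hg, hg2⟩ := hf.grad j
    exact (hg.isInvFourier hg2 hq).left
  have hs := ((h 0).norm.add (h 1).norm).add (h 2).norm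
  refine hs.mono (AEStronglyMeasurable.mul (by fun_prop : Measurable fun p : Freq =>
    (freqNorm p : ℂ)).aestronglyMeasurable hq.left.1) (Filter.Eventually.of_forall fun p => ?_)
  simp only [Pi.add_apply, norm_mul, norm_neg, Complex.norm_I, one_mul, Complex.norm_real,
    Real.norm_eq_abs]
  rw [abs_of_nonneg (freqNorm_nonneg p), abs_of_nonneg (by positivity), ← add_mul, ← add_mul]
  refine mul_le_mul_of_nonneg_right ?_ (norm_nonneg _)
  refine abs_le_of_sq_le_sq' ?_ (by positivity) |>.2
  rw [freqNorm_sq, Fin.sum_univ_three, ← sq_abs (freqVec p 0), ← sq_abs (freqVec p 1),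
    ← sq_abs (freqVec p 2)]
  nlinarith [abs_nonneg (freqVec p 0), abs_nonneg (freqVec p 1), abs_nonneg (freqVec p 2),
    mul_nonneg (abs_nonneg (freqVec p 0)) (abs_nonneg (freqVec p 1)),
    mul_nonneg (abs_nonneg (freqVec p 0)) (abs_nonneg (freqVec p 2)),
    mul_nonneg (abs_nonneg (freqVec p 1)) (abs_nonneg (freqVec p 2))]

/-- The distribution function of an `H¹` function is controlled by the high frequencies. -/
theorem exists_measure_norm_gt_le {q : Freq → ℂ} {f : CylCell → ℂ} (h : IsInvFourier q f)
    {B : ℝ} (hB : 0 < B)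
    (hi : Integrable (fun p => (1 + freqNorm p)⁻¹ * ‖q p‖) freqMeasure)
    (hiB : ∫ p, (1 + freqNorm p)⁻¹ * ‖q p‖ ∂freqMeasure ≤ B) {t : ℝ} (ht : 0 < t) :
    volume {x | t < ‖f x‖} * ENNReal.ofReal (t ^ 2) ≤
      4 * ∫⁻ p in {p | t / (2 * B) < 1 + freqNorm p}, ‖q p‖ₑ ^ 2 ∂freqMeasure := by
  have hN := measurable_freqNorm
  -- The cutoff is chosen so that the part of `f` with frequencies outside `S` is at most `t/2` in
  -- absolute value. Where `|f| > t`, the part with frequencies in `S` is therefore at least `t/2`,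
  -- and Chebyshev with Plancherel applies.
  set S : Set Freq := {p | t / (2 * B) < 1 + freqNorm p} with hS
  have hSm : MeasurableSet S := measurableSet_lt measurable_const (by fun_prop)
  have hlo2 : MemLp (Sᶜ.indicator q) 2 freqMeasure := h.left.indicator hSm.compl
  have hhi2 : MemLp (S.indicator q) 2 freqMeasure := h.left.indicator hSm
  obtain ⟨f₁, h₁⟩ := exists_isInvFourier_of_freq hlo2
  obtain ⟨f₂, h₂⟩ := exists_isInvFourier_of_freq hhi2
  have hsum : f =ᵐ[volume] fun x => f₁ x + f₂ x := by
    refine h.space_unique ((h₁.add h₂).congr_freq (Filter.Eventually.of_forall fun p => ?_))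
    simp only
    rw [← Pi.add_apply, Set.indicator_compl_add_self]
  have hb : ∀ p, ‖Sᶜ.indicator q p‖ ≤ t / (2 * B) * ((1 + freqNorm p)⁻¹ * ‖q p‖) := by
    intro p
    have hp0 := freqNorm_nonneg p
    by_cases hp : p ∈ S
    · rw [Set.indicator_of_notMem (by simpa using hp), norm_zero]
      positivity
    · rw [Set.indicator_of_mem (by simpa using hp), ← mul_assoc, ← div_eq_mul_inv]
      refine le_mul_of_one_le_left (norm_nonneg _) ?_
      rw [one_le_div (by positivity)]
      exact not_lt.1 hp
  have hlo1 : Integrable (Sᶜ.indicator q) freqMeasure :=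
    (hi.const_mul _).mono' hlo2.1 (Filter.Eventually.of_forall hb)
  have hlob : ∀ᵐ x, ‖f₁ x‖ ≤ t / 2 := by
    filter_upwards [h₁.ae_eq_integral_wave hlo1] with x hx
    rw [hx]
    refine (norm_integral_wave_le hlo1 x).trans ((integral_mono hlo1.norm (hi.const_mul _) hb).trans ?_)
    rw [integral_const_mul]
    calc t / (2 * B) * _ ≤ t / (2 * B) * B := by gcongr
      _ = t / 2 := by field_simp
  have hsub : volume {x | t < ‖f x‖} ≤ volume {x | ENNReal.ofReal ((t / 2) ^ 2) ≤ ‖f₂ x‖ₑ ^ 2} := by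
    refine measure_mono_ae ?_
    filter_upwards [hsum, hlob] with x hx1 hx2 hx3
    have hx4 : t < ‖f x‖ := hx3
    rw [hx1] at hx4
    have := norm_add_le (f₁ x) (f₂ x)
    have h5 : t / 2 ≤ ‖f₂ x‖ := by linarith
    change ENNReal.ofReal ((t / 2) ^ 2) ≤ ‖f₂ x‖ₑ ^ 2
    rw [← ofReal_norm, ← ENNReal.ofReal_pow (norm_nonneg _)]
    exact ENNReal.ofReal_le_ofReal (by gcongr)
  have hch := mul_meas_ge_le_lintegral₀ (μ := (volume : Measure CylCell))
    (h₂.right.1.enorm.pow_const 2) (ENNReal.ofReal ((t / 2) ^ 2))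
  rw [h₂.lintegral_sq] at hch
  have e : ∫⁻ p, ‖S.indicator q p‖ₑ ^ 2 ∂freqMeasure = ∫⁻ p in S, ‖q p‖ₑ ^ 2 ∂freqMeasure := by
    rw [← lintegral_indicator hSm]
    refine lintegral_congr fun p => ?_
    by_cases hp : p ∈ S
    · simp [hp]
    · simp [hp]
  rw [e] at hch
  have e2 : ENNReal.ofReal (t ^ 2) = 4 * ENNReal.ofReal ((t / 2) ^ 2) := by
    rw [← ENNReal.ofReal_ofNat 4, ← ENNReal.ofReal_mul (by norm_num)]
    congr 1
    ring
  rw [e2, mul_left_comm]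
  refine mul_le_mul_right ?_ 4
  refine le_trans ?_ hch
  rw [mul_comm]
  exact mul_le_mul_right hsub _

theorem lintegral_ite_div_lt {b n : ℝ} (hb : 0 < b) (c : ℝ≥0∞) :
    ∫⁻ t in Set.Ioi (0 : ℝ), (if t / b < n then ENNReal.ofReal (b * n) * c else 0)
      = ENNReal.ofReal (b * n) ^ 2 * c := by
  have e : ∀ t : ℝ, (if t / b < n then ENNReal.ofReal (b * n) * c else 0)
      = (Set.Iio (b * n)).indicator (fun _ => ENNReal.ofReal (b * n) * c) t := by
    intro t
    rw [Set.indicator_apply]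
    refine if_congr ?_ rfl rfl
    rw [div_lt_iff₀ hb, mul_comm n]
    rfl
  simp only [e]
  rw [lintegral_indicator measurableSet_Iio, Measure.restrict_restrict measurableSet_Iio,
    setLIntegral_const, Set.inter_comm, Set.Ioi_inter_Iio, Real.volume_Ioo, sub_zero]
  ring

/-- The layer-cake formula writes the integral as one of `t³ |{|f| > t}|`. The bound on the
distribution function holds for frequencies with `t < 2B(1 + |p|)`; after replacing the remaining
factor `t` by that upper bound, Tonelli leaves `(2B(1 + |p|))² |q|²`, which is integrable. That `B`
is finite is Cauchy–Schwarz with `(1 + |p|²)⁻¹ ∈ L²`. -/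
theorem lintegral_norm_pow_four_lt_top {q : Freq → ℂ} {f : CylCell → ℂ} (hq : IsInvFourier q f)
    (hqm : Measurable q) (hNq : MemLp (fun p => (1 + freqNorm p) * ‖q p‖) 2 freqMeasure) :
    ∫⁻ x, ‖f x‖ₑ ^ 4 < ∞ := by
  have hN := measurable_freqNorm
  have hi : Integrable (fun p => (1 + freqNorm p)⁻¹ * ‖q p‖) freqMeasure := by
    refine (hNq.integrable_mul memLp_one_add_freqNorm_sq_inv).mono'
      (by fun_prop : Measurable fun p => (1 + freqNorm p)⁻¹ * ‖q p‖).aestronglyMeasurable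
      (Filter.Eventually.of_forall fun p => ?_)
    have h0 := freqNorm_nonneg p
    rw [Real.norm_of_nonneg (by positivity)]
    simp only [Pi.mul_apply]
    rw [mul_assoc, mul_comm ‖q p‖, ← mul_assoc]
    refine mul_le_mul_of_nonneg_right ?_ (norm_nonneg _)
    rw [← div_eq_mul_inv, inv_eq_one_div, div_le_div_iff₀ (by positivity) (by positivity)]
    nlinarith
  obtain ⟨B, hB, hiB⟩ : ∃ B, 0 < B ∧ ∫ p, (1 + freqNorm p)⁻¹ * ‖q p‖ ∂freqMeasure ≤ B := by
    have : 0 ≤ ∫ p, (1 + freqNorm p)⁻¹ * ‖q p‖ ∂freqMeasure :=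
      integral_nonneg fun p => by have := freqNorm_nonneg p; positivity
    exact ⟨1 + ∫ p, (1 + freqNorm p)⁻¹ * ‖q p‖ ∂freqMeasure, by linarith, by linarith⟩
  have e1 : ∫⁻ x, ‖f x‖ₑ ^ 4 = ∫⁻ x, ENNReal.ofReal (‖f x‖ ^ (4 : ℝ)) := by
    refine lintegral_congr fun x => ?_
    rw [← ofReal_norm, ← ENNReal.ofReal_pow (norm_nonneg _)]
    norm_cast
  rw [e1, lintegral_rpow_eq_lintegral_meas_lt_mul _
    (Filter.Eventually.of_forall fun x => norm_nonneg _) hq.right.1.norm.aemeasurable (by norm_num)]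
  refine ENNReal.mul_lt_top ENNReal.ofReal_lt_top ?_
  have hstep : ∀ t ∈ Set.Ioi (0 : ℝ), volume {x | t < ‖f x‖} * ENNReal.ofReal (t ^ ((4 : ℝ) - 1)) ≤
      4 * ∫⁻ p, (if t / (2 * B) < 1 + freqNorm p then
        ENNReal.ofReal (2 * B * (1 + freqNorm p)) * ‖q p‖ₑ ^ 2 else 0) ∂freqMeasure := by
    intro t ht
    have ht0 : 0 < t := ht
    have h1 := exists_measure_norm_gt_le hq hB hi hiB ht0
    have e2 : ENNReal.ofReal (t ^ ((4 : ℝ) - 1)) = ENNReal.ofReal (t ^ 2) * ENNReal.ofReal t := by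
      rw [← ENNReal.ofReal_mul (by positivity)]
      congr 1
      rw [show (4 : ℝ) - 1 = (3 : ℕ) by norm_num, Real.rpow_natCast]
      ring
    rw [e2, ← mul_assoc]
    refine (mul_le_mul_left h1 _).trans ?_
    rw [mul_assoc]
    refine mul_le_mul_right ?_ _
    rw [← lintegral_indicator (measurableSet_lt measurable_const (by fun_prop)),
      ← lintegral_mul_const' _ _ ENNReal.ofReal_ne_top]
    refine lintegral_mono fun p => ?_
    by_cases hp : t / (2 * B) < 1 + freqNorm p
    · rw [Set.indicator_of_mem (show p ∈ {p | t / (2 * B) < 1 + freqNorm p} from hp), if_pos hp,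
        mul_comm]
      refine mul_le_mul_left (ENNReal.ofReal_le_ofReal ?_) _
      rw [div_lt_iff₀ (by positivity)] at hp
      linarith
    · rw [Set.indicator_of_notMem (show p ∉ {p | t / (2 * B) < 1 + freqNorm p} from hp), zero_mul]
      exact zero_le
  refine (setLIntegral_mono' measurableSet_Ioi hstep).trans_lt ?_
  have hmeas : Measurable fun z : ℝ × Freq => if z.1 / (2 * B) < 1 + freqNorm z.2 then
        ENNReal.ofReal (2 * B * (1 + freqNorm z.2)) * ‖q z.2‖ₑ ^ 2 else 0 :=
    Measurable.ite (measurableSet_lt (by fun_prop) (by fun_prop)) (by fun_prop) measurable_const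
  rw [lintegral_const_mul _ hmeas.lintegral_prod_right']
  refine ENNReal.mul_lt_top (by simp) ?_
  rw [lintegral_lintegral_swap hmeas.aemeasurable]
  have hB2 : 0 < 2 * B := by positivity
  simp only [lintegral_ite_div_lt hB2]
  refine lt_of_eq_of_lt (lintegral_congr fun p => ?_) (hNq.const_mul (2 * B)).lintegral_sq_lt_top
  have h0 := freqNorm_nonneg p
  have e2 : ‖2 * B * ((1 + freqNorm p) * ‖q p‖)‖ₑ
      = ENNReal.ofReal (2 * B * (1 + freqNorm p)) * ‖q p‖ₑ := by
    rw [← mul_assoc, enorm_mul, enorm_norm, ← ofReal_norm, Real.norm_of_nonneg (by positivity)]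
  rw [e2, mul_pow]

theorem MemH1.lintegral_norm_pow_four_lt_top {f : CylCell → ℂ} (hf : MemH1 f) :
    ∫⁻ x, ‖f x‖ₑ ^ 4 < ∞ := by
  obtain ⟨q₀, hq₀⟩ := exists_isInvFourier hf.memLp
  have hq := hq₀.congr_freq hq₀.left.1.ae_eq_mk
  refine CylCell.lintegral_norm_pow_four_lt_top hq
    hq₀.left.1.stronglyMeasurable_mk.measurable ?_
  refine (hq.left.norm.add (hf.memLp_freqNorm_mul hq).norm).ae_eq
    (Filter.Eventually.of_forall fun p => ?_)
  simp only [Pi.add_apply, norm_mul, Complex.norm_real, Real.norm_of_nonneg (freqNorm_nonneg p)]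
  ring

theorem MemH1.memLp_norm_sq {f : CylCell → ℂ} (hf : MemH1 f) :
    MemLp (fun x => ‖f x‖ ^ 2) 2 := by
  refine memLp_two_iff_lintegral.2 ⟨hf.memLp.1.norm.pow 2, ?_⟩
  refine lt_of_eq_of_lt (lintegral_congr fun x => ?_) hf.lintegral_norm_pow_four_lt_top
  rw [enorm_pow, enorm_norm, ← pow_mul]

end CylCell

end

/-! ### Weak compactness and a weighted Rellich theorem -/

noncomputable section

open Filter Topology in
/-- A bounded sequence in a separable Hilbert space has a weakly convergent subsequence. -/
theorem exists_subseq_tendsto_inner {H : Type*} [NormedAddCommGroup H] [InnerProductSpace ℂ H]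
    [CompleteSpace H] [TopologicalSpace.SeparableSpace H] {u : ℕ → H} {M : ℝ}
    (hu : ∀ n, ‖u n‖ ≤ M) : ∃ (φ : ℕ → ℕ) (v : H), StrictMono φ ∧
      ∀ w, Tendsto (fun n => inner ℂ w (u (φ n))) atTop (𝓝 (inner ℂ w v)) := by
  have hb : ∀ n, StrongDual.toWeakDual (InnerProductSpace.toDual ℂ H (u n)) ∈
      (WeakDual.toStrongDual ⁻¹' Metric.closedBall (0 : StrongDual ℂ H) M) := fun n => by
    simp [hu n]
  obtain ⟨l, -, φ, hφ, hl⟩ := WeakDual.isSeqCompact_closedBall ℂ H 0 M hb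
  refine ⟨φ, (InnerProductSpace.toDual ℂ H).symm (WeakDual.toStrongDual l), hφ, fun w => ?_⟩
  have h1 := ((WeakDual.eval_continuous w).tendsto l).comp hl
  have h2 := (Complex.continuous_conj.tendsto _).comp h1
  refine (h2.congr fun n => ?_).trans (le_of_eq ?_)
  · exact inner_conj_symm w (u (φ n))
  · rw [← inner_conj_symm w, InnerProductSpace.toDual_symm_apply]
    rfl

namespace CylCell

open Filter Topology in
/-- Weak sequential compactness for finitely many bounded sequences in `L²`. -/
theorem exists_subseq_tendsto_integral {ι : Type*} [Fintype ι] {u : ℕ → ι → CylCell → ℂ}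
    (hu : ∀ n i, MemLp (u n i) 2) {M : ℝ≥0∞} (hM : M ≠ ∞)
    (huM : ∀ n i, ∫⁻ x, ‖u n i x‖ₑ ^ 2 ≤ M) :
    ∃ (φ : ℕ → ℕ) (v : ι → CylCell → ℂ), StrictMono φ ∧ (∀ i, MemLp (v i) 2) ∧
      ∀ i w, MemLp w 2 → Tendsto (fun n => ∫ x, u (φ n) i x * starRingEnd ℂ (w x)) atTop
        (𝓝 (∫ x, v i x * starRingEnd ℂ (w x))) := by
  classical
  have : Fact ((2 : ℝ≥0∞) ≠ ∞) := ⟨by simp⟩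
  have : IsSeparable (volume : Measure CylCell) := instIsSeparableOfCountablyGeneratedOfSFinite volume
  -- Packing the components into one Hilbert space gives a subsequence common to all; each component
  -- is recovered by testing with vectors having a single nonzero entry.
  let U : ℕ → PiLp 2 (fun _ : ι => Lp ℂ 2 (volume : Measure CylCell)) :=
    fun n => WithLp.toLp 2 fun i => (hu n i).toLp (u n i)
  have hn : ∀ n i, ‖(hu n i).toLp (u n i)‖ ^ 2 ≤ M.toReal := fun n i => by
    have := ofReal_norm_toLp_sq (hu n i) ▸ huM n i
    exact (ENNReal.ofReal_le_iff_le_toReal hM).1 this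
  have hU : ∀ n, ‖U n‖ ≤ Real.sqrt (∑ _i : ι, M.toReal) := fun n => by
    rw [PiLp.norm_eq_of_L2]
    exact Real.sqrt_le_sqrt (Finset.sum_le_sum fun i _ => hn n i)
  obtain ⟨φ, v, hφ, hv⟩ := exists_subseq_tendsto_inner hU
  refine ⟨φ, fun i => v i, hφ, fun i => Lp.memLp (v i), fun i w hw => ?_⟩
  have h1 := hv (WithLp.toLp 2 (Pi.single i (hw.toLp w)))
  have e : ∀ z : PiLp 2 (fun _ : ι => Lp ℂ 2 (volume : Measure CylCell)),
      inner ℂ (WithLp.toLp 2 (Pi.single i (hw.toLp w))) z = inner ℂ (hw.toLp w) (z i) := fun z => by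
    rw [PiLp.inner_apply, Finset.sum_eq_single i]
    · simp
    · intro j _ hj
      simp [Pi.single_eq_of_ne hj]
    · simp
  simp only [e] at h1
  convert h1 using 2 with n
  · exact (inner_toLp hw (hu (φ n) i)).symm
  · rw [← inner_toLp hw (Lp.memLp (v i)), Lp.toLp_coeFn]

/-! ### A decaying weight -/

theorem measurePreserving_height :
    MeasurePreserving (fun x : CylCell => x.2.2) volume (volume : Measure ℝ) := by
  have hp : IsProbabilityMeasure (volume : Measure UnitAddCircle) := by
    constructor; simp
  have h1 : MeasurePreserving (Prod.snd : CylCell → UnitAddCircle × ℝ) volume volume :=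
    measurePreserving_snd
  have h2 : MeasurePreserving (Prod.snd : UnitAddCircle × ℝ → ℝ) volume volume :=
    measurePreserving_snd
  exact h2.comp h1

/-- The weight `(1 + x₃²)⁻¹`. -/
def weight (x : CylCell) : ℂ := (((1 + x.2.2 ^ 2)⁻¹ : ℝ) : ℂ)

theorem norm_weight_le_one (x : CylCell) : ‖weight x‖ ≤ 1 := by
  rw [weight, Complex.norm_real, Real.norm_of_nonneg (by positivity)]
  exact inv_le_one_of_one_le₀ (by nlinarith [sq_nonneg x.2.2])

theorem contDiff_weight : ContDiff ℝ ((⊤ : ℕ∞) : WithTop ℕ∞)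
    fun s : ℝ => (((1 + s ^ 2)⁻¹ : ℝ) : ℂ) := by
  refine Complex.ofRealCLM.contDiff.comp (ContDiff.inv (by fun_prop) fun s => ?_)
  positivity

theorem isSmooth_weight : IsSmooth weight := IsSmooth.comp_height contDiff_weight

theorem deriv_weight (s : ℝ) : deriv (fun s : ℝ => (((1 + s ^ 2)⁻¹ : ℝ) : ℂ)) s
    = ((-(2 * s) * ((1 + s ^ 2)⁻¹) ^ 2 : ℝ) : ℂ) := by
  have h : HasDerivAt (fun s : ℝ => (1 + s ^ 2)⁻¹) (-(2 * s) * ((1 + s ^ 2)⁻¹) ^ 2) s := by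
    have h1 : HasDerivAt (fun s : ℝ => 1 + s ^ 2) (2 * s) s := by
      simpa using (hasDerivAt_pow 2 s).const_add 1
    have h2 := h1.fun_inv (by positivity)
    rwa [div_eq_mul_inv, ← inv_pow] at h2
  exact h.ofReal_comp.deriv

theorem partialD_weight (j : Fin 3) (x : CylCell) : partialD j weight x =
    if j = 2 then ((-(2 * x.2.2) * ((1 + x.2.2 ^ 2)⁻¹) ^ 2 : ℝ) : ℂ) else 0 := by
  rw [← deriv_weight]
  exact partialD_comp_height (fun s : ℝ => (((1 + s ^ 2)⁻¹ : ℝ) : ℂ)) j x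

theorem norm_partialD_weight_le_one (j : Fin 3) (x : CylCell) : ‖partialD j weight x‖ ≤ 1 := by
  rw [partialD_weight]
  split_ifs
  · rw [Complex.norm_real, norm_mul, Real.norm_of_nonneg (by positivity : (0 : ℝ) ≤ _ ^ 2), inv_pow,
      ← div_eq_mul_inv, div_le_one (by positivity), norm_neg, norm_mul, Real.norm_ofNat,
      Real.norm_eq_abs]
    nlinarith [sq_abs x.2.2, sq_nonneg (|x.2.2| - 1), sq_nonneg (x.2.2 ^ 2)]
  · simp

theorem memLp_weight : MemLp weight 2 := by
  have h : MemLp (fun s : ℝ => (((1 + s ^ 2)⁻¹ : ℝ) : ℂ)) 2 := by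
    rw [memLp_two_iff_integrable_sq_norm contDiff_weight.continuous.aestronglyMeasurable]
    refine integrable_inv_one_add_sq.mono'
      (contDiff_weight.continuous.norm.pow 2).aestronglyMeasurable
      (Filter.Eventually.of_forall fun s => ?_)
    rw [Complex.norm_real, norm_pow, norm_norm, Real.norm_of_nonneg (by positivity), sq]
    exact mul_le_of_le_one_left (by positivity)
      (inv_le_one_of_one_le₀ (by nlinarith [sq_nonneg s]))
  exact h.comp_measurePreserving measurePreserving_height

theorem memLp_bdd_mul {a f : CylCell → ℂ} (ha : Continuous a) {C : ℝ} (hC : ∀ x, ‖a x‖ ≤ C)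
    (hf : MemLp f 2) : MemLp (fun x => a x * f x) 2 := by
  refine (hf.norm.const_mul C).mono (ha.aestronglyMeasurable.mul hf.1)
    (Filter.Eventually.of_forall fun x => ?_)
  rw [norm_mul, norm_mul, norm_norm]
  exact mul_le_mul_of_nonneg_right ((hC x).trans (le_abs_self C)) (norm_nonneg _)

theorem memLp_weight_mul {f : CylCell → ℂ} (hf : MemLp f 2) : MemLp (fun x => weight x * f x) 2 :=
  memLp_bdd_mul isSmooth_weight.continuous norm_weight_le_one hf

theorem integrable_weight_mul {f : CylCell → ℂ} (hf : MemLp f 2) :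
    Integrable (fun x => weight x * f x) := memLp_weight.integrable_mul hf

theorem enorm_add_sq_le {E : Type*} [NormedAddCommGroup E] (a b : E) :
    ‖a + b‖ₑ ^ 2 ≤ 2 * ‖a‖ₑ ^ 2 + 2 * ‖b‖ₑ ^ 2 := by
  rw [← ofReal_norm, ← ofReal_norm, ← ofReal_norm, ← ENNReal.ofReal_pow (norm_nonneg _),
    ← ENNReal.ofReal_pow (norm_nonneg _), ← ENNReal.ofReal_pow (norm_nonneg _),
    ← ENNReal.ofReal_ofNat 2, ← ENNReal.ofReal_mul (by norm_num), ← ENNReal.ofReal_mul (by norm_num),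
    ← ENNReal.ofReal_add (by positivity) (by positivity)]
  refine ENNReal.ofReal_le_ofReal ?_
  have := norm_add_le a b
  nlinarith [norm_nonneg (a + b), norm_nonneg a, norm_nonneg b, sq_nonneg (‖a‖ - ‖b‖)]

theorem lintegral_weight_mul_partial_le {j : Fin 3} {f g : CylCell → ℂ} {M : ℝ≥0∞}
    (hf2 : MemLp f 2) (hf : ∫⁻ x, ‖f x‖ₑ ^ 2 ≤ M)
    (hg : ∫⁻ x, ‖g x‖ₑ ^ 2 ≤ M) :
    ∫⁻ x, ‖weight x * g x + partialD j weight x * f x‖ₑ ^ 2 ≤ 4 * M := by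
  have h : ∀ (a z : ℂ), ‖a‖ ≤ 1 → ‖a * z‖ₑ ^ 2 ≤ ‖z‖ₑ ^ 2 := fun a z ha => by
    gcongr
    rw [enorm_mul]
    refine mul_le_of_le_one_left (by simp) ?_
    rw [← ofReal_norm]
    exact ENNReal.ofReal_le_one.2 ha
  calc _ ≤ ∫⁻ x, (2 * ‖g x‖ₑ ^ 2 + 2 * ‖f x‖ₑ ^ 2) := by
        refine lintegral_mono fun x => (enorm_add_sq_le _ _).trans ?_
        gcongr ?_ + ?_
        · exact mul_le_mul_right (h _ _ (norm_weight_le_one x)) _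
        · exact mul_le_mul_right (h _ _ (norm_partialD_weight_le_one j x)) _
    _ = 2 * (∫⁻ x, ‖g x‖ₑ ^ 2) + 2 * ∫⁻ x, ‖f x‖ₑ ^ 2 := by
        rw [lintegral_add_right' _ ((hf2.1.enorm.pow_const 2).const_mul 2),
          lintegral_const_mul' _ _ (by simp), lintegral_const_mul' _ _ (by simp)]
    _ ≤ 2 * M + 2 * M := by gcongr
    _ = 4 * M := by ring

theorem lintegral_freqNorm_mul_sq_le {q : Freq → ℂ} {M : ℝ≥0∞} (hq : AEStronglyMeasurable q freqMeasure)
    (h : ∀ j, ∫⁻ p, ‖-(Complex.I * freqVec p j) * q p‖ₑ ^ 2 ∂freqMeasure ≤ M) :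
    ∫⁻ p, ENNReal.ofReal (freqNorm p ^ 2) * ‖q p‖ₑ ^ 2 ∂freqMeasure ≤ 3 * M := by
  have e : ∀ p, ENNReal.ofReal (freqNorm p ^ 2) * ‖q p‖ₑ ^ 2
      = ∑ j, ‖-(Complex.I * freqVec p j) * q p‖ₑ ^ 2 := fun p => by
    rw [freqNorm_sq, ENNReal.ofReal_sum_of_nonneg fun j _ => sq_nonneg _, Finset.sum_mul]
    refine Finset.sum_congr rfl fun j _ => ?_
    rw [enorm_mul, mul_pow, enorm_neg, enorm_mul, ← ofReal_norm Complex.I, Complex.norm_I,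
      ENNReal.ofReal_one, one_mul, ← ofReal_norm ((freqVec p j : ℝ) : ℂ), Complex.norm_real,
      ← ENNReal.ofReal_pow (norm_nonneg _), Real.norm_eq_abs, sq_abs]
  simp only [e]
  rw [lintegral_finsetSum' _ fun j _ => ?_]
  · calc _ ≤ ∑ _j : Fin 3, M := Finset.sum_le_sum fun j _ => h j
      _ = 3 * M := by simp
  · have := measurable_freqVec j
    exact ((AEStronglyMeasurable.mul (by fun_prop : Measurable fun p : Freq =>
      -(Complex.I * (freqVec p j : ℂ))).aestronglyMeasurable hq).enorm).pow_const 2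

open Filter Topology in
/-- Rellich compactness in a weighted space: weak convergence to zero in `H¹` implies strong
convergence of the weighted functions in `L²`. -/
theorem tendsto_lintegral_weight_mul {u : ℕ → CylCell → ℂ} {G : ℕ → Fin 3 → CylCell → ℂ}
    {M : ℝ≥0∞} (hM : M ≠ ∞) (hu : ∀ n, MemLp (u n) 2)
    (hG : ∀ n j, HasWeakPartial j (u n) (G n j)) (hG2 : ∀ n j, MemLp (G n j) 2)
    (huM : ∀ n, ∫⁻ x, ‖u n x‖ₑ ^ 2 ≤ M) (hGM : ∀ n j, ∫⁻ x, ‖G n j x‖ₑ ^ 2 ≤ M)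
    (hw : ∀ w, MemLp w 2 → Tendsto (fun n => ∫ x, u n x * starRingEnd ℂ (w x)) atTop (𝓝 0)) :
    Tendsto (fun n => ∫⁻ x, ‖weight x * u n x‖ₑ ^ 2) atTop (𝓝 0) := by
  have hf1 := fun n => integrable_weight_mul (hu n)
  have hf2 := fun n => memLp_weight_mul (hu n)
  set q : ℕ → Freq → ℂ := fun n => fourierT fun x => weight x * u n x with hq
  have hqm : ∀ n, StronglyMeasurable (q n) := fun n =>
    stronglyMeasurable_fourierT (hf1 n).aestronglyMeasurable
  have hqi : ∀ n, IsInvFourier (q n) fun x => weight x * u n x := fun n =>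
    isInvFourier_fourierT (hf1 n) (hf2 n)
  -- The weighted functions stay bounded in `H¹`, so their mass at frequencies above `R` is `O(R⁻²)`
  -- uniformly in `n`.
  have htail : ∀ n, ∫⁻ p, ENNReal.ofReal (freqNorm p ^ 2) * ‖q n p‖ₑ ^ 2 ∂freqMeasure
      ≤ 3 * (4 * M) := fun n => by
    refine lintegral_freqNorm_mul_sq_le (hqm n).aestronglyMeasurable fun j => ?_
    have h1 := (hG n j).smooth_mul isSmooth_weight
    have h2 := h1.isInvFourier ((memLp_weight_mul (hG2 n j)).add
      (memLp_bdd_mul (isSmooth_weight.partialD j).continuous (norm_partialD_weight_le_one j) (hu n)))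
      (hqi n)
    rw [← h2.lintegral_sq]
    exact lintegral_weight_mul_partial_le (hu n) (huM n) (hGM n j)
  -- This is where the weight is needed: a plane wave is not in `L²`, but wave times weight is, so
  -- weak convergence can be tested with it.
  have hpt : ∀ p, Tendsto (fun n => q n p) atTop (𝓝 0) := fun p => by
    have h1 : MemLp (fun x => starRingEnd ℂ (wave p x * weight x)) 2 :=
      (memLp_bdd_mul (continuous_wave p) (norm_wave_le_one p) memLp_weight).star
    refine (hw _ h1).congr fun n => ?_
    simp only [hq, fourierT_eq, Complex.conj_conj]
    exact integral_congr_ae (Eventually.of_forall fun x => by ring)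
  have hbd : ∀ n p, ‖q n p‖ ≤ (∫ x, ‖weight x‖ ^ 2) + M.toReal := fun n p => by
    refine (norm_fourierT_le _ p).trans ?_
    have h1 : ∫ x, ‖u n x‖ ^ 2 ≤ M.toReal := by
      have := huM n
      rw [lintegral_sq_eq_ofReal_integral (hu n)] at this
      exact (ENNReal.ofReal_le_iff_le_toReal hM).1 this
    refine le_trans ?_ (add_le_add_right h1 _)
    rw [← integral_add memLp_weight.norm.integrable_sq (hu n).norm.integrable_sq]
    refine integral_mono (hf1 n).norm
      (memLp_weight.norm.integrable_sq.add (hu n).norm.integrable_sq) fun x => ?_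
    simp only [norm_mul]
    nlinarith [sq_nonneg (‖weight x‖ - ‖u n x‖), sq_nonneg ‖weight x‖, sq_nonneg ‖u n x‖]
  -- Bounded frequencies have finite measure, so the uniform bound and the pointwise limit suffice
  -- for dominated convergence.
  have hlow : ∀ R : ℝ, Tendsto (fun n => ∫⁻ p in {p | freqNorm p ≤ R}, ‖q n p‖ₑ ^ 2 ∂freqMeasure)
      atTop (𝓝 0) := fun R => by
    have := tendsto_lintegral_of_dominated_convergence
      (μ := freqMeasure.restrict {p | freqNorm p ≤ R}) (F := fun n p => ‖q n p‖ₑ ^ 2) (f := 0)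
      (fun _ => ENNReal.ofReal ((∫ x, ‖weight x‖ ^ 2) + M.toReal) ^ 2)
      (fun n => (hqm n).measurable.enorm.pow_const 2)
      (fun n => Eventually.of_forall fun p => ?_) ?_ (Eventually.of_forall fun p => ?_)
    · simpa using this
    · simp only
      rw [← ofReal_norm]
      gcongr
      exact hbd n p
    · rw [setLIntegral_const]
      exact ENNReal.mul_ne_top (by simp) (freqMeasure_freqNorm_le_lt_top R).ne
    · have := (ENNReal.continuous_pow 2).tendsto _ |>.comp (hpt p).enorm
      simpa [Function.comp_def] using this
  rw [ENNReal.tendsto_nhds_zero]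
  intro ε hε
  have hε2 : ε / 2 ≠ 0 := by simp [hε.ne']
  obtain ⟨N, hN⟩ := ENNReal.exists_nat_gt (ENNReal.div_ne_top
    (by finiteness : 3 * (4 * M) ≠ ∞) hε2)
  set R : ℝ := (N : ℝ) + 1 with hR
  have hR1 : 1 ≤ R := by have := N.cast_nonneg (α := ℝ); linarith
  filter_upwards [(ENNReal.tendsto_nhds_zero.1 (hlow R)) (ε / 2) (pos_iff_ne_zero.2 hε2)] with n hn
  have hSm : MeasurableSet {p | freqNorm p ≤ R} := measurableSet_le measurable_freqNorm measurable_const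
  rw [(hqi n).lintegral_sq, ← lintegral_add_compl _ hSm, ← ENNReal.add_halves ε]
  refine add_le_add hn ?_
  have h1 : (∫⁻ p in {p | freqNorm p ≤ R}ᶜ, ‖q n p‖ₑ ^ 2 ∂freqMeasure) * (N : ℝ≥0∞)
      ≤ 3 * (4 * M) := by
    refine le_trans ?_ (htail n)
    rw [mul_comm, ← lintegral_const_mul' _ _ (by simp)]
    refine le_trans (setLIntegral_mono' hSm.compl fun p hp => ?_) (setLIntegral_le_lintegral _ _)
    refine mul_le_mul_left ?_ _
    rw [← ENNReal.ofReal_natCast]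
    refine ENNReal.ofReal_le_ofReal ?_
    have hp' : R < freqNorm p := not_le.1 hp
    nlinarith
  have hN0 : (N : ℝ≥0∞) ≠ 0 := fun h => by rw [h] at hN; exact not_lt_bot hN
  calc _ ≤ 3 * (4 * M) / N := by
        rw [ENNReal.le_div_iff_mul_le (Or.inl hN0) (Or.inl (by simp))]
        exact h1
    _ ≤ ε / 2 := by
        by_cases ht : ε / 2 = ∞
        · rw [ht]; exact le_top
        rw [ENNReal.div_le_iff_le_mul (Or.inl hN0) (Or.inl (by simp))]
        rw [ENNReal.div_lt_iff (Or.inl hε2) (Or.inl ht)] at hN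
        rw [mul_comm (ε / 2)]
        exact hN.le

end CylCell

end

noncomputable section

namespace CylCell

/-! ### The electrostatic potential -/

theorem measurable_star_wave :
    Measurable fun z : Freq × CylCell => starRingEnd ℂ (wave z.1 z.2) := by
  have h : Measurable fun z : Freq × CylCell => wave z.1 z.2 := measurable_wave
  exact Complex.continuous_conj.measurable.comp h


/-- The low frequencies `𝐤 = 0`, `|ξ| < 1`. -/
def lowFreq : Set Freq := {0} ×ˢ ({0} ×ˢ Set.Ioo (-1) 1)

theorem measurableSet_lowFreq : MeasurableSet lowFreq :=
  (measurableSet_singleton 0).prod ((measurableSet_singleton 0).prod measurableSet_Ioo)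

theorem mem_lowFreq {p : Freq} : p ∈ lowFreq ↔ p.1 = 0 ∧ p.2.1 = 0 ∧ |p.2.2| < 1 := by
  simp [lowFreq, abs_lt]

theorem freqNorm_of_mem_lowFreq {p : Freq} (hp : p ∈ lowFreq) : freqNorm p = |p.2.2| := by
  obtain ⟨h1, h2, -⟩ := mem_lowFreq.1 hp
  rw [freqNorm, h1, h2, ← Real.sqrt_sq_eq_abs]
  simp

theorem one_le_freqNorm_of_notMem {p : Freq} (hp : p ∉ lowFreq) : 1 ≤ freqNorm p := by
  have hpi := Real.pi_gt_three
  have hint : ∀ n : ℤ, n ≠ 0 → 1 ≤ (2 * Real.pi * n) ^ 2 := fun n hn => by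
    have h1 : (1 : ℝ) ≤ (n : ℝ) ^ 2 := by
      have : 1 ≤ n ^ 2 := Order.one_le_iff_pos.2 (by positivity)
      exact_mod_cast this
    have h2 : (1 : ℝ) ≤ (2 * Real.pi) ^ 2 := by nlinarith
    calc (1 : ℝ) = 1 * 1 := by ring
      _ ≤ (2 * Real.pi) ^ 2 * (n : ℝ) ^ 2 := by gcongr
      _ = _ := by ring
  rw [freqNorm, Real.one_le_sqrt]
  have a1 := sq_nonneg (2 * Real.pi * (p.1 : ℝ))
  have a2 := sq_nonneg (2 * Real.pi * (p.2.1 : ℝ))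
  have a3 := sq_nonneg p.2.2
  by_cases h1 : p.1 = 0
  · by_cases h2 : p.2.1 = 0
    · have h3 : 1 ≤ |p.2.2| := by
        by_contra h
        exact hp (mem_lowFreq.2 ⟨h1, h2, not_le.1 h⟩)
      have : 1 ≤ p.2.2 ^ 2 := by rw [← sq_abs]; nlinarith
      linarith
    · have := hint _ h2
      linarith
  · have := hint _ h1
    linarith

theorem freqMeasure_lowFreq_lt_top : freqMeasure lowFreq < ∞ := by
  refine lt_of_le_of_lt (measure_mono fun p hp => ?_) (freqMeasure_freqNorm_le_lt_top 1)
  have : freqNorm p ≤ 1 := by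
    rw [freqNorm_of_mem_lowFreq hp]
    exact (mem_lowFreq.1 hp).2.2.le
  exact this

/-- The renormalized kernel of the inverse Fourier transform. -/
def potKernel (p : Freq) (x : CylCell) : ℂ :=
  starRingEnd ℂ (wave p x) - lowFreq.indicator (fun p => starRingEnd ℂ (wave p 0)) p

theorem measurable_potKernel : Measurable (Function.uncurry potKernel) := by
  have h2 : Measurable fun p : Freq => starRingEnd ℂ (wave p 0) :=
    Measurable.of_uncurry_right (f := fun p x => starRingEnd ℂ (wave p x)) measurable_star_wave
  have h3 : Measurable fun z : Freq × CylCell =>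
      lowFreq.indicator (fun p => starRingEnd ℂ (wave p 0)) z.1 :=
    (h2.indicator measurableSet_lowFreq).comp measurable_fst
  exact measurable_star_wave.sub h3

attribute [irreducible] potKernel

theorem continuous_potKernel (p : Freq) : Continuous (potKernel p) := by
  unfold potKernel
  exact (Complex.continuous_conj.comp (continuous_wave p)).sub continuous_const

theorem norm_potKernel_of_notMem {p : Freq} (hp : p ∉ lowFreq) (x : CylCell) :
    ‖potKernel p x‖ ≤ 1 := by
  rw [potKernel, Set.indicator_of_notMem hp, sub_zero, RCLike.norm_conj]
  exact norm_wave_le_one p x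

theorem norm_potKernel_le_two {p : Freq} (hp : p ∈ lowFreq) (x : CylCell) :
    ‖potKernel p x‖ ≤ 2 := by
  rw [potKernel, Set.indicator_of_mem hp]
  refine (norm_sub_le _ _).trans ?_
  rw [RCLike.norm_conj, RCLike.norm_conj]
  linarith [norm_wave_le_one p x, norm_wave_le_one p 0]

/-- On low frequencies the wave depends on `x₃` only, and subtracting its value at the origin leaves
a multiple of `e^{iξx₃} - 1`. The gained factor `|ξ|` cancels one power in `r/|p|²`. -/
theorem norm_potKernel_le_mul {p : Freq} (hp : p ∈ lowFreq) (x : CylCell) :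
    ‖potKernel p x‖ ≤ freqNorm p * |x.2.2| := by
  obtain ⟨h1, h2, -⟩ := mem_lowFreq.1 hp
  rw [potKernel, Set.indicator_of_mem hp, ← map_sub, RCLike.norm_conj, freqNorm_of_mem_lowFreq hp]
  have e : wave p x - wave p 0 = ((1 / Real.sqrt (2 * Real.pi) : ℝ) : ℂ) *
      (Complex.exp (Complex.I * (p.2.2 * x.2.2 : ℝ)) - 1) := by
    simp only [wave, h1, h2, fourier_zero, Prod.snd_zero, mul_zero, Complex.ofReal_zero,
      Complex.exp_zero]
    ring
  rw [e, norm_mul, Complex.norm_real, ← norm_wave p 0, norm_norm, ← abs_mul]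
  calc _ ≤ 1 * ‖p.2.2 * x.2.2‖ := mul_le_mul (norm_wave_le_one p 0)
        (Real.norm_exp_I_mul_ofReal_sub_one_le) (norm_nonneg _) zero_le_one
    _ = _ := one_mul _

/-- The summand of the potential with symbol `r`. -/
def potTerm (r : Freq → ℂ) (p : Freq) (x : CylCell) : ℂ :=
  r p / ((freqNorm p ^ 2 : ℝ) : ℂ) * potKernel p x

/-- The potential `Λ²ρ` with `r = Fρ`, renormalized at low frequencies. -/
def potential (r : Freq → ℂ) (x : CylCell) : ℂ := ∫ p, potTerm r p x ∂freqMeasure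

/-- A bound for the high frequency part of the potential. -/
def potHigh (r : Freq → ℂ) (p : Freq) : ℝ := 2 * (‖r p‖ * (1 + freqNorm p ^ 2)⁻¹)

theorem norm_potTerm_of_notMem (r : Freq → ℂ) {p : Freq} (hp : p ∉ lowFreq) (x : CylCell) :
    ‖potTerm r p x‖ ≤ potHigh r p := by
  have h1 := one_le_freqNorm_of_notMem hp
  have h2 : 1 ≤ freqNorm p ^ 2 := by nlinarith
  rw [potTerm, norm_mul, norm_div, Complex.norm_real, Real.norm_of_nonneg (by positivity), potHigh]
  refine (mul_le_of_le_one_right (by positivity) (norm_potKernel_of_notMem hp x)).trans ?_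
  rw [mul_left_comm, div_eq_mul_inv]
  refine mul_le_mul_of_nonneg_left ?_ (norm_nonneg _)
  rw [← div_eq_mul_inv, inv_eq_one_div, div_le_div_iff₀ (by positivity) (by positivity)]
  linarith

theorem norm_potTerm_le_of_mem (r : Freq → ℂ) {p : Freq} {x : CylCell} {b : ℝ}
    (hb : ‖potKernel p x‖ ≤ freqNorm p * b) :
    ‖potTerm r p x‖ ≤ ‖r p / (freqNorm p : ℂ)‖ * b := by
  have h0 := freqNorm_nonneg p
  rw [potTerm, norm_mul, norm_div, norm_div, Complex.norm_real, Complex.norm_real,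
    Real.norm_of_nonneg (by positivity), Real.norm_of_nonneg h0]
  rcases h0.eq_or_lt with h | h
  · rw [← h]; simp
  · refine (mul_le_mul_of_nonneg_left hb (by positivity)).trans (le_of_eq ?_)
    field_simp

/-- A dominating function for the summand of the potential on `|x₃| ≤ R`. -/
def potBound (r : Freq → ℂ) (R : ℝ) (p : Freq) : ℝ :=
  potHigh r p + R * lowFreq.indicator (fun p => ‖r p / (freqNorm p : ℂ)‖) p

theorem potHigh_nonneg (r : Freq → ℂ) (p : Freq) : 0 ≤ potHigh r p := by
  unfold potHigh; positivity

theorem norm_potTerm_le_potBound (r : Freq → ℂ) {R : ℝ} {x : CylCell} (hx : |x.2.2| ≤ R)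
    (p : Freq) : ‖potTerm r p x‖ ≤ potBound r R p := by
  have h0 := potHigh_nonneg r p
  by_cases hp : p ∈ lowFreq
  · rw [potBound, Set.indicator_of_mem hp]
    have := norm_potTerm_le_of_mem r (norm_potKernel_le_mul hp x)
    have h2 : ‖r p / (freqNorm p : ℂ)‖ * |x.2.2| ≤ ‖r p / (freqNorm p : ℂ)‖ * R := by gcongr
    linarith
  · rw [potBound, Set.indicator_of_notMem hp, mul_zero, add_zero]
    exact norm_potTerm_of_notMem r hp x

section

variable {r : Freq → ℂ} (hr : MemLp r 2 freqMeasure)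
  (hr' : MemLp (fun p => r p / (freqNorm p : ℂ)) 2 freqMeasure)

include hr

theorem integrable_potHigh : Integrable (potHigh r) freqMeasure :=
  (hr.norm.integrable_mul memLp_one_add_freqNorm_sq_inv).const_mul 2

theorem aestronglyMeasurable_potTerm (x : CylCell) :
    AEStronglyMeasurable (fun p => potTerm r p x) freqMeasure := by
  have hN := measurable_freqNorm
  exact (hr.1.mul (by fun_prop : Measurable fun p : Freq =>
    (((freqNorm p ^ 2 : ℝ) : ℂ))⁻¹).aestronglyMeasurable).mul
    (measurable_potKernel.comp measurable_prodMk_right).aestronglyMeasurable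

theorem aestronglyMeasurable_potTerm_prod : AEStronglyMeasurable
    (fun z : CylCell × Freq => potTerm r z.2 z.1) (volume.prod freqMeasure) := by
  have hN : Measurable fun z : CylCell × Freq => (((freqNorm z.2 ^ 2 : ℝ) : ℂ))⁻¹ := by
    have := measurable_freqNorm
    fun_prop
  have hrm : AEStronglyMeasurable (fun z : CylCell × Freq => r z.2) (volume.prod freqMeasure) :=
    hr.1.comp_snd
  have hK : Measurable fun z : CylCell × Freq => potKernel z.2 z.1 :=
    measurable_potKernel.comp measurable_swap
  exact (hrm.mul hN.aestronglyMeasurable).mul hK.aestronglyMeasurable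

include hr'

theorem integrable_potBound (R : ℝ) : Integrable (potBound r R) freqMeasure := by
  refine (integrable_potHigh hr).add (Integrable.const_mul ?_ R)
  rw [integrable_indicator_iff measurableSet_lowFreq]
  have : IsFiniteMeasure (freqMeasure.restrict lowFreq) :=
    ⟨by simpa using freqMeasure_lowFreq_lt_top⟩
  exact ((hr'.restrict lowFreq).integrable one_le_two).norm

theorem continuous_potential : Continuous (potential r) := by
  rw [continuous_iff_continuousAt]
  intro x
  refine continuousAt_of_dominated (bound := potBound r (|x.2.2| + 1))
    (Filter.Eventually.of_forall (aestronglyMeasurable_potTerm hr)) ?_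
    (integrable_potBound hr hr' _) (Filter.Eventually.of_forall fun p =>
      (continuous_const.mul (continuous_potKernel p)).continuousAt)
  have h : Continuous fun y : CylCell => |y.2.2| := by fun_prop
  filter_upwards [h.continuousAt.eventually_lt continuousAt_const (by linarith :
    |x.2.2| < |x.2.2| + 1)] with y hy
  exact Filter.Eventually.of_forall (norm_potTerm_le_potBound r hy.le)

/-- The subtracted term of the kernel does not depend on `x`, so it disappears against a density of
mean zero and the pairing sees the symbol `r/|p|²`. Bounded support in `x₃` provides the majorant
for Fubini. -/
theorem integral_potential_mul_star {f : CylCell → ℂ} (hf : Integrable f) {R : ℝ}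
    (hR : ∀ x, R < |x.2.2| → f x = 0) (hf0 : ∫ x, f x = 0) :
    ∫ x, potential r x * starRingEnd ℂ (f x)
      = ∫ p, r p / ((freqNorm p ^ 2 : ℝ) : ℂ) * starRingEnd ℂ (fourierT f p) ∂freqMeasure := by
  have hN := measurable_freqNorm
  simp only [potential, ← integral_mul_const]
  have hfc : Integrable fun x => starRingEnd ℂ (f x) :=
    Complex.conjCLE.toContinuousLinearMap.integrable_comp hf
  rw [integral_integral_swap]
  · refine integral_congr_ae (Filter.Eventually.of_forall fun p => ?_)
    simp only [potTerm, mul_assoc, integral_const_mul]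
    congr 1
    have h1 : Integrable fun x => starRingEnd ℂ (wave p x) * starRingEnd ℂ (f x) := by
      refine (Complex.conjCLE.toContinuousLinearMap.integrable_comp
        (integrable_wave_mul hf p)).congr (Filter.Eventually.of_forall fun x => ?_)
      exact map_mul (starRingEnd ℂ) _ _
    simp only [potKernel, sub_mul]
    rw [integral_sub h1 (hfc.const_mul _), integral_const_mul, integral_conj, hf0, map_zero,
      mul_zero, sub_zero, fourierT_eq, ← integral_conj]
    simp only [map_mul]
  · have h1 : Integrable (fun z : CylCell × Freq => ‖f z.1‖ * potBound r R z.2)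
        (volume.prod freqMeasure) := hf.norm.mul_prod (integrable_potBound hr hr' R)
    refine h1.mono' ?_ (Filter.Eventually.of_forall fun z => ?_)
    · exact (aestronglyMeasurable_potTerm_prod hr).mul hfc.1.comp_fst
    · simp only [Function.uncurry, norm_mul, RCLike.norm_conj]
      by_cases hz : |z.1.2.2| ≤ R
      · rw [mul_comm]
        exact mul_le_mul_of_nonneg_left (norm_potTerm_le_potBound r hz _) (norm_nonneg _)
      · rw [hR _ (not_le.1 hz)]
        simp

/-- High frequencies contribute a bounded term. On low frequencies the kernel is at most `min(2,
|ξ|X)` with `X = 1 + |x₃|`, so kernel over `|ξ|` has squared `L²` norm of order `X`. Pairing it with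
`r/|p| ∈ L²` costs `X^(1/2)`. -/
theorem exists_norm_potential_le :
    ∃ C : ℝ, ∀ x : CylCell, ‖potential r x‖ ≤ C * (1 + |x.2.2|) ^ (1 / 2 : ℝ) := by
  set A := ∫ p, potHigh r p ∂freqMeasure with hA
  set B := ∫ p, ‖r p / (freqNorm p : ℂ)‖ ^ 2 ∂freqMeasure with hB
  refine ⟨A + (B + 5 * Real.pi), fun x => ?_⟩
  set X := 1 + |x.2.2| with hX
  have hX1 : 1 ≤ X := by have := abs_nonneg x.2.2; linarith
  have hX0 : 0 < X := by linarith
  rw [← Real.sqrt_eq_rpow]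
  set s := Real.sqrt X with hs
  have hs1 : 1 ≤ s := Real.one_le_sqrt.2 hX1
  have hss : s * s = X := Real.mul_self_sqrt hX0.le
  -- An integrable majorant of `min(4/ξ², X²)`. The constant is `4 + 1`: the bounds `|K|² ≤ 4` and
  -- `|K|² ≤ X²ξ²` add up to `|K|² (1 + X²ξ²) ≤ 5X²ξ²`.
  set h : ℝ → ℝ := fun ξ => 5 * X ^ 2 * (1 + (X * ξ) ^ 2)⁻¹ with hh
  have hh0 : ∀ ξ, 0 ≤ h ξ := fun ξ => by simp only [hh]; positivity
  have hhi : Integrable h :=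
    (integrable_inv_one_add_sq.comp_mul_left' hX0.ne').const_mul (5 * X ^ 2)
  have hhint : ∫ ξ, h ξ = 5 * Real.pi * X := by
    simp only [hh, integral_const_mul]
    rw [Measure.integral_comp_mul_left (fun ξ : ℝ => (1 + ξ ^ 2)⁻¹), integral_univ_inv_one_add_sq,
      abs_of_pos (by positivity), smul_eq_mul]
    field_simp
  set H : Freq → ℝ := lowFreq.indicator fun p => h p.2.2 with hH
  have hHm : Measurable H := by
    have : Measurable fun p : Freq => h p.2.2 := by simp only [hh]; fun_prop
    exact this.indicator measurableSet_lowFreq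
  have hHi : Integrable H freqMeasure := by
    rw [hH, integrable_indicator_iff measurableSet_lowFreq]
    refine Measure.integrableOn_of_bounded freqMeasure_lowFreq_lt_top.ne
      (by simp only [hh]; fun_prop : Measurable fun p : Freq => h p.2.2).aestronglyMeasurable
      (M := 5 * X ^ 2) (Filter.Eventually.of_forall fun p => ?_)
    rw [Real.norm_of_nonneg (hh0 _)]
    exact mul_le_of_le_one_right (by positivity) (inv_le_one_of_one_le₀ (by
      nlinarith [sq_nonneg (X * p.2.2)]))
  have hHint : ∫ p, H p ∂freqMeasure ≤ 5 * Real.pi * X := by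
    have e : ∫ p, ((H p : ℝ) : ℂ) ∂freqMeasure = ∫ ξ : ℝ, ((H (0, 0, ξ) : ℝ) : ℂ) := by
      refine integral_section 0 0 fun p hp => ?_
      rw [hH, Set.indicator_of_notMem, Complex.ofReal_zero]
      exact fun hp' => hp ⟨(mem_lowFreq.1 hp').1, (mem_lowFreq.1 hp').2.1⟩
    rw [integral_complex_ofReal, integral_complex_ofReal, Complex.ofReal_inj] at e
    rw [e, ← hhint]
    refine integral_mono_of_nonneg (Filter.Eventually.of_forall fun ξ =>
      Set.indicator_nonneg (fun p _ => hh0 _) _) hhi (Filter.Eventually.of_forall fun ξ => ?_)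
    exact Set.indicator_le_self' (fun p _ => hh0 _) (0, 0, ξ)
  have hker : ∀ p ∈ lowFreq, ‖potKernel p x‖ ≤ freqNorm p * Real.sqrt (h p.2.2) := by
    intro p hp
    have k1 := norm_potKernel_le_two hp x
    have k2 := norm_potKernel_le_mul hp x
    rw [freqNorm_of_mem_lowFreq hp] at k2 ⊢
    have hx3 : |x.2.2| ≤ X := by linarith
    have k3 : ‖potKernel p x‖ ≤ |p.2.2| * X := k2.trans (by gcongr)
    rw [← Real.sqrt_sq (abs_nonneg p.2.2), ← Real.sqrt_mul (sq_nonneg _)]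
    refine Real.le_sqrt_of_sq_le ?_
    simp only [hh, sq_abs]
    rw [← div_eq_mul_inv, mul_div_assoc', le_div_iff₀ (by positivity)]
    have k4 : ‖potKernel p x‖ ^ 2 ≤ 4 := by nlinarith [norm_nonneg (potKernel p x)]
    have k5 : ‖potKernel p x‖ ^ 2 ≤ p.2.2 ^ 2 * X ^ 2 := by
      rw [← sq_abs p.2.2, ← mul_pow]
      gcongr
    nlinarith [sq_nonneg (X * p.2.2)]
  have hbound : ∀ p, ‖potTerm r p x‖ ≤
      potHigh r p + (s * ‖r p / (freqNorm p : ℂ)‖ ^ 2 + s⁻¹ * H p) := by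
    intro p
    have h0 := potHigh_nonneg r p
    have hs0 : 0 < s := by linarith
    by_cases hp : p ∈ lowFreq
    · have h1 := norm_potTerm_le_of_mem r (hker p hp)
      rw [hH, Set.indicator_of_mem hp]
      set a := ‖r p / (freqNorm p : ℂ)‖
      set b := Real.sqrt (h p.2.2) with hb
      have hb2 : h p.2.2 = b ^ 2 := (Real.sq_sqrt (hh0 _)).symm
      rw [hb2]
      -- The arithmetic–geometric inequality with parameter `s = X^(1/2)` replaces Cauchy–Schwarz:
      -- both terms then integrate to order `s`.
      have h2 : a * b ≤ s * a ^ 2 + s⁻¹ * b ^ 2 := by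
        have h3 : 0 ≤ s⁻¹ * ((s * a - b) ^ 2 + (s * a) ^ 2 + b ^ 2) := by positivity
        have h4 : s⁻¹ * ((s * a - b) ^ 2 + (s * a) ^ 2 + b ^ 2)
          = 2 * (s * a ^ 2 + s⁻¹ * b ^ 2 - a * b) := by field_simp; ring
        linarith
      linarith
    · rw [hH, Set.indicator_of_notMem hp, mul_zero, add_zero]
      have := norm_potTerm_of_notMem r hp x
      have h5 : 0 ≤ s * ‖r p / (freqNorm p : ℂ)‖ ^ 2 := by positivity
      linarith
  have hI1 := integrable_potHigh hr
  have hI2 := hr'.norm.integrable_sq.const_mul s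
  have hI3 := hHi.const_mul s⁻¹
  calc ‖potential r x‖ ≤ ∫ p, (potHigh r p + (s * ‖r p / (freqNorm p : ℂ)‖ ^ 2 + s⁻¹ * H p))
        ∂freqMeasure := norm_integral_le_of_norm_le (hI1.add (hI2.add hI3))
          (Filter.Eventually.of_forall hbound)
    _ = A + (s * B + s⁻¹ * ∫ p, H p ∂freqMeasure) := by
        rw [integral_add (g := fun p => s * ‖r p / (freqNorm p : ℂ)‖ ^ 2 + s⁻¹ * H p) hI1
          (hI2.add hI3), integral_add hI2 hI3, integral_const_mul, integral_const_mul]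
    _ ≤ A + (s * B + s⁻¹ * (5 * Real.pi * X)) := by gcongr
    _ = A + s * (B + 5 * Real.pi) := by rw [← hss]; field_simp
    _ ≤ (A + (B + 5 * Real.pi)) * s := by
        have hA0 : 0 ≤ A := integral_nonneg (potHigh_nonneg r)
        nlinarith

end

end CylCell

end

noncomputable section

namespace CylCell

/-- The value zero assigned to a quotient by `|p| = 0` is therefore harmless in all the multipliers.
-/
theorem ae_freqNorm_ne_zero : ∀ᵐ p ∂freqMeasure, freqNorm p ≠ 0 := by
  refine ae_freqMeasure_iff.2 fun n₁ n₂ => ?_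
  filter_upwards [Measure.ae_ne volume (0 : ℝ)] with ξ hξ h0
  have := abs_freqVec_le (n₁, n₂, ξ) 2
  rw [h0] at this
  exact hξ (abs_nonpos_iff.1 this)

/-! ### Regularity of the potential -/

section

variable {r : Freq → ℂ}

theorem memLp_freqVec_mul_div (hr' : MemLp (fun p => r p / (freqNorm p : ℂ)) 2 freqMeasure)
    (hr : AEStronglyMeasurable r freqMeasure) (j : Fin 3) :
    MemLp (fun p => -(Complex.I * freqVec p j) * (r p / ((freqNorm p ^ 2 : ℝ) : ℂ))) 2
      freqMeasure := by
  have hN := measurable_freqNorm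
  have hv := measurable_freqVec j
  refine hr'.mono (AEStronglyMeasurable.mul (by fun_prop : Measurable fun p : Freq =>
    -(Complex.I * (freqVec p j : ℂ))).aestronglyMeasurable (hr.mul (by fun_prop : Measurable
    fun p : Freq => (((freqNorm p ^ 2 : ℝ) : ℂ))⁻¹).aestronglyMeasurable))
    (Filter.Eventually.of_forall fun p => (norm_freqVec_mul_le p j _).trans (le_of_eq ?_))
  have h0 := freqNorm_nonneg p
  rw [norm_div, norm_div, Complex.norm_real, Complex.norm_real, Real.norm_of_nonneg h0,
    Real.norm_of_nonneg (by positivity)]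
  rcases h0.eq_or_lt with h | h
  · rw [← h]; simp
  · field_simp

theorem memLp_freqVec_mul_freqVec_mul_div (hr : MemLp r 2 freqMeasure) (i j : Fin 3) :
    MemLp (fun p => -(Complex.I * freqVec p i) *
      (-(Complex.I * freqVec p j) * (r p / ((freqNorm p ^ 2 : ℝ) : ℂ)))) 2 freqMeasure := by
  have hN := measurable_freqNorm
  have hv := measurable_freqVec j
  have hv' := measurable_freqVec i
  refine hr.mono (AEStronglyMeasurable.mul (by fun_prop : Measurable fun p : Freq =>
    -(Complex.I * (freqVec p i : ℂ))).aestronglyMeasurable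
    (AEStronglyMeasurable.mul (by fun_prop : Measurable fun p : Freq =>
    -(Complex.I * (freqVec p j : ℂ))).aestronglyMeasurable (hr.1.mul (by fun_prop : Measurable
    fun p : Freq => (((freqNorm p ^ 2 : ℝ) : ℂ))⁻¹).aestronglyMeasurable)))
    (Filter.Eventually.of_forall fun p => (norm_freqVec_mul_le p i _).trans ?_)
  have h0 := freqNorm_nonneg p
  refine (mul_le_mul_of_nonneg_left (norm_freqVec_mul_le p j _) h0).trans ?_
  rw [norm_div, Complex.norm_real, Real.norm_of_nonneg (by positivity)]
  rcases h0.eq_or_lt with h | h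
  · rw [← h]; simp
  · refine le_of_eq ?_
    field_simp

/-- The derivative of a test function has mean zero, so the renormalized potential can be paired
with it as if its symbol were `r/|p|²`. The same remark gives the Laplacian. -/
theorem hasWeakPartial_potential (hr : MemLp r 2 freqMeasure)
    (hr' : MemLp (fun p => r p / (freqNorm p : ℂ)) 2 freqMeasure) {j : Fin 3} {g : CylCell → ℂ}
    (hg : IsInvFourier (fun p => -(Complex.I * freqVec p j) * (r p / ((freqNorm p ^ 2 : ℝ) : ℂ))) g) :
    HasWeakPartial j (potential r) g := by
  refine ⟨(continuous_potential hr hr').locallyIntegrable,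
    locallyIntegrable_of_memLp_two hg.right, fun τ hτ => ?_⟩
  have ht := hτ.star.partialD j
  obtain ⟨R, -, hR⟩ := ht.exists_slab
  have h1 := integral_potential_mul_star hr hr' ht.integrable hR (hτ.star.integral_partialD j)
  have h2 := hg.eq _ hτ.star
  simp only [hτ.isSmooth.partialD_star, Complex.conj_conj] at h1 h2
  rw [h1, h2, ← integral_neg]
  refine integral_congr_ae (Filter.Eventually.of_forall fun p => ?_)
  simp only [fourierT_partialD hτ.star, map_neg, map_mul, Complex.conj_I, Complex.conj_ofReal]
  ring

theorem hasWeakLaplacian_potential {ρ : CylCell → ℂ} (hρ : IsInvFourier r ρ)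
    (hr' : MemLp (fun p => r p / (freqNorm p : ℂ)) 2 freqMeasure) :
    HasWeakLaplacian (potential r) fun x => -ρ x := by
  refine ⟨(continuous_potential hρ.left hr').locallyIntegrable,
    locallyIntegrable_of_memLp_two hρ.right.neg, fun τ hτ => ?_⟩
  have ht := hτ.star.laplacian
  obtain ⟨R, -, hR⟩ := ht.exists_slab
  have hz : ∫ x, ∑ j, partialD j (partialD j fun x => starRingEnd ℂ (τ x)) x = 0 := by
    rw [integral_finsetSum _ fun j _ => ((hτ.star.partialD j).partialD j).integrable]
    exact Finset.sum_eq_zero fun j _ => (hτ.star.partialD j).integral_partialD j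
  have h1 := integral_potential_mul_star hρ.left hr' ht.integrable hR hz
  have h2 := hρ.eq _ hτ.star
  have e : ∀ x, starRingEnd ℂ (∑ j, partialD j (partialD j fun x => starRingEnd ℂ (τ x)) x)
      = ∑ j, partialD j (partialD j τ) x := fun x => by
    rw [map_sum]
    refine Finset.sum_congr rfl fun j _ => ?_
    rw [← (hτ.star.partialD j).isSmooth.partialD_star]
    congr 1
    ext y
    rw [← hτ.star.isSmooth.partialD_star]
    simp only [Complex.conj_conj]
  simp only [e, Complex.conj_conj] at h1 h2
  simp only [neg_mul]
  rw [h1, integral_neg, h2, ← integral_neg]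
  refine integral_congr_ae ?_
  filter_upwards [ae_freqNorm_ne_zero] with p hp
  have hp' : ((freqNorm p ^ 2 : ℝ) : ℂ) ≠ 0 := by exact_mod_cast pow_ne_zero 2 hp
  simp only [fourierT_laplacian hτ.star, map_neg, map_mul, Complex.conj_ofReal]
  field_simp

theorem memL2loc_of_continuous {f : CylCell → ℂ} (hf : Continuous f) : MemL2loc f := by
  intro K hK
  obtain ⟨C, hC⟩ := hK.exists_bound_of_continuousOn hf.continuousOn
  have : IsFiniteMeasure ((volume : Measure CylCell).restrict K) :=
    ⟨by simpa using hK.measure_lt_top⟩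
  exact MemLp.of_bound hf.aestronglyMeasurable C
    ((ae_restrict_iff' hK.measurableSet).2 (Filter.Eventually.of_forall hC))

theorem memL2loc_of_memLp {f : CylCell → ℂ} (hf : MemLp f 2) : MemL2loc f :=
  fun K _ => hf.restrict K

theorem memH2loc_potential (hr : MemLp r 2 freqMeasure)
    (hr' : MemLp (fun p => r p / (freqNorm p : ℂ)) 2 freqMeasure) : MemH2loc (potential r) := by
  refine ⟨memL2loc_of_continuous (continuous_potential hr hr'), fun j => ?_⟩
  obtain ⟨g, hg⟩ := exists_isInvFourier_of_freq (memLp_freqVec_mul_div hr' hr.1 j)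
  refine ⟨g, hasWeakPartial_potential hr hr' hg, memL2loc_of_memLp hg.right, fun i => ?_⟩
  obtain ⟨h, hh⟩ := exists_isInvFourier_of_freq (memLp_freqVec_mul_freqVec_mul_div hr i j)
  exact ⟨h, hg.hasWeakPartial hh, memL2loc_of_memLp hh.right⟩

/-! ### Reality -/

theorem freqVec_neg (p : Freq) (j : Fin 3) : freqVec (-p) j = -freqVec p j := by
  fin_cases j <;> simp [freqVec]

theorem freqNorm_neg (p : Freq) : freqNorm (-p) = freqNorm p := by
  simp [freqNorm]

theorem wave_neg (p : Freq) (x : CylCell) : wave (-p) x = starRingEnd ℂ (wave p x) := by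
  obtain ⟨y, rfl⟩ := proj_surjective x
  simp only [wave_proj, freqVec_neg, map_mul, Complex.conj_ofReal, ← Complex.exp_conj,
    Complex.conj_I, neg_mul, Finset.sum_neg_distrib, Complex.ofReal_neg, mul_neg]

theorem potKernel_neg (p : Freq) (x : CylCell) :
    potKernel (-p) x = starRingEnd ℂ (potKernel p x) := by
  have h : -p ∈ lowFreq ↔ p ∈ lowFreq := by simp [mem_lowFreq]
  unfold potKernel
  by_cases hp : p ∈ lowFreq
  · rw [Set.indicator_of_mem hp, Set.indicator_of_mem (h.2 hp), wave_neg, wave_neg, map_sub]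
  · rw [Set.indicator_of_notMem hp, Set.indicator_of_notMem (mt h.1 hp), wave_neg, sub_zero, sub_zero]

theorem fourierT_neg {f : CylCell → ℂ} (hf : ∀ x, starRingEnd ℂ (f x) = f x) (p : Freq) :
    fourierT f (-p) = starRingEnd ℂ (fourierT f p) := by
  simp only [fourierT_eq, ← integral_conj, map_mul, wave_neg, hf]

theorem measurePreserving_neg_freq : MeasurePreserving (fun p : Freq => -p) freqMeasure freqMeasure :=
  (Measure.measurePreserving_neg (Measure.count : Measure ℤ)).prod
    ((Measure.measurePreserving_neg (Measure.count : Measure ℤ)).prod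
      (Measure.measurePreserving_neg (volume : Measure ℝ)))

theorem integral_neg_freq (F : Freq → ℂ) :
    ∫ p, F (-p) ∂freqMeasure = ∫ p, F p ∂freqMeasure :=
  measurePreserving_neg_freq.integral_comp (MeasurableEquiv.neg Freq).measurableEmbedding F

/-- Reflection `p ↦ -p` preserves the measure, the norm and the low frequencies, and conjugates both
symbol and kernel. -/
theorem star_potential (hs : ∀ p, r (-p) = starRingEnd ℂ (r p)) (x : CylCell) :
    starRingEnd ℂ (potential r x) = potential r x := by
  rw [potential, ← integral_conj, ← integral_neg_freq]
  refine integral_congr_ae (Filter.Eventually.of_forall fun p => ?_)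
  simp only [potTerm, potKernel_neg, hs, freqNorm_neg, map_mul, map_div₀, Complex.conj_ofReal,
    Complex.conj_conj]

/-- The self-force vanishes. -/
theorem integral_grad_potential_mul_self {ρ g : CylCell → ℂ} (hρ : IsInvFourier r ρ)
    (hs : ∀ p, r (-p) = starRingEnd ℂ (r p)) {j : Fin 3}
    (hg : IsInvFourier (fun p => -(Complex.I * freqVec p j) * (r p / ((freqNorm p ^ 2 : ℝ) : ℂ))) g) :
    ∫ x, g x * starRingEnd ℂ (ρ x) = 0 := by
  -- By Parseval the pairing is the integral of `-i p_j |r|²/|p|²`, which is odd under `p ↦ -p`.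
  rw [hg.parseval hρ, ← CharZero.eq_neg_self_iff, ← integral_neg, ← integral_neg_freq]
  refine integral_congr_ae (Filter.Eventually.of_forall fun p => ?_)
  simp only [hs, freqNorm_neg, freqVec_neg, Complex.conj_conj, Complex.ofReal_neg]
  ring

end

/-! ### The domain of `Λ` -/

/-- The Fourier transform of `f` minus its value at zero, divided by `|ξ|`, is square integrable near
zero on the line `𝐤 = 0`. -/
def LowSq (f : CylCell → ℂ) : Prop :=
  MemLp (fun ξ : ℝ => (fourierT f (0, 0, ξ) - ((1 / Real.sqrt (2 * Real.pi) : ℝ) : ℂ) * ∫ x, f x)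
    / ((|ξ| : ℝ) : ℂ)) 2 (volume.restrict (Set.Ioo (-1 : ℝ) 1))

theorem LowSq.add {f g : CylCell → ℂ} (hf : LowSq f) (hg : LowSq g) (hfi : Integrable f)
    (hgi : Integrable g) : LowSq fun x => f x + g x := by
  refine (MemLp.add hf hg).ae_eq (Filter.Eventually.of_forall fun ξ => ?_)
  simp only [Pi.add_apply]
  rw [fourierT_add hfi hgi, integral_add hfi hgi]
  ring

theorem LowSq.const_mul {f : CylCell → ℂ} (c : ℂ) (hf : LowSq f) : LowSq fun x => c * f x := by
  refine (MemLp.const_mul hf c).ae_eq (Filter.Eventually.of_forall fun ξ => ?_)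
  simp only
  rw [fourierT_const_mul, integral_const_mul]
  ring

theorem LowSq.sub {f g : CylCell → ℂ} (hf : LowSq f) (hg : LowSq g) (hfi : Integrable f)
    (hgi : Integrable g) : LowSq fun x => f x - g x := by
  simpa only [neg_one_mul, sub_eq_add_neg] using hf.add (hg.const_mul (-1)) hfi (hgi.const_mul (-1))

theorem mem_lowFreq_section {ξ : ℝ} (hξ : ξ ∈ Set.Ioo (-1 : ℝ) 1) : ((0, 0, ξ) : Freq) ∈ lowFreq :=
  ⟨rfl, rfl, hξ⟩

theorem wave_section_zero (ξ : ℝ) :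
    wave (0, 0, ξ) 0 = ((1 / Real.sqrt (2 * Real.pi) : ℝ) : ℂ) := by
  rw [wave]
  simp

theorem norm_wave_sub_wave_zero {p : Freq} (hp : p ∈ lowFreq) (x : CylCell) :
    ‖wave p x - wave p 0‖ ≤ freqNorm p * |x.2.2| := by
  have := norm_potKernel_le_mul hp x
  unfold potKernel at this
  rwa [Set.indicator_of_mem hp, ← map_sub, RCLike.norm_conj] at this

theorem measurable_fourierT_section {f : CylCell → ℂ} (hf : AEStronglyMeasurable f) :
    Measurable fun ξ : ℝ => fourierT f (0, 0, ξ) :=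
  (stronglyMeasurable_fourierT hf).measurable.comp (measurableEmbedding_section 0 0).measurable

/-- With a finite first moment in `x₃` the quotient is even bounded, since `|e^{iξx₃} - 1| ≤
|ξ||x₃|`. -/
theorem lowSq_of_moment {f : CylCell → ℂ} (hf : Integrable f)
    (hm : Integrable fun x : CylCell => |x.2.2| * ‖f x‖) : LowSq f := by
  have hmeas := measurable_fourierT_section hf.aestronglyMeasurable
  refine MemLp.of_bound (by fun_prop : Measurable _).aestronglyMeasurable
    (∫ x : CylCell, |x.2.2| * ‖f x‖) ((ae_restrict_iff' measurableSet_Ioo).2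
      (Filter.Eventually.of_forall fun ξ hξ => ?_))
  have hp := mem_lowFreq_section hξ
  have e : fourierT f (0, 0, ξ) - ((1 / Real.sqrt (2 * Real.pi) : ℝ) : ℂ) * ∫ x, f x
      = ∫ x, (wave (0, 0, ξ) x - wave (0, 0, ξ) 0) * f x := by
    simp only [sub_mul]
    rw [integral_sub (integrable_wave_mul hf _) (hf.const_mul _), integral_const_mul, fourierT_eq,
      wave_section_zero]
  rw [e, norm_div, Complex.norm_real, Real.norm_eq_abs, abs_abs]
  refine div_le_of_le_mul₀ (abs_nonneg _) (integral_nonneg fun x => by positivity) ?_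
  rw [← integral_mul_const]
  refine norm_integral_le_of_norm_le (hm.mul_const _) (Filter.Eventually.of_forall fun x => ?_)
  rw [norm_mul]
  have := norm_wave_sub_wave_zero hp x
  rw [freqNorm_of_mem_lowFreq hp] at this
  calc _ ≤ |ξ| * |x.2.2| * ‖f x‖ := by gcongr
    _ = _ := by ring

theorem restrict_lowFreq : freqMeasure.restrict lowFreq
    = (volume.restrict (Set.Ioo (-1 : ℝ) 1)).map fun ξ : ℝ => ((0, 0, ξ) : Freq) := by
  have h1 : lowFreq ∩ ({0} ×ˢ ({0} ×ˢ Set.univ)) = lowFreq := by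
    ext p
    simp only [lowFreq, Set.mem_inter_iff, Set.mem_prod, Set.mem_univ, and_true]
    tauto
  have h2 : (fun ξ : ℝ => ((0, 0, ξ) : Freq)) ⁻¹' lowFreq = Set.Ioo (-1) 1 := by
    ext ξ
    simp [lowFreq]
  rw [← h2, ← (measurableEmbedding_section 0 0).restrict_map, ← freqMeasure_restrict,
    Measure.restrict_restrict measurableSet_lowFreq, h1]

/-- The gap of the lattice gives `|p| ≥ 1` away from the low frequencies, where division is
harmless. On them, neutrality removes the constant in `LowSq` and leaves exactly the required
quotient. -/
theorem memLp_div_freqNorm {f : CylCell → ℂ} (hf1 : Integrable f) (hf2 : MemLp f 2)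
    (hl : LowSq f) (h0 : ∫ x, f x = 0) :
    MemLp (fun p => fourierT f p / (freqNorm p : ℂ)) 2 freqMeasure := by
  have hN := measurable_freqNorm
  have hr := memLp_fourierT hf1 hf2
  refine memLp_two_iff_lintegral.2 ⟨hr.1.mul (by fun_prop : Measurable fun p : Freq =>
    (freqNorm p : ℂ)⁻¹).aestronglyMeasurable, ?_⟩
  rw [← lintegral_add_compl _ measurableSet_lowFreq]
  refine ENNReal.add_lt_top.2 ⟨?_, ?_⟩
  · refine MemLp.lintegral_sq_lt_top ?_
    rw [restrict_lowFreq, (measurableEmbedding_section 0 0).memLp_map_measure_iff]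
    refine MemLp.ae_eq ((ae_restrict_iff' measurableSet_Ioo).2 (Filter.Eventually.of_forall
      fun ξ hξ => ?_)) hl
    simp only [Function.comp]
    rw [h0, mul_zero, sub_zero, freqNorm_of_mem_lowFreq (mem_lowFreq_section hξ)]
  · refine lt_of_le_of_lt (setLIntegral_mono' measurableSet_lowFreq.compl fun p hp => ?_)
      (lt_of_le_of_lt (setLIntegral_le_lintegral _ _) hr.lintegral_sq_lt_top)
    gcongr
    rw [← ofReal_norm, ← ofReal_norm]
    refine ENNReal.ofReal_le_ofReal ?_
    rw [norm_div, Complex.norm_real, Real.norm_of_nonneg (freqNorm_nonneg p)]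
    exact div_le_self (norm_nonneg _) (one_le_freqNorm_of_notMem hp)

theorem exists_isLambda {f : CylCell → ℂ} (hf1 : Integrable f) (hf2 : MemLp f 2)
    (hl : LowSq f) (h0 : ∫ x, f x = 0) : ∃ g, IsLambda f g := by
  obtain ⟨g, hg⟩ := exists_isInvFourier_of_freq (memLp_div_freqNorm hf1 hf2 hl h0)
  exact ⟨g, hf1, hf2, hg⟩

theorem continuous_fourierT_section {f : CylCell → ℂ} (hf : Integrable f) :
    Continuous fun ξ : ℝ => fourierT f (0, 0, ξ) := by
  simp only [fourierT_eq]
  refine continuous_of_dominated (bound := fun x => ‖f x‖)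
    (fun ξ => (integrable_wave_mul hf _).1) (fun ξ => Filter.Eventually.of_forall fun x => ?_)
    hf.norm (Filter.Eventually.of_forall fun x => ?_)
  · rw [norm_mul]
    exact mul_le_of_le_one_left (norm_nonneg _) (norm_wave_le_one _ x)
  · unfold wave
    fun_prop

namespace IsLambda

variable {f f' g g' : CylCell → ℂ}

/-- A density in the domain of `Λ` is neutral. -/
theorem integral_eq_zero (h : IsLambda f g) : ∫ x, f x = 0 := by
  have hc := continuous_fourierT_section h.integrable
  have hs := MemLp.section h.inv.left 0 0
  by_contra hne
  have h0 : fourierT f (0, 0, 0) ≠ 0 := by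
    have e : fourierT f (0, 0, 0) = ((1 / Real.sqrt (2 * Real.pi) : ℝ) : ℂ) * ∫ x, f x := by
      rw [fourierT]
      simp
    rw [e]
    refine mul_ne_zero ?_ hne
    exact_mod_cast (by positivity : (1 / Real.sqrt (2 * Real.pi)) ≠ 0)
  set c := ‖fourierT f (0, 0, 0)‖ / 2 with hcdef
  have hc0 : 0 < c := by have := norm_pos_iff.2 h0; positivity
  have hev : ∀ᶠ ξ : ℝ in nhds 0, c < ‖fourierT f (0, 0, ξ)‖ :=
    hc.norm.continuousAt.eventually_const_lt (by
      have := norm_pos_iff.2 h0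
      simp only [hcdef]; linarith)
  obtain ⟨δ, hδ, hball⟩ := Metric.eventually_nhds_iff.1 hev
  have hi := ((hs.restrict (Set.Ioo 0 δ)).integrable one_le_two).norm
  have hlt : (0 : ℝ) < δ := hδ
  -- By continuity the transform stays above `c` in modulus on `(0, δ)`. A square integrable
  -- quotient is integrable on this bounded interval, and would make `1/ξ` integrable there.
  have hbad : IntegrableOn (fun ξ : ℝ => ξ ^ (-1 : ℝ)) (Set.Ioo 0 δ) := by
    refine Integrable.mono' (hi.const_mul c⁻¹)
      (by fun_prop : Measurable fun ξ : ℝ => ξ ^ (-1 : ℝ)).aestronglyMeasurable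
      ((ae_restrict_iff' measurableSet_Ioo).2 (Filter.Eventually.of_forall fun ξ hξ => ?_))
    have h1 : c < ‖fourierT f (0, 0, ξ)‖ := hball (by
      rw [dist_zero_right, Real.norm_of_nonneg hξ.1.le]; exact hξ.2)
    have h2 : freqNorm (0, 0, ξ) = ξ := by
      simp only [freqNorm, Int.cast_zero, mul_zero]
      rw [← Real.sqrt_sq hξ.1.le]
      congr 1
      rw [Real.sqrt_sq hξ.1.le]
      ring
    rw [h2, norm_div, Complex.norm_real, Real.norm_of_nonneg hξ.1.le, Real.rpow_neg_one,
      norm_inv, Real.norm_of_nonneg hξ.1.le, ← mul_div_assoc, ← one_div]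
    refine div_le_div_of_nonneg_right ?_ hξ.1.le
    rw [inv_mul_eq_div, one_le_div hc0]
    exact h1.le
  have := (intervalIntegral.integrableOn_Ioo_rpow_iff (s := -1) hlt).1 hbad
  linarith

theorem lowSq (h : IsLambda f g) : LowSq f := by
  have h1 := h.inv.left.restrict lowFreq
  rw [restrict_lowFreq, (measurableEmbedding_section 0 0).memLp_map_measure_iff] at h1
  refine MemLp.ae_eq ((ae_restrict_iff' measurableSet_Ioo).2 (Filter.Eventually.of_forall
      fun ξ hξ => ?_)) h1
  simp only [Function.comp]
  rw [h.integral_eq_zero, mul_zero, sub_zero, freqNorm_of_mem_lowFreq (mem_lowFreq_section hξ)]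

theorem add (h : IsLambda f g) (h' : IsLambda f' g') :
    IsLambda (fun x => f x + f' x) fun x => g x + g' x :=
  ⟨h.integrable.add h'.integrable, h.memLp.add h'.memLp,
    (h.inv.add h'.inv).congr_freq (Filter.Eventually.of_forall fun p => by
      simp only [fourierT_add h.integrable h'.integrable, add_div])⟩

theorem const_mul (c : ℂ) (h : IsLambda f g) : IsLambda (fun x => c * f x) fun x => c * g x :=
  ⟨h.integrable.const_mul c, h.memLp.const_mul c,
    (h.inv.const_mul c).congr_freq (Filter.Eventually.of_forall fun p => by
      simp only [fourierT_const_mul, mul_div_assoc])⟩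

/-- The Coulomb pairing of two densities through the potential of the first. -/
theorem integral_potential_mul_star (h : IsLambda f g) (h' : IsLambda f' g') {R : ℝ}
    (hR : ∀ x, R < |x.2.2| → f' x = 0) :
    ∫ x, potential (fourierT f) x * starRingEnd ℂ (f' x) = ∫ x, g x * starRingEnd ℂ (g' x) := by
  rw [CylCell.integral_potential_mul_star (memLp_fourierT h.integrable h.memLp) h.inv.left
    h'.integrable hR h'.integral_eq_zero, h.inv.parseval h'.inv]
  refine integral_congr_ae (Filter.Eventually.of_forall fun p => ?_)
  simp only [map_div₀, Complex.conj_ofReal]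
  push_cast
  ring

end IsLambda

end CylCell

end

/-! ### Finite-energy states and weak limits -/

noncomputable section

open Filter Topology

namespace CylCell

theorem MemH1.of_hasWeakPartial {ψ : CylCell → ℂ} {G : Fin 3 → CylCell → ℂ} (h : MemLp ψ 2)
    (hG : ∀ j, HasWeakPartial j ψ (G j)) (hG2 : ∀ j, MemLp (G j) 2) : MemH1 ψ :=
  ⟨h, fun j => ⟨G j, hG j, hG2 j⟩⟩

theorem HasWeakPartial.ae_unique {j : Fin 3} {f g g' : CylCell → ℂ} (hf : MemLp f 2)
    (h : HasWeakPartial j f g) (hg : MemLp g 2) (h' : HasWeakPartial j f g') (hg' : MemLp g' 2) :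
    g =ᵐ[volume] g' := by
  obtain ⟨q, hq⟩ := exists_isInvFourier hf
  exact (h.isInvFourier hg hq).space_unique (h'.isInvFourier hg' hq)

/-- Any competitor in the infimum with finite value is a square integrable weak gradient, hence
almost everywhere equal to the given one. -/
theorem dirichlet_eq {ψ : CylCell → ℂ} {G : Fin 3 → CylCell → ℂ} (h : MemLp ψ 2)
    (hG : ∀ j, HasWeakPartial j ψ (G j)) (hG2 : ∀ j, MemLp (G j) 2) :
    dirichlet ψ = ∑ j, ∫⁻ x, ‖G j x‖ₑ ^ 2 := by
  refine le_antisymm (iInf₂_le G hG) (le_iInf₂ fun g hg => ?_)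
  by_cases ht : ∑ j, ∫⁻ x, ‖g j x‖ₑ ^ 2 = ∞
  · rw [ht]; exact le_top
  refine Finset.sum_le_sum fun j _ => le_of_eq (lintegral_congr_ae ?_)
  have h2 : MemLp (g j) 2 := memLp_two_iff_lintegral.2 ⟨(hg j).right.aestronglyMeasurable,
    (ENNReal.sum_lt_top.1 (lt_top_iff_ne_top.2 ht)) j (Finset.mem_univ j)⟩
  filter_upwards [(hG j).ae_unique h (hG2 j) (hg j) h2] with x hx
  rw [hx]

theorem coulomb_eq {f g : CylCell → ℂ} (h : IsLambda f g) : coulomb f = ∫⁻ x, ‖g x‖ₑ ^ 2 := by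
  refine le_antisymm (iInf₂_le g h) (le_iInf₂ fun g' h' => le_of_eq (lintegral_congr_ae ?_))
  filter_upwards [h.inv.space_unique h'.inv] with x hx
  rw [hx]

theorem exists_isLambda_of_coulomb_ne_top {f : CylCell → ℂ} (h : coulomb f ≠ ∞) :
    ∃ g, IsLambda f g := by
  by_contra hn
  push Not at hn
  exact h (by simp [coulomb, hn])

/-- A wave function of finite energy on the neutral manifold, with its gradient and the field
`Λ ρ` of its charge density. -/
structure IsState (e Z : ℝ) (σ : CylCell → ℝ) (ψ : CylCell → ℂ) (G : Fin 3 → CylCell → ℂ)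
    (g : CylCell → ℂ) : Prop where
  memLp : MemLp ψ 2
  hasWeakPartial : ∀ j, HasWeakPartial j ψ (G j)
  memLp_grad : ∀ j, MemLp (G j) 2
  isLambda : IsLambda (fun x => (charge e σ ψ x : ℂ)) g
  mass : ∫ x, ‖ψ x‖ ^ 2 = Z

/-- The energy in terms of the gradient and the field, with `a = ħ² / (2m)`. -/
def stateEnergy (a : ℝ) (G : Fin 3 → CylCell → ℂ) (g : CylCell → ℂ) : ℝ :=
  a * (∑ j, ∫ x, ‖G j x‖ ^ 2) + 1 / 2 * ∫ x, ‖g x‖ ^ 2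

theorem stateEnergy_nonneg {a : ℝ} (ha : 0 ≤ a) (G : Fin 3 → CylCell → ℂ) (g : CylCell → ℂ) :
    0 ≤ stateEnergy a G g := by
  unfold stateEnergy
  positivity

namespace IsState

variable {e Z : ℝ} {σ : CylCell → ℝ} {ψ g : CylCell → ℂ} {G : Fin 3 → CylCell → ℂ}

theorem memH1 (h : IsState e Z σ ψ G g) : MemH1 ψ :=
  .of_hasWeakPartial h.memLp h.hasWeakPartial h.memLp_grad

theorem mem_neutralManifold (h : IsState e Z σ ψ G g) : ψ ∈ neutralManifold Z := ⟨h.memH1, h.mass⟩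

theorem energy_eq (h : IsState e Z σ ψ G g) {ħ m : ℝ} (hm : 0 < m) :
    energy ħ m e σ ψ = ENNReal.ofReal (stateEnergy (ħ ^ 2 / (2 * m)) G g) := by
  rw [energy, dirichlet_eq h.memLp h.hasWeakPartial h.memLp_grad, coulomb_eq h.isLambda,
    stateEnergy, ENNReal.ofReal_add (by positivity) (by positivity),
    ENNReal.ofReal_mul (by positivity), ENNReal.ofReal_mul (by norm_num),
    ENNReal.ofReal_sum_of_nonneg fun j _ => by positivity,
    lintegral_sq_eq_ofReal_integral h.isLambda.inv.right]
  congr 2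
  · exact Finset.sum_congr rfl fun j _ => lintegral_sq_eq_ofReal_integral (h.memLp_grad j)
  · simp

end IsState

theorem exists_isState_of_energy_ne_top {e Z ħ m : ℝ} {σ : CylCell → ℝ} {ψ : CylCell → ℂ}
    (hψ : ψ ∈ neutralManifold Z) (h : energy ħ m e σ ψ ≠ ∞) : ∃ G g, IsState e Z σ ψ G g := by
  choose G hG hG2 using hψ.1.grad
  obtain ⟨g, hg⟩ := exists_isLambda_of_coulomb_ne_top (f := fun x => (charge e σ ψ x : ℂ))
    fun ht => h (by rw [energy, ht, ENNReal.mul_top (by simp), add_top])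
  exact ⟨G, g, hψ.1.memLp, hG, hG2, hg, hψ.2⟩

theorem integrable_norm_sq {X : Type*} [MeasurableSpace X] {μ : Measure X} {f : X → ℂ}
    (hf : MemLp f 2 μ) : Integrable (fun x => ‖f x‖ ^ 2) μ :=
  hf.norm.integrable_sq

theorem integral_mul_star_self {X : Type*} [MeasurableSpace X] {μ : Measure X} (f : X → ℂ) :
    ∫ x, f x * starRingEnd ℂ (f x) ∂μ = ((∫ x, ‖f x‖ ^ 2 ∂μ : ℝ) : ℂ) := by
  rw [← integral_complex_ofReal]
  exact integral_congr_ae (Eventually.of_forall fun x => by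
    simp only [Complex.mul_conj, Complex.normSq_eq_norm_sq])

theorem integral_mul_star_comm {X : Type*} [MeasurableSpace X] {μ : Measure X} (f g : X → ℂ) :
    ∫ x, f x * starRingEnd ℂ (g x) ∂μ = starRingEnd ℂ (∫ x, g x * starRingEnd ℂ (f x) ∂μ) := by
  rw [← integral_conj]
  exact integral_congr_ae (Eventually.of_forall fun x => by
    simp only [map_mul, Complex.conj_conj, mul_comm])

theorem integral_norm_add_sq {X : Type*} [MeasurableSpace X] {μ : Measure X} {f g : X → ℂ}
    (hf : MemLp f 2 μ) (hg : MemLp g 2 μ) : ∫ x, ‖f x + g x‖ ^ 2 ∂μ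
      = ∫ x, ‖f x‖ ^ 2 ∂μ + 2 * (∫ x, f x * starRingEnd ℂ (g x) ∂μ).re + ∫ x, ‖g x‖ ^ 2 ∂μ := by
  have h1 : (∫ x, f x * starRingEnd ℂ (g x) ∂μ).re = ∫ x, (f x * starRingEnd ℂ (g x)).re ∂μ :=
    (integral_re (integrable_mul_star hf hg)).symm
  have h2 : Integrable (fun x => (f x * starRingEnd ℂ (g x)).re) μ := (integrable_mul_star hf hg).re
  rw [h1, ← integral_const_mul, ← integral_add (integrable_norm_sq hf) (h2.const_mul 2),
    ← integral_add ((integrable_norm_sq hf).fun_add (h2.const_mul 2)) (integrable_norm_sq hg)]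
  refine integral_congr_ae (Eventually.of_forall fun x => ?_)
  simp only [← Complex.normSq_eq_norm_sq, Complex.normSq_add]
  ring

theorem integral_norm_const_mul_sq {X : Type*} [MeasurableSpace X] {μ : Measure X} (c : ℂ)
    (f : X → ℂ) : ∫ x, ‖c * f x‖ ^ 2 ∂μ = ‖c‖ ^ 2 * ∫ x, ‖f x‖ ^ 2 ∂μ := by
  simp only [norm_mul, mul_pow, integral_const_mul]

/-- This is `‖f - g‖² ≥ 0`. The lower bound is affine in `f`, so it passes to weak limits; with `g`
the weak limit it gives lower semicontinuity of the norm. -/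
theorem two_mul_re_integral_sub_le {X : Type*} [MeasurableSpace X] {μ : Measure X} {f g : X → ℂ}
    (hf : MemLp f 2 μ) (hg : MemLp g 2 μ) :
    2 * (∫ x, f x * starRingEnd ℂ (g x) ∂μ).re - ∫ x, ‖g x‖ ^ 2 ∂μ ≤ ∫ x, ‖f x‖ ^ 2 ∂μ := by
  have h := integral_norm_add_sq hf hg.neg
  simp only [Pi.neg_apply, map_neg, mul_neg, integral_neg, Complex.neg_re, norm_neg] at h
  have h0 : 0 ≤ ∫ x, ‖f x + -g x‖ ^ 2 ∂μ := by positivity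
  linarith

/-- Weak convergence in `L²(T₂)`. -/
def WeakTendsto (u : ℕ → CylCell → ℂ) (v : CylCell → ℂ) : Prop :=
  ∀ w, MemLp w 2 → Tendsto (fun n => ∫ x, u n x * starRingEnd ℂ (w x)) atTop
    (𝓝 (∫ x, v x * starRingEnd ℂ (w x)))

theorem WeakTendsto.hasWeakPartial {j : Fin 3} {u G : ℕ → CylCell → ℂ} {v w : CylCell → ℂ}
    (h : WeakTendsto u v) (h' : WeakTendsto G w) (hv : MemLp v 2) (hw : MemLp w 2)
    (hu : ∀ n, HasWeakPartial j (u n) (G n)) : HasWeakPartial j v w := by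
  refine ⟨locallyIntegrable_of_memLp_two hv, locallyIntegrable_of_memLp_two hw, fun τ hτ => ?_⟩
  have h1 := h _ ((hτ.partialD j).star.memLp 2)
  have h2 := (h' _ (hτ.star.memLp 2)).neg
  simp only [Complex.conj_conj] at h1 h2
  exact tendsto_nhds_unique (h1.congr fun n => (hu n).eq τ hτ) h2

theorem IsTest.exists_norm_le_weight_sq {τ : CylCell → ℂ} (hτ : IsTest τ) :
    ∃ C : ℝ, 0 ≤ C ∧ ∀ x, ‖τ x‖ ≤ C * ‖weight x‖ ^ 2 := by
  obtain ⟨B, hB⟩ := hτ.exists_bound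
  obtain ⟨R, hR0, hR⟩ := hτ.exists_slab
  have hB0 : 0 ≤ B := (norm_nonneg _).trans (hB 0)
  refine ⟨B * (1 + R ^ 2) ^ 2, by positivity, fun x => ?_⟩
  by_cases hx : R < |x.2.2|
  · rw [hR x hx, norm_zero]; positivity
  · push Not at hx
    have h1 : ‖weight x‖ = (1 + x.2.2 ^ 2)⁻¹ := by
      rw [weight, Complex.norm_real, Real.norm_of_nonneg (by positivity)]
    have h2 : x.2.2 ^ 2 ≤ R ^ 2 := sq_le_sq' (by linarith [neg_abs_le x.2.2]) (by
      linarith [le_abs_self x.2.2])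
    rw [h1, inv_pow, mul_assoc, ← div_eq_mul_inv]
    refine (hB x).trans (le_mul_of_one_le_right hB0 ?_)
    rw [one_le_div (by positivity)]
    gcongr

/-- Put `d = u_n - v` and expand `|v + d|²`. The cross terms tend to zero by weak convergence. The
term `|d|²` is handled by the weighted Rellich theorem, because a test function is dominated by the
square of the weight. -/
theorem tendsto_integral_norm_sq_mul_test {u : ℕ → CylCell → ℂ} {v : CylCell → ℂ}
    {G : ℕ → Fin 3 → CylCell → ℂ} {H : Fin 3 → CylCell → ℂ} {M : ℝ≥0∞} (hM : M ≠ ∞)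
    (hu : ∀ n, MemLp (u n) 2) (hv : MemLp v 2) (hG : ∀ n j, HasWeakPartial j (u n) (G n j))
    (hG2 : ∀ n j, MemLp (G n j) 2) (hH : ∀ j, HasWeakPartial j v (H j)) (hH2 : ∀ j, MemLp (H j) 2)
    (huM : ∀ n, ∫⁻ x, ‖u n x‖ₑ ^ 2 ≤ M) (hGM : ∀ n j, ∫⁻ x, ‖G n j x‖ₑ ^ 2 ≤ M)
    (hw : WeakTendsto u v) {τ : CylCell → ℂ} (hτ : IsTest τ) :
    Tendsto (fun n => ∫ x, ((‖u n x‖ ^ 2 : ℝ) : ℂ) * τ x) atTop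
      (𝓝 (∫ x, ((‖v x‖ ^ 2 : ℝ) : ℂ) * τ x)) := by
  obtain ⟨C, hC0, hC⟩ := hτ.exists_norm_le_weight_sq
  obtain ⟨B, hB⟩ := hτ.exists_bound
  set d : ℕ → CylCell → ℂ := fun n x => u n x - v x with hd
  have hd2 : ∀ n, MemLp (d n) 2 := fun n => (hu n).sub hv
  have hdw : ∀ w, MemLp w 2 → Tendsto (fun n => ∫ x, d n x * starRingEnd ℂ (w x)) atTop (𝓝 0) := by
    intro w h
    have := (hw w h).sub_const (∫ x, v x * starRingEnd ℂ (w x))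
    rw [sub_self] at this
    refine this.congr fun n => ?_
    rw [← integral_sub (integrable_mul_star (hu n) h) (integrable_mul_star hv h)]
    simp only [hd, sub_mul]
  have hvt : MemLp (fun x => starRingEnd ℂ (τ x) * v x) 2 :=
    memLp_bdd_mul hτ.star.continuous (fun x => by simpa using hB x) hv
  have hvt' : MemLp (fun x => τ x * v x) 2 := memLp_bdd_mul hτ.continuous hB hv
  have hdt : ∀ n, MemLp (fun x => τ x * d n x) 2 := fun n => memLp_bdd_mul hτ.continuous hB (hd2 n)
  have h1 : Tendsto (fun n => ∫ x, d n x * starRingEnd ℂ (starRingEnd ℂ (τ x) * v x)) atTop (𝓝 0) :=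
    hdw _ hvt
  have h2 : Tendsto (fun n => ∫ x, (τ x * v x) * starRingEnd ℂ (d n x)) atTop (𝓝 0) := by
    have := (Complex.continuous_conj.tendsto 0).comp (hdw _ hvt')
    rw [map_zero] at this
    exact this.congr fun n => (integral_mul_star_comm _ _).symm
  have h3 : Tendsto (fun n => ∫ x, (τ x * d n x) * starRingEnd ℂ (d n x)) atTop (𝓝 0) := by
    set M' : ℝ≥0∞ := 2 * M + 2 * ((∫⁻ x, ‖v x‖ₑ ^ 2) + ∑ j, ∫⁻ x, ‖H j x‖ₑ ^ 2) with hM'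
    have hM'top : M' ≠ ∞ := by
      have h4 := hv.lintegral_sq_lt_top.ne
      have h5 : ∑ j, ∫⁻ x, ‖H j x‖ₑ ^ 2 ≠ ∞ :=
        (ENNReal.sum_lt_top.2 fun j _ => (hH2 j).lintegral_sq_lt_top).ne
      finiteness
    have hbd : ∀ (a b : CylCell → ℂ), MemLp a 2 → MemLp b 2 → (∫⁻ x, ‖a x‖ₑ ^ 2 ≤ M) →
        (∫⁻ x, ‖b x‖ₑ ^ 2 ≤ (∫⁻ x, ‖v x‖ₑ ^ 2) + ∑ j, ∫⁻ x, ‖H j x‖ₑ ^ 2) →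
        ∫⁻ x, ‖a x - b x‖ₑ ^ 2 ≤ M' := by
      intro a b ha hb haM hbM
      calc ∫⁻ x, ‖a x - b x‖ₑ ^ 2 ≤ ∫⁻ x, (2 * ‖a x‖ₑ ^ 2 + 2 * ‖b x‖ₑ ^ 2) :=
            lintegral_mono fun x => by
              have := enorm_add_sq_le (a x) (-b x)
              rwa [enorm_neg, ← sub_eq_add_neg] at this
        _ = 2 * (∫⁻ x, ‖a x‖ₑ ^ 2) + 2 * ∫⁻ x, ‖b x‖ₑ ^ 2 := by
            rw [lintegral_add_left' ((ha.1.enorm.pow_const 2).const_mul 2),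
              lintegral_const_mul' _ _ (by simp), lintegral_const_mul' _ _ (by simp)]
        _ ≤ M' := by rw [hM']; gcongr
    have hR := tendsto_lintegral_weight_mul (u := d) (G := fun n j x => G n j x + (-1) * H j x)
      hM'top hd2 (fun n j => by
        simpa only [hd, neg_one_mul, ← sub_eq_add_neg] using
          (hG n j).add ((hH j).const_mul (-1)))
      (fun n j => (hG2 n j).add ((hH2 j).const_mul (-1)))
      (fun n => hbd _ _ (hu n) hv (huM n) le_self_add)
      (fun n j => by
        simp only [neg_one_mul, ← sub_eq_add_neg]
        refine hbd _ _ (hG2 n j) (hH2 j) (hGM n j) (le_add_left ?_)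
        exact Finset.single_le_sum (f := fun j => ∫⁻ x, ‖H j x‖ₑ ^ 2) (fun _ _ => zero_le)
          (Finset.mem_univ j)) hdw
    rw [tendsto_zero_iff_norm_tendsto_zero]
    have hR' : Tendsto (fun n => (ENNReal.ofReal C * ∫⁻ x, ‖weight x * d n x‖ₑ ^ 2).toReal)
        atTop (𝓝 0) := by
      have := ENNReal.Tendsto.const_mul hR (Or.inr (ENNReal.ofReal_ne_top (r := C)))
      rw [mul_zero] at this
      have h9 := (ENNReal.tendsto_toReal ENNReal.zero_ne_top).comp this
      rwa [ENNReal.toReal_zero] at h9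
    refine squeeze_zero (fun n => norm_nonneg _) (fun n => ?_) hR'
    rw [← toReal_enorm]
    refine ENNReal.toReal_mono (ENNReal.mul_ne_top ENNReal.ofReal_ne_top
      (memLp_weight_mul (hd2 n)).lintegral_sq_lt_top.ne) ?_
    refine (enorm_integral_le_lintegral_enorm _).trans ?_
    rw [← lintegral_const_mul' _ _ ENNReal.ofReal_ne_top]
    refine lintegral_mono fun x => ?_
    simp only [← ofReal_norm]
    rw [← ENNReal.ofReal_pow (norm_nonneg _), ← ENNReal.ofReal_mul hC0]
    refine ENNReal.ofReal_le_ofReal ?_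
    rw [norm_mul, norm_mul, norm_mul, RCLike.norm_conj]
    have := mul_le_mul_of_nonneg_right (hC x) (sq_nonneg ‖d n x‖)
    calc _ = ‖τ x‖ * ‖d n x‖ ^ 2 := by ring
      _ ≤ _ := this
      _ = _ := by ring
  have hvv : Integrable fun x => (τ x * v x) * starRingEnd ℂ (v x) := integrable_mul_star hvt' hv
  have key := ((h1.add h2).add h3).const_add (∫ x, (τ x * v x) * starRingEnd ℂ (v x))
  have e : ∀ w : ℂ, ((‖w‖ ^ 2 : ℝ) : ℂ) = w * starRingEnd ℂ w := fun w => by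
    rw [Complex.mul_conj, Complex.normSq_eq_norm_sq]
  rw [add_zero, add_zero, add_zero] at key
  have e0 : ∫ x, ((‖v x‖ ^ 2 : ℝ) : ℂ) * τ x = ∫ x, (τ x * v x) * starRingEnd ℂ (v x) :=
    integral_congr_ae (Eventually.of_forall fun x => by simp only [e]; ring)
  rw [e0]
  refine key.congr fun n => ?_
  have i1 := integrable_mul_star (hd2 n) hvt
  have i2 := integrable_mul_star hvt' (hd2 n)
  have i3 := integrable_mul_star (hdt n) (hd2 n)
  rw [← integral_add i1 i2, ← integral_add (i1.fun_add i2) i3,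
    ← integral_add hvv ((i1.fun_add i2).fun_add i3)]
  refine integral_congr_ae (Eventually.of_forall fun x => ?_)
  simp only [e, hd, map_sub, map_mul, Complex.conj_conj]
  ring

end CylCell

end

/-! ### Trial states and the dual characterization of the field -/

noncomputable section

open Filter Topology

namespace CylCell

theorem IsTest.lowSq {τ : CylCell → ℂ} (hτ : IsTest τ) : LowSq τ := by
  refine lowSq_of_moment hτ.integrable (Continuous.integrable_of_hasCompactSupport ?_ ?_)
  · have := hτ.continuous
    fun_prop
  · exact hτ.compact.norm.mul_left

theorem lowSq_of_condition {e Z : ℝ} {σ : CylCell → ℝ} (hσZ : ∫ x, σ x = e * Z)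
    (hII : MemLp (fun ξ : ℝ => (fourierT (fun x => (σ x : ℂ)) (0, 0, ξ)
        - ((e * Z / Real.sqrt (2 * Real.pi) : ℝ) : ℂ)) / ((|ξ| : ℝ) : ℂ))
      2 (volume.restrict (Set.Ioo (-1 : ℝ) 1))) : LowSq fun x => (σ x : ℂ) := by
  unfold LowSq
  convert hII using 4 with ξ
  rw [integral_complex_ofReal, hσZ, ← Complex.ofReal_mul]
  congr 1
  ring

theorem exists_isTest_integral_norm_sq {Z : ℝ} (hZ : 0 < Z) :
    ∃ τ : CylCell → ℂ, IsTest τ ∧ ∫ x, ‖τ x‖ ^ 2 = Z := by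
  let b : ContDiffBump (0 : ℝ) := ⟨1, 2, by norm_num, by norm_num⟩
  have hsm : IsSmooth fun x : CylCell => ((b x.2.2 : ℝ) : ℂ) :=
    IsSmooth.comp_height (χ := fun s => ((b s : ℝ) : ℂ)) (Complex.ofRealCLM.contDiff.comp b.contDiff)
  have ht : IsTest fun x : CylCell => ((b x.2.2 : ℝ) : ℂ) :=
    .of_slab hsm (R := 2) fun x hx => by
      rw [b.zero_of_le_dist (by simpa [Real.dist_eq] using hx.le), Complex.ofReal_zero]
  set N := ∫ x : CylCell, ‖((b x.2.2 : ℝ) : ℂ)‖ ^ 2 with hN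
  have hN0 : 0 < N := by
    have hc : Continuous fun x : CylCell => ‖((b x.2.2 : ℝ) : ℂ)‖ ^ 2 := by
      have := ht.continuous
      fun_prop
    refine hc.integral_pos_of_hasCompactSupport_nonneg_nonzero (x := 0) ?_ (fun x => by positivity) ?_
    · simp only [sq]
      exact ht.compact.norm.mul_left
    · have : b ((0 : CylCell).2.2) = 1 :=
        b.one_of_mem_closedBall (by simp [b])
      rw [this]
      simp
  refine ⟨fun x => (Real.sqrt (Z / N) : ℂ) * ((b x.2.2 : ℝ) : ℂ), ht.const_mul _, ?_⟩
  rw [integral_norm_const_mul_sq, ← hN, Complex.norm_real, Real.norm_of_nonneg (Real.sqrt_nonneg _),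
    Real.sq_sqrt (by positivity), div_mul_cancel₀ _ hN0.ne']

variable {e Z : ℝ} {σ : CylCell → ℝ}

theorem ofReal_charge (ψ : CylCell → ℂ) (x : CylCell) :
    (charge e σ ψ x : ℂ) = (σ x : ℂ) - (e : ℂ) * ((‖ψ x‖ ^ 2 : ℝ) : ℂ) := by
  rw [charge]
  push_cast
  rfl

theorem integrable_norm_sq_ofReal {ψ : CylCell → ℂ} (hψ : MemLp ψ 2) :
    Integrable fun x => ((‖ψ x‖ ^ 2 : ℝ) : ℂ) :=
  (integrable_norm_sq hψ).ofReal

theorem integrable_ofReal (hσ1 : MemLp σ 1) : Integrable fun x => (σ x : ℂ) :=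
  (memLp_one_iff_integrable.1 hσ1).ofReal

theorem integral_ofReal_charge (hσ1 : MemLp σ 1) {ψ : CylCell → ℂ} (hψ : MemLp ψ 2) :
    ∫ x, (charge e σ ψ x : ℂ) = ((∫ x, σ x : ℝ) : ℂ) - e * ((∫ x, ‖ψ x‖ ^ 2 : ℝ) : ℂ) := by
  simp only [ofReal_charge]
  rw [integral_sub (integrable_ofReal hσ1)
    ((integrable_norm_sq_ofReal hψ).const_mul _), integral_const_mul, integral_complex_ofReal,
    integral_complex_ofReal]

theorem integrable_charge (hσ1 : MemLp σ 1) {ψ : CylCell → ℂ} (hψ : MemLp ψ 2) :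
    Integrable fun x => (charge e σ ψ x : ℂ) := by
  simp only [ofReal_charge]
  exact (integrable_ofReal hσ1).sub ((integrable_norm_sq_ofReal hψ).const_mul _)

theorem MemH1.memLp_norm_sq_ofReal {ψ : CylCell → ℂ} (hψ : MemH1 ψ) :
    MemLp (fun x => ((‖ψ x‖ ^ 2 : ℝ) : ℂ)) 2 := hψ.memLp_norm_sq.ofReal

theorem memLp_charge (hσ2 : MemLp σ 2) {ψ : CylCell → ℂ} (hψ : MemH1 ψ) :
    MemLp (fun x => (charge e σ ψ x : ℂ)) 2 := by
  simp only [ofReal_charge]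
  exact hσ2.ofReal.sub (hψ.memLp_norm_sq_ofReal.const_mul _)

theorem IsTest.norm_sq {τ : CylCell → ℂ} (hτ : IsTest τ) : IsTest fun x => ((‖τ x‖ ^ 2 : ℝ) : ℂ) := by
  have := hτ.star.smooth_mul hτ.isSmooth
  simpa only [Complex.mul_conj, Complex.normSq_eq_norm_sq] using this

/-- Condition II makes the trial energy finite: for a test function of mass `Z` the total density is
neutral, and both `σ` and the compactly supported electron density are admissible at low
frequencies. -/
theorem exists_isState (hZ : 0 < Z) (hσ1 : MemLp σ 1) (hσ2 : MemLp σ 2) (hσZ : ∫ x, σ x = e * Z)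
    (hl : LowSq fun x => (σ x : ℂ)) : ∃ ψ G g, IsState e Z σ ψ G g := by
  obtain ⟨τ, hτ, hτZ⟩ := exists_isTest_integral_norm_sq hZ
  have hG : ∀ j, HasWeakPartial j τ (partialD j τ) := hτ.isSmooth.hasWeakPartial
  have hG2 : ∀ j, MemLp (partialD j τ) 2 := fun j => (hτ.partialD j).memLp 2
  have h2 := hτ.memLp 2
  obtain ⟨g, hg⟩ := exists_isLambda (integrable_charge (e := e) hσ1 h2)
    (memLp_charge hσ2 (.of_hasWeakPartial h2 hG hG2))
    (by
      simp only [ofReal_charge]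
      exact hl.sub (hτ.norm_sq.lowSq.const_mul _) (integrable_ofReal hσ1)
        ((integrable_norm_sq_ofReal h2).const_mul _))
    (by rw [integral_ofReal_charge hσ1 h2, hσZ, hτZ]; push_cast; ring)
  exact ⟨τ, _, g, h2, hG, hG2, hg, hτZ⟩

theorem memLp_freqNorm_mul_fourierT {τ : CylCell → ℂ} (hτ : IsTest τ) :
    MemLp (fun p => (freqNorm p : ℂ) * fourierT τ p) 2 freqMeasure :=
  (MemH1.of_hasWeakPartial (hτ.memLp 2) hτ.isSmooth.hasWeakPartial
    fun j => (hτ.partialD j).memLp 2).memLp_freqNorm_mul (isInvFourier_fourierT hτ.integrable (hτ.memLp 2))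

/-- `⟨f, τ⟩ = ⟨Λ f, (-Δ)^(1/2) τ⟩`. -/
theorem IsLambda.integral_mul_star {f g τ η : CylCell → ℂ} (h : IsLambda f g) (hτ : IsTest τ)
    (hη : IsInvFourier (fun p => (freqNorm p : ℂ) * fourierT τ p) η) :
    ∫ x, g x * starRingEnd ℂ (η x) = ∫ x, f x * starRingEnd ℂ (τ x) := by
  rw [h.inv.parseval hη, (isInvFourier_fourierT h.integrable h.memLp).eq τ hτ]
  refine integral_congr_ae ?_
  filter_upwards [ae_freqNorm_ne_zero] with p hp
  have hp' : (freqNorm p : ℂ) ≠ 0 := by exact_mod_cast hp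
  rw [map_mul, Complex.conj_ofReal]
  field_simp

/-- The converse of `IsLambda.integral_mul_star`. The condition is linear in `f` and in `g` and
tests against fixed functions, so it survives weak limits of the fields and distributional limits of
the densities. -/
theorem isLambda_of_forall_test {f g : CylCell → ℂ} (hf1 : Integrable f) (hf2 : MemLp f 2)
    (hg : MemLp g 2) (H : ∀ τ η, IsTest τ →
      IsInvFourier (fun p => (freqNorm p : ℂ) * fourierT τ p) η →
      ∫ x, g x * starRingEnd ℂ (η x) = ∫ x, f x * starRingEnd ℂ (τ x)) : IsLambda f g := by
  obtain ⟨q, hq⟩ := exists_isInvFourier hg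
  have hf := isInvFourier_fourierT hf1 hf2
  have hN := measurable_freqNorm
  have key : fourierT f =ᵐ[freqMeasure] fun p => (freqNorm p : ℂ) * q p := by
    refine ae_eq_mul_of_forall_test (m := fun p => (freqNorm p : ℂ)) (by fun_prop) (fun p => ?_)
      hq.left hf.left (fun τ hτ => ?_) fun τ hτ => ?_
    · rw [Complex.norm_real, Real.norm_of_nonneg (freqNorm_nonneg p)]
      nlinarith [sq_nonneg (freqNorm p - 1), freqNorm_nonneg p]
    · simpa only [Complex.conj_ofReal] using memLp_freqNorm_mul_fourierT hτ
    · obtain ⟨η, hη⟩ := exists_isInvFourier_of_freq (memLp_freqNorm_mul_fourierT hτ)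
      rw [← hf.eq τ hτ, ← H τ η hτ hη, hq.parseval hη]
      simp only [Complex.conj_ofReal]
  refine ⟨hf1, hf2, hq.congr_freq ?_⟩
  filter_upwards [key, ae_freqNorm_ne_zero] with p hp hp0
  have hp' : (freqNorm p : ℂ) ≠ 0 := by exact_mod_cast hp0
  rw [hp, mul_div_cancel_left₀ _ hp']

/-- The sequence consists of the affine lower bounds of `two_mul_re_integral_sub_le` for the
energies, taken at the weak limit. -/
theorem tendsto_stateEnergy_lower (a : ℝ) {G : ℕ → Fin 3 → CylCell → ℂ} {g : ℕ → CylCell → ℂ}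
    {H : Fin 3 → CylCell → ℂ} {h : CylCell → ℂ} (hH : ∀ j, MemLp (H j) 2) (hh : MemLp h 2)
    (hG : ∀ j, WeakTendsto (fun n => G n j) (H j)) (hg : WeakTendsto g h) :
    Tendsto (fun n => a * (∑ j, (2 * (∫ x, G n j x * starRingEnd ℂ (H j x)).re - ∫ x, ‖H j x‖ ^ 2))
      + 1 / 2 * (2 * (∫ x, g n x * starRingEnd ℂ (h x)).re - ∫ x, ‖h x‖ ^ 2)) atTop
      (𝓝 (stateEnergy a H h)) := by
  have key : ∀ {u : ℕ → CylCell → ℂ} {v : CylCell → ℂ}, MemLp v 2 → WeakTendsto u v →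
      Tendsto (fun n => 2 * (∫ x, u n x * starRingEnd ℂ (v x)).re - ∫ x, ‖v x‖ ^ 2) atTop
        (𝓝 (∫ x, ‖v x‖ ^ 2)) := fun {u v} hv huv => by
    have h1 := (Complex.continuous_re.tendsto _).comp (huv v hv)
    rw [integral_mul_star_self, Complex.ofReal_re] at h1
    have h2 := (h1.const_mul 2).sub_const (∫ x, ‖v x‖ ^ 2)
    rwa [two_mul (∫ x, ‖v x‖ ^ 2), add_sub_cancel_right] at h2
  unfold stateEnergy
  exact ((tendsto_finsetSum _ fun j _ => key (hH j) (hG j)).const_mul a).add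
    ((key hh hg).const_mul (1 / 2))

end CylCell

end

/-! ### Existence of a minimizer -/

noncomputable section

open Filter Topology

namespace CylCell

variable {e Z : ℝ} {σ : CylCell → ℝ}

theorem integral_charge_mul_test (hσ1 : MemLp σ 1) {ψ τ : CylCell → ℂ} (hψ : MemLp ψ 2)
    (hτ : IsTest τ) : ∫ x, (charge e σ ψ x : ℂ) * τ x
      = (∫ x, (σ x : ℂ) * τ x) - e * ∫ x, ((‖ψ x‖ ^ 2 : ℝ) : ℂ) * τ x := by
  simp only [ofReal_charge, sub_mul, mul_assoc]
  rw [integral_sub (integrable_mul_test (integrable_ofReal hσ1).locallyIntegrable hτ)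
    ((integrable_mul_test (integrable_norm_sq_ofReal hψ).locallyIntegrable hτ).const_mul _),
    integral_const_mul]

theorem integral_norm_sq_le_of_stateEnergy_le {a B : ℝ} (ha : 0 < a) {g : CylCell → ℂ}
    {G : Fin 3 → CylCell → ℂ} (h : stateEnergy a G g ≤ B) :
    (∀ j, ∫ x, ‖G j x‖ ^ 2 ≤ B / a) ∧ ∫ x, ‖g x‖ ^ 2 ≤ 2 * B := by
  unfold stateEnergy at h
  have h1 : 0 ≤ ∫ x, ‖g x‖ ^ 2 := by positivity
  have h2 : ∀ j, 0 ≤ ∫ x, ‖G j x‖ ^ 2 := fun j => by positivity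
  have h3 : 0 ≤ a * ∑ j, ∫ x, ‖G j x‖ ^ 2 := by positivity
  refine ⟨fun j => ?_, by linarith⟩
  rw [le_div_iff₀ ha]
  have h4 := Finset.single_le_sum (f := fun j => ∫ x, ‖G j x‖ ^ 2) (fun j _ => h2 j)
    (Finset.mem_univ j)
  nlinarith

/-- A weak limit of states of bounded energy is a state. -/
theorem IsState.of_weakTendsto (he : e ≠ 0) (hσ1 : MemLp σ 1) (hσ2 : MemLp σ 2)
    (hσZ : ∫ x, σ x = e * Z) {ψ : ℕ → CylCell → ℂ} {G : ℕ → Fin 3 → CylCell → ℂ}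
    {g : ℕ → CylCell → ℂ} (hs : ∀ n, IsState e Z σ (ψ n) (G n) (g n)) {M : ℝ≥0∞} (hM : M ≠ ∞)
    (hψM : ∀ n, ∫⁻ x, ‖ψ n x‖ₑ ^ 2 ≤ M) (hGM : ∀ n j, ∫⁻ x, ‖G n j x‖ₑ ^ 2 ≤ M)
    {ψ₀ g₀ : CylCell → ℂ} {G₀ : Fin 3 → CylCell → ℂ} (h2 : MemLp ψ₀ 2) (hG2 : ∀ j, MemLp (G₀ j) 2)
    (hg2 : MemLp g₀ 2) (hψ : WeakTendsto ψ ψ₀) (hG : ∀ j, WeakTendsto (fun n => G n j) (G₀ j))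
    (hg : WeakTendsto g g₀) : IsState e Z σ ψ₀ G₀ g₀ := by
  have hp : ∀ j, HasWeakPartial j ψ₀ (G₀ j) := fun j =>
    hψ.hasWeakPartial (hG j) h2 (hG2 j) fun n => (hs n).hasWeakPartial j
  have hl : IsLambda (fun x => (charge e σ ψ₀ x : ℂ)) g₀ := by
    refine isLambda_of_forall_test (integrable_charge hσ1 h2)
      (memLp_charge hσ2 (.of_hasWeakPartial h2 hp hG2)) hg2 fun τ η hτ hη => ?_
    refine tendsto_nhds_unique (hg η hη.right) ?_
    simp only [fun n => (hs n).isLambda.integral_mul_star hτ hη]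
    simp only [fun n => integral_charge_mul_test (e := e) hσ1 (hs n).memLp hτ.star,
      integral_charge_mul_test (e := e) hσ1 h2 hτ.star]
    exact ((tendsto_integral_norm_sq_mul_test hM (fun n => (hs n).memLp) h2
      (fun n => (hs n).hasWeakPartial) (fun n => (hs n).memLp_grad) hp hG2 hψM hGM hψ
      hτ.star).const_mul _).const_sub _
  refine ⟨h2, hp, hG2, hl, ?_⟩
  -- No mass is lost in the limit: the limit density has a field, hence is neutral, and `e ≠ 0`
  -- fixes the electron mass.
  have h0 := hl.integral_eq_zero
  rw [integral_ofReal_charge hσ1 h2, hσZ, sub_eq_zero] at h0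
  have h1 : e * Z = e * ∫ x, ‖ψ₀ x‖ ^ 2 := by exact_mod_cast h0
  exact (mul_left_cancel₀ he h1).symm

theorem exists_minimal_state {a : ℝ} (ha : 0 < a) (he : e ≠ 0) (hZ : 0 < Z) (hσ1 : MemLp σ 1)
    (hσ2 : MemLp σ 2) (hσZ : ∫ x, σ x = e * Z) (hl : LowSq fun x => (σ x : ℂ)) :
    ∃ ψ G g, IsState e Z σ ψ G g ∧
      ∀ ψ' G' g', IsState e Z σ ψ' G' g' → stateEnergy a G g ≤ stateEnergy a G' g' := by
  set S : Set ℝ := {E | ∃ ψ G g, IsState e Z σ ψ G g ∧ stateEnergy a G g = E} with hS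
  obtain ⟨ψ', G', g', h'⟩ := exists_isState hZ hσ1 hσ2 hσZ hl
  have hbdd : BddBelow S := ⟨0, by
    rintro _ ⟨ψ, G, g, -, rfl⟩
    exact stateEnergy_nonneg ha.le G g⟩
  obtain ⟨u, hu, hlim, hmem⟩ := exists_seq_tendsto_sInf (S := S) ⟨_, ψ', G', g', h', rfl⟩ hbdd
  choose ψ G g hs hE using hmem
  have hB : ∀ n, stateEnergy a (G n) (g n) ≤ u 0 := fun n => (hE n).le.trans (hu (Nat.zero_le n))
  have hB0 : 0 ≤ u 0 := (stateEnergy_nonneg ha.le (G 0) (g 0)).trans (hB 0)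
  have hbd := fun n => integral_norm_sq_le_of_stateEnergy_le ha (hB n)
  set M := ENNReal.ofReal (Z + u 0 / a + 2 * u 0) with hM
  have hdiv : 0 ≤ u 0 / a := by positivity
  have hψM : ∀ n, ∫⁻ x, ‖ψ n x‖ₑ ^ 2 ≤ M := fun n => by
    rw [lintegral_sq_eq_ofReal_integral (hs n).memLp, (hs n).mass]
    exact ENNReal.ofReal_le_ofReal (by linarith)
  have hGM : ∀ n j, ∫⁻ x, ‖G n j x‖ₑ ^ 2 ≤ M := fun n j => by
    rw [lintegral_sq_eq_ofReal_integral ((hs n).memLp_grad j)]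
    exact ENNReal.ofReal_le_ofReal (by linarith [(hbd n).1 j])
  have hgM : ∀ n, ∫⁻ x, ‖g n x‖ₑ ^ 2 ≤ M := fun n => by
    rw [lintegral_sq_eq_ofReal_integral (hs n).isLambda.inv.right]
    exact ENNReal.ofReal_le_ofReal (by linarith [(hbd n).2])
  -- The five components are the wave function, the field and the three partial derivatives; one
  -- subsequence has to serve them all.
  obtain ⟨φ, v, hφ, hv, hw⟩ := exists_subseq_tendsto_integral (ι := Unit ⊕ Unit ⊕ Fin 3)
    (u := fun n => Sum.elim (fun _ => ψ n) (Sum.elim (fun _ => g n) (G n)))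
    (fun n i => match i with
      | .inl _ => (hs n).memLp
      | .inr (.inl _) => (hs n).isLambda.inv.right
      | .inr (.inr j) => (hs n).memLp_grad j) ENNReal.ofReal_ne_top
    (fun n i => match i with
      | .inl _ => hψM n
      | .inr (.inl _) => hgM n
      | .inr (.inr j) => hGM n j)
  have hwG : ∀ j, WeakTendsto (fun n => G (φ n) j) (v (.inr (.inr j))) := fun j => hw (.inr (.inr j))
  have hwg : WeakTendsto (fun n => g (φ n)) (v (.inr (.inl ()))) := hw (.inr (.inl ()))
  have hst : IsState e Z σ (v (.inl ())) (fun j => v (.inr (.inr j))) (v (.inr (.inl ()))) :=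
    .of_weakTendsto he hσ1 hσ2 hσZ (fun n => hs (φ n)) ENNReal.ofReal_ne_top (fun n => hψM (φ n))
      (fun n => hGM (φ n)) (hv _) (fun _ => hv _) (hv _) (hw (.inl ())) hwG hwg
  refine ⟨_, _, _, hst, fun ψ' G' g' h' => ?_⟩
  refine le_trans ?_ (csInf_le hbdd ⟨ψ', G', g', h', rfl⟩)
  refine le_of_tendsto_of_tendsto' (tendsto_stateEnergy_lower a (fun _ => hv _) (hv _) hwG hwg)
    (hlim.comp hφ.tendsto_atTop) fun n => ?_
  simp only [Function.comp, ← hE (φ n), stateEnergy]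
  have h1 := two_mul_re_integral_sub_le (hs (φ n)).isLambda.inv.right (hv (.inr (.inl ())))
  have h2 := Finset.sum_le_sum fun j (_ : j ∈ Finset.univ) =>
    two_mul_re_integral_sub_le ((hs (φ n)).memLp_grad j) (hv (.inr (.inr j)))
  gcongr

/-- Minimality among states suffices, since members of the neutral manifold that carry no state have
infinite energy. -/
theorem energy_eq_iInf_of_minimal {ħ m : ℝ} (hm : 0 < m) {ψ g : CylCell → ℂ}
    {G : Fin 3 → CylCell → ℂ} (h : IsState e Z σ ψ G g)
    (hmin : ∀ ψ' G' g', IsState e Z σ ψ' G' g' →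
      stateEnergy (ħ ^ 2 / (2 * m)) G g ≤ stateEnergy (ħ ^ 2 / (2 * m)) G' g') :
    energy ħ m e σ ψ = ⨅ ψ ∈ neutralManifold Z, energy ħ m e σ ψ := by
  refine le_antisymm (le_iInf₂ fun ψ' hψ' => ?_) (iInf₂_le _ h.mem_neutralManifold)
  by_cases ht : energy ħ m e σ ψ' = ∞
  · rw [ht]; exact le_top
  obtain ⟨G', g', h'⟩ := exists_isState_of_energy_ne_top hψ' ht
  rw [h.energy_eq hm, h'.energy_eq hm]
  exact ENNReal.ofReal_le_ofReal (hmin _ _ _ h')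

end CylCell

end

/-! ### Admissible variations of a state -/

noncomputable section

open Filter Topology

namespace CylCell

theorem integral_norm_add_real_mul_sq {X : Type*} [MeasurableSpace X] {μ : Measure X} {f g : X → ℂ}
    (hf : MemLp f 2 μ) (hg : MemLp g 2 μ) (t : ℝ) : ∫ x, ‖f x + t * g x‖ ^ 2 ∂μ
      = ∫ x, ‖f x‖ ^ 2 ∂μ + t * (2 * (∫ x, f x * starRingEnd ℂ (g x) ∂μ).re)
        + t ^ 2 * ∫ x, ‖g x‖ ^ 2 ∂μ := by
  rw [integral_norm_add_sq hf (hg.const_mul _), integral_norm_const_mul_sq, Complex.norm_real,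
    Real.norm_eq_abs, sq_abs]
  have : ∫ x, f x * starRingEnd ℂ (t * g x) ∂μ = (t : ℂ) * ∫ x, f x * starRingEnd ℂ (g x) ∂μ := by
    rw [← integral_const_mul]
    exact integral_congr_ae (Eventually.of_forall fun x => by
      simp only [map_mul, Complex.conj_ofReal]; ring)
  rw [this, Complex.re_ofReal_mul]
  ring

theorem lowSq_of_slab {f : CylCell → ℂ} (hf : Integrable f) {R : ℝ}
    (hR : ∀ x, R < |x.2.2| → f x = 0) : LowSq f := by
  refine lowSq_of_moment hf ((hf.norm.const_mul R).mono' ?_ (Eventually.of_forall fun x => ?_))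
  · exact (by fun_prop : Continuous fun x : CylCell => |x.2.2|).aestronglyMeasurable.mul hf.norm.1
  · rw [Real.norm_of_nonneg (by positivity)]
    by_cases hx : R < |x.2.2|
    · simp [hR x hx]
    · exact mul_le_mul_of_nonneg_right (not_lt.1 hx) (norm_nonneg _)

theorem exists_isLambda_of_slab {f : CylCell → ℂ} (hf1 : Integrable f) (hf2 : MemLp f 2) {R : ℝ}
    (hR : ∀ x, R < |x.2.2| → f x = 0) (h0 : ∫ x, f x = 0) : ∃ g, IsLambda f g :=
  exists_isLambda hf1 hf2 (lowSq_of_slab hf1 hR) h0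

variable {e Z : ℝ} {σ : CylCell → ℝ} {ψ g : CylCell → ℂ} {G : Fin 3 → CylCell → ℂ}

/-- Write `|ψ|² = (σ - ρ)/e`: Condition II controls `σ`, and `ρ` lies in the domain of `Λ`. -/
theorem IsState.lowSq_norm_sq (h : IsState e Z σ ψ G g) (he : e ≠ 0) (hσ1 : MemLp σ 1)
    (hl : LowSq fun x => (σ x : ℂ)) : LowSq fun x => ((‖ψ x‖ ^ 2 : ℝ) : ℂ) := by
  have := (hl.sub h.isLambda.lowSq (integrable_ofReal hσ1) h.isLambda.integrable).const_mul (e : ℂ)⁻¹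
  have he' : (e : ℂ) ≠ 0 := by exact_mod_cast he
  convert this using 2 with x
  rw [ofReal_charge]
  field_simp
  ring

/-- The part of first order in `η` of the density of the renormalized `ψ + η`. -/
def variationOne (b : ℝ) (ψ η : CylCell → ℂ) (x : CylCell) : ℂ :=
  ((2 * (η x * starRingEnd ℂ (ψ x)).re : ℝ) : ℂ) - (b : ℂ) * ((‖ψ x‖ ^ 2 : ℝ) : ℂ)

/-- The part of second order in `η` of the density of the renormalized `ψ + η`. -/
def variationTwo (c : ℝ) (ψ η : CylCell → ℂ) (x : CylCell) : ℂ :=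
  ((‖η x‖ ^ 2 : ℝ) : ℂ) - (c : ℂ) * ((‖ψ x‖ ^ 2 : ℝ) : ℂ)

/-- The mass of `ψ + εη` is `N Z`, so division by `√N` restores it. As `1 - N = -εb - ε²c`, the new
electron density is `|ψ|² + (ε/N)(variationOne + ε variationTwo)`, and both variations are neutral.
The field changes linearly with the density. -/
theorem IsState.variation (h : IsState e Z σ ψ G g) {η : CylCell → ℂ} (hη : IsTest η) {b c : ℝ}
    (hb : 2 * (∫ x, ψ x * starRingEnd ℂ (η x)).re = b * Z) (hc : ∫ x, ‖η x‖ ^ 2 = c * Z)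
    {g₁ g₂ : CylCell → ℂ} (h₁ : IsLambda (variationOne b ψ η) g₁)
    (h₂ : IsLambda (variationTwo c ψ η) g₂) {ε N : ℝ} (hN : N = 1 + ε * b + ε ^ 2 * c)
    (hN0 : 0 < N) :
    IsState e Z σ (fun x => ((Real.sqrt N)⁻¹ : ℝ) * (ψ x + ε * η x))
      (fun j x => ((Real.sqrt N)⁻¹ : ℝ) * (G j x + ε * partialD j η x))
      (fun x => g x + ((-(e * ε / N) : ℝ) : ℂ) * (g₁ x + (ε : ℝ) * g₂ x)) := by
  have hs : (Real.sqrt N)⁻¹ ^ 2 = N⁻¹ := by rw [inv_pow, Real.sq_sqrt hN0.le]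
  have hn : ∀ w : ℂ, ‖(((Real.sqrt N)⁻¹ : ℝ) : ℂ) * w‖ ^ 2 = N⁻¹ * ‖w‖ ^ 2 := fun w => by
    rw [norm_mul, mul_pow, Complex.norm_real, Real.norm_eq_abs, sq_abs, hs]
  refine ⟨(h.memLp.add ((hη.memLp 2).const_mul _)).const_mul _,
    fun j => ((h.hasWeakPartial j).add ((hη.isSmooth.hasWeakPartial j).const_mul _)).const_mul _,
    fun j => ((h.memLp_grad j).add (((hη.partialD j).memLp 2).const_mul _)).const_mul _, ?_, ?_⟩
  · convert h.isLambda.add ((h₁.add (h₂.const_mul (ε : ℝ))).const_mul ((-(e * ε / N) : ℝ) : ℂ))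
      using 2 with x
    simp only [charge, variationOne, variationTwo, hn]
    have e1 : ‖ψ x + ε * η x‖ ^ 2 = ‖ψ x‖ ^ 2 + ε * (2 * (η x * starRingEnd ℂ (ψ x)).re)
        + ε ^ 2 * ‖η x‖ ^ 2 := by
      simp only [← Complex.normSq_eq_norm_sq, Complex.normSq_apply, Complex.add_re, Complex.add_im,
        Complex.mul_re, Complex.mul_im, Complex.conj_re, Complex.conj_im, Complex.ofReal_re,
        Complex.ofReal_im]
      ring
    rw [e1]
    norm_cast
    have hN0' := hN0.ne'
    field_simp
    rw [hN]
    ring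
  · simp only [hn]
    rw [integral_const_mul, integral_norm_add_real_mul_sq h.memLp (hη.memLp 2), h.mass, hb, hc]
    have hN0' := hN0.ne'
    field_simp
    rw [hN]
    ring

/-- The right side is a rational function of `ε`, defined near zero, which has a local minimum at
zero with value equal to the left side. The conclusion is the vanishing of its derivative. -/
theorem eq_zero_of_isMinOn_energy {a D K K₂ W R₁ R₂ S₀ S₁ S₂ b c e : ℝ}
    (H : ∀ ε N : ℝ, N = 1 + ε * b + ε ^ 2 * c → 0 < N →
      a * D + 1 / 2 * W ≤ a * (N⁻¹ * (D + ε * K + ε ^ 2 * K₂)) + 1 / 2 * (W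
        + (-(e * ε / N)) * (2 * (R₁ + ε * R₂)) + (-(e * ε / N)) ^ 2 * (S₀ + ε * S₁ + ε ^ 2 * S₂))) :
    a * (K - b * D) - e * R₁ = 0 := by
  have hquad : ∀ A B C : ℝ, HasDerivAt (fun ε : ℝ => A + ε * B + ε ^ 2 * C) B 0 := fun A B C => by
    have := (((hasDerivAt_id' (0 : ℝ)).mul_const B).const_add A).fun_add
      (((hasDerivAt_id' (0 : ℝ)).fun_pow 2).mul_const C)
    simpa using this
  have hN := hquad 1 b c
  have hD := hquad D K K₂
  have hS := hquad S₀ S₁ S₂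
  have hR : HasDerivAt (fun ε : ℝ => 2 * (R₁ + ε * R₂)) (2 * R₂) 0 := by
    have := (((hasDerivAt_id' (0 : ℝ)).mul_const R₂).const_add R₁).const_mul 2
    simpa using this
  have hN1 : (fun ε : ℝ => 1 + ε * b + ε ^ 2 * c) 0 ≠ 0 := by simp
  have hi := hN.fun_inv hN1
  have hs : HasDerivAt (fun ε : ℝ => -(e * ε / (1 + ε * b + ε ^ 2 * c))) (-e) 0 := by
    have := (((hasDerivAt_id' (0 : ℝ)).const_mul e).fun_div hN hN1).fun_neg
    simpa using this
  have hQ := ((hi.fun_mul hD).const_mul a).fun_add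
    (((((hs.fun_mul hR).const_add W).fun_add ((hs.fun_pow 2).fun_mul hS))).const_mul (1 / 2))
  have hmin := (show IsLocalMin _ (0 : ℝ) from by
    filter_upwards [hN.continuousAt.eventually_const_lt (u := 0) (by simp)] with ε hε
    exact le_of_eq_of_le (by simp) (H ε _ rfl hε)).hasDerivAt_eq_zero hQ
  simp at hmin
  linarith

end CylCell

end

/-! ### The Euler–Lagrange equation -/

noncomputable section

open Filter Topology

namespace CylCell

/-- The electrostatic potential of the state `ψ`. -/
def statePotential (e : ℝ) (σ : CylCell → ℝ) (ψ : CylCell → ℂ) : CylCell → ℂ :=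
  potential (fourierT fun x => (charge e σ ψ x : ℂ))

theorem fourierT_charge_neg (e : ℝ) (σ : CylCell → ℝ) (ψ : CylCell → ℂ) (p : Freq) :
    fourierT (fun x => (charge e σ ψ x : ℂ)) (-p)
      = starRingEnd ℂ (fourierT (fun x => (charge e σ ψ x : ℂ)) p) :=
  fourierT_neg (fun _ => Complex.conj_ofReal _) p

theorem ofReal_re_statePotential (e : ℝ) (σ : CylCell → ℝ) (ψ : CylCell → ℂ) (x : CylCell) :
    ((statePotential e σ ψ x).re : ℂ) = statePotential e σ ψ x :=
  Complex.conj_eq_iff_re.1 (star_potential (fourierT_charge_neg e σ ψ) x)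

variable {e Z : ℝ} {σ : CylCell → ℝ} {ψ g : CylCell → ℂ} {G : Fin 3 → CylCell → ℂ}

/-- A state of least energy, with `a = ħ² / (2m)`. -/
structure IsMinimalState (a e Z : ℝ) (σ : CylCell → ℝ) (ψ : CylCell → ℂ)
    (G : Fin 3 → CylCell → ℂ) (g : CylCell → ℂ) : Prop extends IsState e Z σ ψ G g where
  le : ∀ ψ' G' g', IsState e Z σ ψ' G' g' → stateEnergy a G g ≤ stateEnergy a G' g'

theorem IsState.memLp_fourierT_charge (h : IsState e Z σ ψ G g) :
    MemLp (fourierT fun x => (charge e σ ψ x : ℂ)) 2 freqMeasure :=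
  memLp_fourierT h.isLambda.integrable h.isLambda.memLp

theorem IsState.continuous_statePotential (h : IsState e Z σ ψ G g) :
    Continuous (statePotential e σ ψ) :=
  continuous_potential h.memLp_fourierT_charge h.isLambda.inv.left

/-- Densities `|ψ|² - c⁻¹ |η|²` of zero mean, with a test function `η`, lie in the domain of `Λ`. -/
theorem IsState.exists_isLambda_sub (h : IsState e Z σ ψ G g) (he : e ≠ 0) (hσ1 : MemLp σ 1)
    (hl : LowSq fun x => (σ x : ℂ)) {η : CylCell → ℂ} (hη : IsTest η) {c : ℝ}
    (hc : ∫ x, ‖η x‖ ^ 2 = c * Z) : ∃ g', IsLambda (variationTwo c ψ η) g' := by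
  have i1 := integrable_norm_sq_ofReal (hη.memLp 2)
  have i2 := (integrable_norm_sq_ofReal h.memLp).const_mul (c : ℂ)
  refine exists_isLambda (i1.sub i2)
    ((hη.norm_sq.memLp 2).sub (h.memH1.memLp_norm_sq_ofReal.const_mul _))
    (hη.norm_sq.lowSq.sub ((h.lowSq_norm_sq he hσ1 hl).const_mul _) i1 i2) ?_
  simp only [variationTwo]
  rw [integral_sub i1 i2, integral_const_mul, integral_complex_ofReal, integral_complex_ofReal,
    h.mass, hc]
  push_cast
  ring

theorem IsMinimalState.euler_lagrange {a : ℝ} (h : IsMinimalState a e Z σ ψ G g) (hZ : 0 < Z)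
    (he : e ≠ 0) (hσ1 : MemLp σ 1) (hl : LowSq fun x => (σ x : ℂ)) {η : CylCell → ℂ}
    (hη : IsTest η) {b : ℝ} (hb : 2 * (∫ x, ψ x * starRingEnd ℂ (η x)).re = b * Z)
    {g₁ : CylCell → ℂ} (h₁ : IsLambda (variationOne b ψ η) g₁) :
    a * ((∑ j, 2 * (∫ x, G j x * starRingEnd ℂ (partialD j η x)).re)
      - b * ∑ j, ∫ x, ‖G j x‖ ^ 2) - e * (∫ x, g x * starRingEnd ℂ (g₁ x)).re = 0 := by
  have hs := h.toIsState
  have hc : ∫ x, ‖η x‖ ^ 2 = ((∫ x, ‖η x‖ ^ 2) / Z) * Z := by field_simp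
  obtain ⟨g₂, h₂⟩ := hs.exists_isLambda_sub he hσ1 hl hη hc
  refine eq_zero_of_isMinOn_energy (c := (∫ x, ‖η x‖ ^ 2) / Z) (W := ∫ x, ‖g x‖ ^ 2)
    (K₂ := ∑ j, ∫ x, ‖partialD j η x‖ ^ 2) (R₂ := (∫ x, g x * starRingEnd ℂ (g₂ x)).re)
    (S₀ := ∫ x, ‖g₁ x‖ ^ 2) (S₁ := 2 * (∫ x, g₁ x * starRingEnd ℂ (g₂ x)).re)
    (S₂ := ∫ x, ‖g₂ x‖ ^ 2) fun ε N hN hN0 => ?_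
  have key := h.le _ _ _ (hs.variation hη hb hc h₁ h₂ hN hN0)
  have hg := hs.isLambda.inv.right
  have hg1 := h₁.inv.right
  have hg2 := h₂.inv.right
  unfold stateEnergy at key
  refine key.trans (le_of_eq ?_)
  congr 2
  · rw [Finset.mul_sum, Finset.mul_sum, ← Finset.sum_add_distrib, ← Finset.sum_add_distrib,
      Finset.mul_sum]
    refine Finset.sum_congr rfl fun j _ => ?_
    rw [integral_norm_const_mul_sq,
      integral_norm_add_real_mul_sq (hs.memLp_grad j) ((hη.partialD j).memLp 2), Complex.norm_real,
      Real.norm_eq_abs, sq_abs, inv_pow, Real.sq_sqrt hN0.le]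
  · have hg12 : MemLp (fun x => g₁ x + (ε : ℂ) * g₂ x) 2 := hg1.add (hg2.const_mul _)
    rw [integral_norm_add_real_mul_sq hg hg12,
      integral_norm_add_real_mul_sq hg1 hg2]
    congr 3
    have i1 := integrable_mul_star hg hg1
    have i2 := integrable_mul_star hg hg2
    have : ∫ x, g x * starRingEnd ℂ (g₁ x + (ε : ℂ) * g₂ x)
        = (∫ x, g x * starRingEnd ℂ (g₁ x)) + (ε : ℂ) * ∫ x, g x * starRingEnd ℂ (g₂ x) := by
      rw [← integral_const_mul, ← integral_add i1 (i2.const_mul _)]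
      exact integral_congr_ae (Eventually.of_forall fun x => by
        simp only [map_add, map_mul, Complex.conj_ofReal]; ring)
    rw [this, Complex.add_re, Complex.re_ofReal_mul]

/-- The first-order density contains `b|ψ|²`, whose support need not be bounded, so it cannot be
paired directly with the growing potential. It is traded for a reference density `|τ|²` of the same
mass: `variationOne = f + b(|τ|² - |ψ|²)` with `f` neutral and of bounded support. The remainder
enters only through the constant `Q`, multiplied by `b`. -/
theorem IsMinimalState.exists_re_weak_schrodinger {a : ℝ} (h : IsMinimalState a e Z σ ψ G g)
    (hZ : 0 < Z) (he : e ≠ 0) (hσ1 : MemLp σ 1) (hl : LowSq fun x => (σ x : ℂ)) :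
    ∃ lam : ℝ, ∀ η, IsTest η → a * (∑ j, (∫ x, G j x * starRingEnd ℂ (partialD j η x)).re)
      - e * (∫ x, statePotential e σ ψ x * ψ x * starRingEnd ℂ (η x)).re
      - lam * (∫ x, ψ x * starRingEnd ℂ (η x)).re = 0 := by
  have hs := h.toIsState
  have hφ := hs.continuous_statePotential
  obtain ⟨τ, hτ, hτZ⟩ := exists_isTest_integral_norm_sq hZ
  obtain ⟨γ, hγ⟩ := hs.exists_isLambda_sub he hσ1 hl hτ (c := 1) (by rw [hτZ, one_mul])
  set P := (∫ x, statePotential e σ ψ x * ((‖τ x‖ ^ 2 : ℝ) : ℂ)).re with hP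
  set Q := (∫ x, g x * starRingEnd ℂ (γ x)).re with hQ
  -- The multiplier collects all terms proportional to `b = 2 Re⟨ψ, η⟩ / Z` in the Euler–Lagrange
  -- identity, after division by two.
  refine ⟨(a * (∑ j, ∫ x, ‖G j x‖ ^ 2) - e * (P - Q)) / Z, fun η hη => ?_⟩
  set b := 2 * (∫ x, ψ x * starRingEnd ℂ (η x)).re / Z with hbdef
  have hb : 2 * (∫ x, ψ x * starRingEnd ℂ (η x)).re = b * Z := by rw [hbdef]; field_simp
  set f : CylCell → ℂ := fun x => ((2 * (η x * starRingEnd ℂ (ψ x)).re : ℝ) : ℂ)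
    - (b : ℂ) * ((‖τ x‖ ^ 2 : ℝ) : ℂ) with hf
  obtain ⟨B, hB⟩ := hη.exists_bound
  obtain ⟨R, -, hR⟩ := hη.exists_slab
  obtain ⟨R', -, hR'⟩ := hτ.exists_slab
  have i0 : Integrable fun x => η x * starRingEnd ℂ (ψ x) := integrable_mul_star (hη.memLp 2) hs.memLp
  have m0 : MemLp (fun x => η x * starRingEnd ℂ (ψ x)) 2 :=
    memLp_bdd_mul hη.continuous hB hs.memLp.star
  have i1 : Integrable fun x => ((2 * (η x * starRingEnd ℂ (ψ x)).re : ℝ) : ℂ) :=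
    (i0.re.const_mul 2).ofReal
  have m1 : MemLp (fun x => ((2 * (η x * starRingEnd ℂ (ψ x)).re : ℝ) : ℂ)) 2 :=
    (m0.re.const_mul 2).ofReal
  have i2 := hτ.norm_sq.integrable.const_mul (b : ℂ)
  have hfR : ∀ x, max R R' < |x.2.2| → f x = 0 := fun x hx => by
    simp [hf, hR x ((le_max_left _ _).trans_lt hx), hR' x ((le_max_right _ _).trans_lt hx)]
  have hre : ∫ x, (η x * starRingEnd ℂ (ψ x)).re = (∫ x, ψ x * starRingEnd ℂ (η x)).re := by
    rw [integral_mul_star_comm ψ η, Complex.conj_re]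
    exact integral_re i0
  obtain ⟨g₁, hg₁⟩ := exists_isLambda_of_slab (f := f) (i1.sub i2)
    (m1.sub ((hτ.norm_sq.memLp 2).const_mul _)) hfR (by
      simp only [hf]
      rw [integral_sub i1 i2, integral_const_mul, integral_complex_ofReal, integral_complex_ofReal,
        hτZ, integral_const_mul, hre, hb]
      push_cast
      ring)
  have h₁ : IsLambda (variationOne b ψ η) fun x => g₁ x + (b : ℂ) * γ x := by
    convert hg₁.add (hγ.const_mul (b : ℂ)) using 2 with x
    simp only [hf, variationOne, variationTwo]
    push_cast
    ring
  have key := h.euler_lagrange hZ he hσ1 hl hη hb h₁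
  have hg := hs.isLambda.inv.right
  have e1 : ∫ x, g x * starRingEnd ℂ (g₁ x + (b : ℂ) * γ x)
      = (∫ x, g x * starRingEnd ℂ (g₁ x)) + (b : ℂ) * ∫ x, g x * starRingEnd ℂ (γ x) := by
    rw [← integral_const_mul, ← integral_add (integrable_mul_star hg hg₁.inv.right)
      ((integrable_mul_star hg hγ.inv.right).const_mul _)]
    exact integral_congr_ae (Eventually.of_forall fun x => by
      simp only [map_add, map_mul, Complex.conj_ofReal]; ring)
  have e2 := hs.isLambda.integral_potential_mul_star hg₁ hfR
  have j0 : Integrable fun x => statePotential e σ ψ x * ψ x * starRingEnd ℂ (η x) :=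
    integrable_mul_test (locallyIntegrable_mul_continuous hφ
      (locallyIntegrable_of_memLp_two hs.memLp)) hη.star
  have j2 : Integrable fun x => statePotential e σ ψ x * ((‖τ x‖ ^ 2 : ℝ) : ℂ) :=
    integrable_mul_test hφ.locallyIntegrable hτ.norm_sq
  have e3 : (∫ x, statePotential e σ ψ x * starRingEnd ℂ (f x)).re
      = 2 * (∫ x, statePotential e σ ψ x * ψ x * starRingEnd ℂ (η x)).re - b * P := by
    have r0 : (∫ x, statePotential e σ ψ x * ψ x * starRingEnd ℂ (η x)).re
        = ∫ x, (statePotential e σ ψ x * ψ x * starRingEnd ℂ (η x)).re := (integral_re j0).symm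
    have r2 : P = ∫ x, (statePotential e σ ψ x * ((‖τ x‖ ^ 2 : ℝ) : ℂ)).re := (integral_re j2).symm
    have j0' : Integrable fun x => (statePotential e σ ψ x * ψ x * starRingEnd ℂ (η x)).re := j0.re
    have j2' : Integrable fun x => (statePotential e σ ψ x * ((‖τ x‖ ^ 2 : ℝ) : ℂ)).re := j2.re
    rw [r0, r2, ← integral_const_mul, ← integral_const_mul,
      ← integral_sub (j0'.const_mul 2) (j2'.const_mul b)]
    rw [← Complex.ofReal_re (∫ x, _), ← integral_complex_ofReal]
    congr 1
    refine integral_congr_ae (Eventually.of_forall fun x => ?_)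
    have hx := ofReal_re_statePotential e σ ψ x
    simp only [hf]
    rw [← hx, map_sub, map_mul, Complex.conj_ofReal, Complex.conj_ofReal, Complex.conj_ofReal,
      mul_assoc, Complex.re_ofReal_mul, Complex.re_ofReal_mul, Complex.ofReal_re]
    have : (ψ x * starRingEnd ℂ (η x)).re = (η x * starRingEnd ℂ (ψ x)).re := by
      simp only [Complex.mul_re, Complex.conj_re, Complex.conj_im]
      ring
    rw [this]
    push_cast
    ring
  rw [e1, Complex.add_re, Complex.re_ofReal_mul, ← e2] at key
  change _ - e * ((∫ x, statePotential e σ ψ x * starRingEnd ℂ (f x)).re + b * Q) = 0 at key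
  rw [e3, ← Finset.mul_sum] at key
  rw [hbdef] at key
  field_simp at key ⊢
  linear_combination key / 2

end CylCell

end

/-! ### Local `H²` regularity -/

noncomputable section

open Filter Topology

namespace CylCell

theorem MemL2loc.add {f f' : CylCell → ℂ} (h : MemL2loc f) (h' : MemL2loc f') :
    MemL2loc fun x => f x + f' x := fun K hK => (h K hK).add (h' K hK)

theorem MemLp.memL2loc_continuous_mul {a f : CylCell → ℂ} (ha : Continuous a) (hf : MemLp f 2) :
    MemL2loc fun x => a x * f x := fun K hK => by
  obtain ⟨C, hC⟩ := hK.exists_bound_of_continuousOn ha.continuousOn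
  refine ((hf.restrict K).norm.const_mul C).mono (ha.aestronglyMeasurable.mul hf.1.restrict)
    ((ae_restrict_iff' hK.measurableSet).2 (Eventually.of_forall fun x hx => ?_))
  rw [norm_mul, norm_mul, norm_norm]
  exact mul_le_mul_of_nonneg_right ((hC x hx).trans (le_abs_self C)) (norm_nonneg _)

/-- A smooth multiple of a function in `H²` lies in `H²_loc`. -/
theorem memH2loc_smooth_mul {a f : CylCell → ℂ} (ha : IsSmooth a) (hf : MemLp f 2)
    {K : Fin 3 → CylCell → ℂ} {H : Fin 3 → Fin 3 → CylCell → ℂ} (hK : ∀ j, HasWeakPartial j f (K j))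
    (hK2 : ∀ j, MemLp (K j) 2) (hH : ∀ i j, HasWeakPartial i (K j) (H i j))
    (hH2 : ∀ i j, MemLp (H i j) 2) : MemH2loc fun x => a x * f x := by
  refine ⟨MemLp.memL2loc_continuous_mul ha.continuous hf, fun j => ⟨_, (hK j).smooth_mul ha,
    (MemLp.memL2loc_continuous_mul ha.continuous (hK2 j)).add
      (MemLp.memL2loc_continuous_mul (ha.partialD j).continuous hf), fun i => ⟨_,
    ((hH i j).smooth_mul ha).add ((hK i).smooth_mul (ha.partialD j)), ?_⟩⟩⟩
  exact ((MemLp.memL2loc_continuous_mul ha.continuous (hH2 i j)).add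
    (MemLp.memL2loc_continuous_mul (ha.partialD i).continuous (hK2 j))).add
    ((MemLp.memL2loc_continuous_mul (ha.partialD j).continuous (hK2 i)).add
    (MemLp.memL2loc_continuous_mul ((ha.partialD j).partialD i).continuous hf))

/-- Elliptic regularity in `L²`. -/
theorem exists_hasWeakPartial_of_hasWeakLaplacian {f L : CylCell → ℂ} {K : Fin 3 → CylCell → ℂ}
    (hf : MemLp f 2) (hK : ∀ j, HasWeakPartial j f (K j)) (hK2 : ∀ j, MemLp (K j) 2)
    (hL : HasWeakLaplacian f L) (hL2 : MemLp L 2) (i j : Fin 3) :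
    ∃ h, HasWeakPartial i (K j) h ∧ MemLp h 2 := by
  obtain ⟨q, hq⟩ := exists_isInvFourier hf
  have hΔ := (hL.isInvFourier hL2 hq).left
  have hKj := (hK j).isInvFourier (hK2 j) hq
  have hv := measurable_freqVec i
  -- Every second derivative is dominated by the Laplacian, since `|p_i p_j| ≤ |p|²`.
  have hm : MemLp (fun p => -(Complex.I * freqVec p i) * (-(Complex.I * freqVec p j) * q p)) 2
      freqMeasure := by
    refine hΔ.mono ((by fun_prop : Measurable fun p : Freq =>
      -(Complex.I * (freqVec p i : ℂ))).aestronglyMeasurable.mul hKj.left.1)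
      (Eventually.of_forall fun p => ?_)
    refine (norm_freqVec_mul_le p i _).trans ?_
    rw [norm_mul (-((freqNorm p ^ 2 : ℝ) : ℂ)), norm_neg, Complex.norm_real, Real.norm_of_nonneg (by positivity), sq,
      mul_assoc]
    exact mul_le_mul_of_nonneg_left (norm_freqVec_mul_le p j _) (freqNorm_nonneg p)
  obtain ⟨h, hh⟩ := exists_isInvFourier_of_freq hm
  exact ⟨h, hKj.hasWeakPartial hh, hh.right⟩

theorem integrable_smooth_mul_test {a f τ : CylCell → ℂ} (ha : Continuous a)
    (hf : LocallyIntegrable f) (hτ : IsTest τ) : Integrable fun x => a x * f x * τ x :=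
  integrable_mul_test (locallyIntegrable_mul_continuous ha hf) hτ

/-- Leibniz for the Laplacian. The term `∂_j a ∂_j f` occurs twice instead of with a factor 2,
because the second copy comes grouped with `∂_j² a f` as the weak derivative of `∂_j a f`. -/
theorem HasWeakLaplacian.smooth_mul {a f L : CylCell → ℂ} {G : Fin 3 → CylCell → ℂ}
    (ha : IsSmooth a) (h : HasWeakLaplacian f L) (hG : ∀ j, HasWeakPartial j f (G j)) :
    HasWeakLaplacian (fun x => a x * f x) fun x => a x * L x +
      ∑ j, (partialD j a x * G j x + (partialD j a x * G j x + partialD j (partialD j a) x * f x)) := by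
  have hD : ∀ j, HasWeakPartial j (fun x => partialD j a x * f x) _ := fun j =>
    (hG j).smooth_mul (ha.partialD j)
  have lG : ∀ j, LocallyIntegrable fun x => partialD j a x * G j x := fun j =>
    locallyIntegrable_mul_continuous (ha.partialD j).continuous (hG j).right
  have lL := locallyIntegrable_mul_continuous ha.continuous h.right
  have hfun : ∀ j, LocallyIntegrable fun x => partialD j a x * G j x + (partialD j a x * G j x
      + partialD j (partialD j a) x * f x) := fun j => (lG j).add (hD j).right
  have hsum : LocallyIntegrable fun x => ∑ j, (partialD j a x * G j x + (partialD j a x * G j x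
      + partialD j (partialD j a) x * f x)) := by
    have := locallyIntegrable_finsetSum Finset.univ fun j _ => hfun j
    simpa using this
  refine ⟨locallyIntegrable_mul_continuous ha.continuous h.left, lL.add hsum, fun τ hτ => ?_⟩
  have hat : IsTest fun x => a x * τ x := hτ.smooth_mul ha
  have h0 := h.eq _ hat
  have s1 : ∀ x, (a x * L x + ∑ j, (partialD j a x * G j x + (partialD j a x * G j x
      + partialD j (partialD j a) x * f x))) * τ x = a x * L x * τ x + ∑ j, (partialD j a x * G j x
      + (partialD j a x * G j x + partialD j (partialD j a) x * f x)) * τ x := fun x => by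
    rw [add_mul, Finset.sum_mul]
  have ij : ∀ j, Integrable fun x => (partialD j a x * G j x
      + (partialD j a x * G j x + partialD j (partialD j a) x * f x)) * τ x := fun j =>
    integrable_mul_test (hfun j) hτ
  simp only [s1]
  rw [integral_add (integrable_mul_test lL hτ) (integrable_finsetSum _ fun j _ => ij j),
    integral_finsetSum _ fun j _ => ij j]
  have e1 : ∫ x, a x * L x * τ x = ∫ x, L x * (a x * τ x) :=
    integral_congr_ae (Eventually.of_forall fun x => by ring)
  rw [e1, ← h0]
  have s2 : ∀ (b : CylCell → ℂ) (x : CylCell) (u : CylCell → ℂ),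
      b x * (∑ j, partialD j (partialD j u) x) = ∑ j, b x * partialD j (partialD j u) x :=
    fun b x u => Finset.mul_sum _ _ _
  simp only [s2 fun x => a x * f x, s2 f]
  rw [integral_finsetSum _ fun j _ => integrable_smooth_mul_test ha.continuous h.left
      ((hτ.partialD j).partialD j),
    integral_finsetSum _ fun j _ => integrable_mul_test h.left ((hat.partialD j).partialD j),
    ← Finset.sum_add_distrib]
  refine Finset.sum_congr rfl fun j _ => ?_
  have k1 := (hG j).eq _ (hat.partialD j)
  have k2 := ((hG j).smooth_mul ha).eq _ (hτ.partialD j)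
  have k3 := (hD j).eq _ hτ
  have hpat : ∀ x, partialD j (fun x => a x * τ x) x = partialD j a x * τ x + a x * partialD j τ x :=
    ha.partialD_mul hτ.isSmooth j
  rw [k2, k1]
  simp only [hpat]
  have i1 := integrable_smooth_mul_test ha.continuous (hG j).right (hτ.partialD j)
  have i2 := integrable_smooth_mul_test (ha.partialD j).continuous h.left (hτ.partialD j)
  have i3 := integrable_smooth_mul_test (ha.partialD j).continuous (hG j).right hτ
  have i4 := integrable_mul_test (hD j).right hτ
  have e2 : ∫ x, (a x * G j x + partialD j a x * f x) * partialD j τ x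
      = (∫ x, a x * G j x * partialD j τ x) + ∫ x, partialD j a x * f x * partialD j τ x := by
    rw [← integral_add i1 i2]
    exact integral_congr_ae (Eventually.of_forall fun x => by ring)
  have e3 : ∫ x, G j x * (partialD j a x * τ x + a x * partialD j τ x)
      = (∫ x, partialD j a x * G j x * τ x) + ∫ x, a x * G j x * partialD j τ x := by
    rw [← integral_add i3 i1]
    exact integral_congr_ae (Eventually.of_forall fun x => by ring)
  have e4 : ∫ x, (partialD j a x * G j x + (partialD j a x * G j x
      + partialD j (partialD j a) x * f x)) * τ x = (∫ x, partialD j a x * G j x * τ x)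
      + ∫ x, (partialD j a x * G j x + partialD j (partialD j a) x * f x) * τ x := by
    rw [← integral_add i3 i4]
    exact integral_congr_ae (Eventually.of_forall fun x => by ring)
  rw [e2, e3, e4, k3]
  ring

/-- With `v = (1 + s²)⁻¹` the second derivative is `-2v² + 8s²v³`, and `v` and `s²v` are at most
one; hence `2 + 8`. -/
theorem norm_partialD_partialD_weight_le (i j : Fin 3) (x : CylCell) :
    ‖partialD i (partialD j weight) x‖ ≤ 10 := by
  have e : partialD j weight = fun x : CylCell =>
      (fun s : ℝ => if j = 2 then ((-(2 * s) * ((1 + s ^ 2)⁻¹) ^ 2 : ℝ) : ℂ) else 0) x.2.2 :=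
    funext fun x => partialD_weight j x
  rw [e, partialD_comp_height (fun s : ℝ =>
    if j = 2 then ((-(2 * s) * ((1 + s ^ 2)⁻¹) ^ 2 : ℝ) : ℂ) else 0)]
  split_ifs with hi hj
  · set s := x.2.2
    have hpos : 0 < 1 + s ^ 2 := by positivity
    have h1 : HasDerivAt (fun s : ℝ => -(2 * s) * ((1 + s ^ 2)⁻¹) ^ 2)
        (-2 * ((1 + s ^ 2)⁻¹) ^ 2 + 8 * s ^ 2 * ((1 + s ^ 2)⁻¹) ^ 3) s := by
      have := (((hasDerivAt_id' s).const_mul 2).fun_neg).fun_mul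
        (((((hasDerivAt_id' s).fun_pow 2).const_add 1).fun_inv hpos.ne').fun_pow 2)
      refine this.congr_deriv ?_
      push_cast
      field_simp
      ring
    rw [h1.ofReal_comp.deriv, Complex.norm_real, Real.norm_eq_abs]
    set v := (1 + s ^ 2)⁻¹ with hv
    have hv0 : 0 ≤ v := by positivity
    have hv1 : v ≤ 1 := inv_le_one_of_one_le₀ (by nlinarith)
    have hsv : s ^ 2 * v ≤ 1 := by
      rw [hv, ← div_eq_mul_inv, div_le_one hpos]; linarith
    have hsv0 : 0 ≤ s ^ 2 * v := by positivity
    have hv2 : v ^ 2 ≤ 1 := pow_le_one₀ hv0 hv1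
    have e3 : 8 * s ^ 2 * v ^ 3 = 8 * ((s ^ 2 * v) * v ^ 2) := by ring
    have h4 : (s ^ 2 * v) * v ^ 2 ≤ 1 := mul_le_one₀ hsv (by positivity) hv2
    have h5 : 0 ≤ (s ^ 2 * v) * v ^ 2 := by positivity
    rw [e3, abs_le]
    have : 0 ≤ v ^ 2 := by positivity
    constructor <;> linarith
  · simp
  · simp

/-- If `Δ f = L` and `f`, `∇ f`, `(1 + x₃²)⁻¹ L` are square integrable, then `f` lies in `H²_loc`. -/
theorem memH2loc_of_hasWeakLaplacian {f L : CylCell → ℂ} {G : Fin 3 → CylCell → ℂ}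
    (hf : MemLp f 2) (hG : ∀ j, HasWeakPartial j f (G j)) (hG2 : ∀ j, MemLp (G j) 2)
    (hL : HasWeakLaplacian f L) (hL2 : MemLp (fun x => weight x * L x) 2) : MemH2loc f := by
  have hw := isSmooth_weight
  have hd : ∀ j (u : CylCell → ℂ), MemLp u 2 → MemLp (fun x => partialD j weight x * u x) 2 :=
    fun j u hu => memLp_bdd_mul (hw.partialD j).continuous (norm_partialD_weight_le_one j) hu
  have hK := fun j => (hG j).smooth_mul hw
  have hK2 : ∀ j, MemLp (fun x => weight x * G j x + partialD j weight x * f x) 2 :=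
    fun j => (memLp_weight_mul (hG2 j)).add (hd j f hf)
  -- The weighted function has square integrable Laplacian: the commutator terms are `f` and `∇f`
  -- times bounded derivatives of the weight. Global `H²` regularity thus holds for the weighted
  -- function, and multiplication by the smooth function `1 + x₃²` returns `f`.
  have hΔ := hL.smooth_mul hw hG
  have hΔ2 : MemLp (fun x => weight x * L x + ∑ j, (partialD j weight x * G j x
      + (partialD j weight x * G j x + partialD j (partialD j weight) x * f x))) 2 := by
    refine hL2.add (memLp_finsetSum _ fun j _ => (hd j _ (hG2 j)).add ((hd j _ (hG2 j)).add ?_))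
    exact memLp_bdd_mul ((hw.partialD j).partialD j).continuous
      (norm_partialD_partialD_weight_le j j) hf
  choose H hH hH2 using exists_hasWeakPartial_of_hasWeakLaplacian (memLp_weight_mul hf) hK hK2 hΔ hΔ2
  have hv : IsSmooth fun x : CylCell => ((1 + x.2.2 ^ 2 : ℝ) : ℂ) :=
    IsSmooth.comp_height (χ := fun s : ℝ => ((1 + s ^ 2 : ℝ) : ℂ))
      (Complex.ofRealCLM.contDiff.comp (contDiff_const.add (contDiff_id.pow 2)))
  convert memH2loc_smooth_mul hv (memLp_weight_mul hf) hK hK2 hH hH2 using 2 with x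
  have : (1 + x.2.2 ^ 2 : ℝ) ≠ 0 := by positivity
  rw [← mul_assoc, weight, ← Complex.ofReal_mul, mul_inv_cancel₀ this, Complex.ofReal_one, one_mul]

end CylCell

end

/-! ### The Schrödinger equation -/

noncomputable section

open Filter Topology

namespace CylCell

variable {e Z : ℝ} {σ : CylCell → ℝ} {ψ g : CylCell → ℂ} {G : Fin 3 → CylCell → ℂ}

theorem integral_mul_star_I_mul (f η : CylCell → ℂ) :
    ∫ x, f x * starRingEnd ℂ (Complex.I * η x) = -Complex.I * ∫ x, f x * starRingEnd ℂ (η x) := by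
  rw [← integral_const_mul]
  refine integral_congr_ae (Eventually.of_forall fun x => ?_)
  simp only [map_mul, Complex.conj_I]
  ring

/-- The real identity for `η` and for `iη` yields the real and imaginary parts of the complex one,
all terms being antilinear in `η`. -/
theorem IsMinimalState.exists_weak_schrodinger {a : ℝ} (h : IsMinimalState a e Z σ ψ G g)
    (hZ : 0 < Z) (he : e ≠ 0) (hσ1 : MemLp σ 1) (hl : LowSq fun x => (σ x : ℂ)) :
    ∃ lam : ℝ, ∀ η, IsTest η → a * (∑ j, ∫ x, G j x * starRingEnd ℂ (partialD j η x))
      - e * (∫ x, statePotential e σ ψ x * ψ x * starRingEnd ℂ (η x))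
      - lam * (∫ x, ψ x * starRingEnd ℂ (η x)) = 0 := by
  obtain ⟨lam, H⟩ := h.exists_re_weak_schrodinger hZ he hσ1 hl
  refine ⟨lam, fun η hη => ?_⟩
  have h1 := H η hη
  have h2 := H _ (hη.const_mul Complex.I)
  simp only [partialD_const_mul, integral_mul_star_I_mul] at h2
  apply Complex.ext
  · simp only [Complex.sub_re, Complex.re_ofReal_mul, Complex.re_sum, Complex.zero_re]
    exact h1
  · simp only [neg_mul, Complex.neg_re, Complex.I_mul_re, neg_neg] at h2
    simp only [Complex.sub_im, Complex.im_ofReal_mul, Complex.im_sum, Complex.zero_im]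
    exact h2

theorem IsMinimalState.exists_hasWeakLaplacian {a : ℝ} (h : IsMinimalState a e Z σ ψ G g)
    (ha : a ≠ 0) (hZ : 0 < Z) (he : e ≠ 0) (hσ1 : MemLp σ 1) (hl : LowSq fun x => (σ x : ℂ)) :
    ∃ lam : ℝ, HasWeakLaplacian ψ fun x =>
      -(a : ℂ)⁻¹ * ((lam : ℂ) * ψ x + (e : ℂ) * (statePotential e σ ψ x * ψ x)) := by
  have hs := h.toIsState
  have hψ := locallyIntegrable_of_memLp_two hs.memLp
  have hφψ : LocallyIntegrable fun x => statePotential e σ ψ x * ψ x :=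
    locallyIntegrable_mul_continuous hs.continuous_statePotential hψ
  obtain ⟨lam, H⟩ := h.exists_weak_schrodinger hZ he hσ1 hl
  have h1 : LocallyIntegrable fun x => (lam : ℂ) * ψ x :=
    locallyIntegrable_mul_continuous continuous_const hψ
  have h2 : LocallyIntegrable fun x => (e : ℂ) * (statePotential e σ ψ x * ψ x) :=
    locallyIntegrable_mul_continuous continuous_const hφψ
  refine ⟨lam, hψ, locallyIntegrable_mul_continuous continuous_const (h1.add h2), fun τ hτ => ?_⟩
  have key := H _ hτ.star
  have e0 : ∀ j x, starRingEnd ℂ (partialD j (fun x => starRingEnd ℂ (τ x)) x) = partialD j τ x :=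
    fun j x => by rw [hτ.isSmooth.partialD_star, Complex.conj_conj]
  simp only [e0, Complex.conj_conj] at key
  have e1 : ∫ x, ψ x * ∑ j, partialD j (partialD j τ) x = -∑ j, ∫ x, G j x * partialD j τ x := by
    simp only [Finset.mul_sum]
    rw [integral_finsetSum _ fun j _ => integrable_mul_test hψ ((hτ.partialD j).partialD j),
      ← Finset.sum_neg_distrib]
    exact Finset.sum_congr rfl fun j _ => (hs.hasWeakPartial j).eq _ (hτ.partialD j)
  have e2 : ∫ x, -(a : ℂ)⁻¹ * ((lam : ℂ) * ψ x + (e : ℂ) * (statePotential e σ ψ x * ψ x)) * τ x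
      = -(a : ℂ)⁻¹ * ((lam : ℂ) * (∫ x, ψ x * τ x)
        + (e : ℂ) * ∫ x, statePotential e σ ψ x * ψ x * τ x) := by
    rw [← integral_const_mul, ← integral_const_mul, ← integral_add
      ((integrable_mul_test hψ hτ).const_mul _) ((integrable_mul_test hφψ hτ).const_mul _),
      ← integral_const_mul]
    exact integral_congr_ae (Eventually.of_forall fun x => by ring)
  have ha' : (a : ℂ) ≠ 0 := by exact_mod_cast ha
  rw [e1, e2]
  field_simp
  linear_combination -key

theorem IsState.exists_norm_weight_mul_statePotential_le (h : IsState e Z σ ψ G g) :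
    ∃ C, ∀ x, ‖weight x * statePotential e σ ψ x‖ ≤ C := by
  obtain ⟨C, hC⟩ := exists_norm_potential_le h.memLp_fourierT_charge h.isLambda.inv.left
  have hC0 : 0 ≤ C := by
    have := (norm_nonneg _).trans (hC 0)
    simpa using this
  refine ⟨C * 2, fun x => ?_⟩
  have h1 : (1 + |x.2.2|) ^ (1 / 2 : ℝ) ≤ 1 + |x.2.2| := by
    have h0 : 1 ≤ 1 + |x.2.2| := by linarith [abs_nonneg x.2.2]
    exact (Real.rpow_le_rpow_of_exponent_le h0 (by norm_num)).trans_eq (Real.rpow_one _)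
  have hw : ‖weight x‖ = (1 + x.2.2 ^ 2)⁻¹ := by
    rw [weight, Complex.norm_real, Real.norm_of_nonneg (by positivity)]
  rw [norm_mul, hw, inv_mul_le_iff₀ (by positivity)]
  refine (hC x).trans ?_
  have h2 : 1 + |x.2.2| ≤ 2 * (1 + x.2.2 ^ 2) := by
    rw [← sq_abs]
    nlinarith [sq_nonneg (|x.2.2| - 1)]
  calc C * (1 + |x.2.2|) ^ (1 / 2 : ℝ) ≤ C * (2 * (1 + x.2.2 ^ 2)) := by
        gcongr
        exact h1.trans h2
    _ = _ := by ring

/-- The potential grows slower than the weight decays, so the weight times `φψ` is in `L²` even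
though `φψ` itself need not be. -/
theorem IsState.memH2loc (h : IsState e Z σ ψ G g) {a lam : ℝ}
    (hL : HasWeakLaplacian ψ fun x =>
      -(a : ℂ)⁻¹ * ((lam : ℂ) * ψ x + (e : ℂ) * (statePotential e σ ψ x * ψ x))) : MemH2loc ψ := by
  obtain ⟨C, hC⟩ := h.exists_norm_weight_mul_statePotential_le
  refine memH2loc_of_hasWeakLaplacian h.memLp h.hasWeakPartial h.memLp_grad hL ?_
  have h1 := (memLp_weight_mul h.memLp).const_mul (lam : ℂ)
  have h2 := (memLp_bdd_mul (isSmooth_weight.continuous.mul h.continuous_statePotential) hC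
    h.memLp).const_mul (e : ℂ)
  refine ((h1.add h2).const_mul (-(a : ℂ)⁻¹)).ae_eq (Eventually.of_forall fun x => ?_)
  simp only [Pi.add_apply, Pi.mul_apply]
  ring

end CylCell

end

/-! ### Translations of the electron density and Newton's equation -/

noncomputable section

open Filter Topology

namespace CylCell

/-- The translation vector `t e_j`. -/
def shift (j : Fin 3) (t : ℝ) : CylCell := proj (Pi.single j t)

theorem measurePreserving_add_right_cell (v : CylCell) :
    MeasurePreserving (fun x : CylCell => x + v) volume volume := measurePreserving_add_right volume v

theorem wave_add_shift (p : Freq) (x : CylCell) (j : Fin 3) (t : ℝ) :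
    wave p (x + shift j t) = Complex.exp (Complex.I * ((freqVec p j * t : ℝ) : ℂ)) * wave p x := by
  rw [shift, wave_add]
  simp [Pi.single_apply]

theorem fourierT_shift (f : CylCell → ℂ) (j : Fin 3) (t : ℝ) (p : Freq) :
    fourierT (fun x => f (x + shift j t)) p
      = Complex.exp (-(Complex.I * ((freqVec p j * t : ℝ) : ℂ))) * fourierT f p := by
  have h : fourierT f p = Complex.exp (Complex.I * ((freqVec p j * t : ℝ) : ℂ)) *
      fourierT (fun x => f (x + shift j t)) p := by
    rw [fourierT_eq, fourierT_eq, ← integral_const_mul,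
      ← integral_add_right_eq_self (fun x => wave p x * f x) (shift j t)]
    simp only [wave_add_shift, mul_assoc]
  rw [h, ← mul_assoc, ← Complex.exp_add, neg_add_cancel, Complex.exp_zero, one_mul]

theorem IsSmooth.comp_add_right {a : CylCell → ℂ} (ha : IsSmooth a) (v : CylCell) :
    IsSmooth fun x => a (x + v) := by
  obtain ⟨y, rfl⟩ := proj_surjective v
  unfold IsSmooth at ha ⊢
  simp only [← proj_add]
  exact ha.comp (contDiff_id.add contDiff_const)

theorem IsTest.comp_add_right {τ : CylCell → ℂ} (hτ : IsTest τ) (v : CylCell) :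
    IsTest fun x => τ (x + v) :=
  ⟨hτ.isSmooth.comp_add_right v, hτ.compact.comp_homeomorph (Homeomorph.addRight v)⟩

theorem partialD_comp_add_right (j : Fin 3) (f : CylCell → ℂ) (v x : CylCell) :
    partialD j (fun x => f (x + v)) x = partialD j f (x + v) := by
  simp only [partialD, add_right_comm _ _ v]

theorem MemLp.comp_add_right {f : CylCell → ℂ} {p : ℝ≥0∞} (hf : MemLp f p) (v : CylCell) :
    MemLp (fun x => f (x + v)) p := hf.comp_measurePreserving (measurePreserving_add_right_cell v)

theorem HasWeakPartial.comp_add_right {j : Fin 3} {f g : CylCell → ℂ} (h : HasWeakPartial j f g)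
    (hf : MemLp f 2) (hg : MemLp g 2) (v : CylCell) :
    HasWeakPartial j (fun x => f (x + v)) fun x => g (x + v) := by
  refine ⟨locallyIntegrable_of_memLp_two (MemLp.comp_add_right hf v),
    locallyIntegrable_of_memLp_two (MemLp.comp_add_right hg v), fun τ hτ => ?_⟩
  have key := h.eq _ (hτ.comp_add_right (-v))
  simp only [partialD_comp_add_right] at key
  rw [← integral_add_right_eq_self _ v, ← integral_add_right_eq_self (fun x => g x * _) v] at key
  simpa only [add_neg_cancel_right] using key

theorem norm_exp_neg_I_sub_one_le (s : ℝ) : ‖Complex.exp (-(Complex.I * (s : ℂ))) - 1‖ ≤ |s| := by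
  have := Real.norm_exp_I_mul_ofReal_sub_one_le (x := -s)
  simpa using this

theorem fourierT_shift_sub {n : CylCell → ℂ} (hn : Integrable n) (j : Fin 3) (t : ℝ) (p : Freq) :
    fourierT (fun x => n (x + shift j t) - n x) p
      = (Complex.exp (-(Complex.I * ((freqVec p j * t : ℝ) : ℂ))) - 1) * fourierT n p := by
  rw [fourierT_sub (hn.comp_add_right _) hn, fourierT_shift]
  ring

/-- Since `|e^{-ip_j t} - 1| ≤ |p||t|`, the singularity `1/|p|` is absorbed. A difference of
translates always lies in the domain of `Λ`, with field of size `O(t)` in `L²`. -/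
theorem norm_fourierT_shift_sub_div_le {n : CylCell → ℂ} (hn : Integrable n) (j : Fin 3) (t : ℝ)
    (p : Freq) : ‖fourierT (fun x => n (x + shift j t) - n x) p / (freqNorm p : ℂ)‖
      ≤ |t| * ‖fourierT n p‖ := by
  rw [norm_div, fourierT_shift_sub hn, Complex.norm_real, Real.norm_of_nonneg (freqNorm_nonneg p),
    norm_mul]
  refine div_le_of_le_mul₀ (freqNorm_nonneg p) (by positivity) ?_
  have h1 := norm_exp_neg_I_sub_one_le (freqVec p j * t)
  rw [abs_mul] at h1
  have h2 := mul_le_mul_of_nonneg_right (abs_freqVec_le p j) (abs_nonneg t)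
  calc _ ≤ (freqNorm p * |t|) * ‖fourierT n p‖ := by gcongr; exact h1.trans h2
    _ = _ := by ring

theorem exists_isLambda_shift_sub {n : CylCell → ℂ} (hn1 : Integrable n) (hn2 : MemLp n 2)
    (j : Fin 3) (t : ℝ) : ∃ d, IsLambda (fun x => n (x + shift j t) - n x) d := by
  have i1 : Integrable fun x => n (x + shift j t) := hn1.comp_add_right _
  have hN := measurable_freqNorm
  have hm : MemLp (fun p => fourierT (fun x => n (x + shift j t) - n x) p / (freqNorm p : ℂ)) 2
      freqMeasure := by
    refine ((memLp_fourierT hn1 hn2).norm.const_mul |t|).mono ((stronglyMeasurable_fourierT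
      (i1.sub hn1).1).aestronglyMeasurable.mul (by fun_prop : Measurable fun p : Freq =>
        (freqNorm p : ℂ)⁻¹).aestronglyMeasurable) (Eventually.of_forall fun p => ?_)
    rw [norm_mul, norm_norm, Real.norm_eq_abs, abs_abs]
    exact norm_fourierT_shift_sub_div_le hn1 j t p
  obtain ⟨d, hd⟩ := exists_isInvFourier_of_freq hm
  exact ⟨d, i1.sub hn1, (MemLp.comp_add_right hn2 _).sub hn2, hd⟩

theorem IsLambda.integral_norm_sq_shift_le {n d : CylCell → ℂ} {j : Fin 3} {t : ℝ}
    (hn1 : Integrable n) (hn2 : MemLp n 2) (h : IsLambda (fun x => n (x + shift j t) - n x) d) :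
    ∫ x, ‖d x‖ ^ 2 ≤ t ^ 2 * ∫ x, ‖n x‖ ^ 2 := by
  have h0 : 0 ≤ ∫ x, ‖n x‖ ^ 2 := by positivity
  rw [← ENNReal.ofReal_le_ofReal_iff (by positivity), ENNReal.ofReal_mul (by positivity),
    ← lintegral_sq_eq_ofReal_integral h.inv.right, ← lintegral_sq_eq_ofReal_integral hn2,
    h.inv.lintegral_sq, ← lintegral_fourierT_sq hn1 hn2, ← lintegral_const_mul' _ _
      ENNReal.ofReal_ne_top]
  refine lintegral_mono fun p => ?_
  rw [← ofReal_norm, ← ofReal_norm, ← ENNReal.ofReal_pow (norm_nonneg _),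
    ← ENNReal.ofReal_pow (norm_nonneg _), ← ENNReal.ofReal_mul (by positivity), ← sq_abs t,
    ← mul_pow]
  exact ENNReal.ofReal_le_ofReal (pow_le_pow_left₀ (norm_nonneg _)
    (norm_fourierT_shift_sub_div_le hn1 j t p) 2)

/-- The derivative of the Coulomb pairing under translations of one density. -/
theorem hasDerivAt_integral_shift {r : Freq → ℂ}
    (hr' : MemLp (fun p => r p / (freqNorm p : ℂ)) 2 freqMeasure) {n gj : CylCell → ℂ}
    (hn1 : Integrable n) (hn2 : MemLp n 2) {j : Fin 3}
    (hg : IsInvFourier (fun p => -(Complex.I * freqVec p j) * (r p / ((freqNorm p ^ 2 : ℝ) : ℂ))) gj) :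
    HasDerivAt (fun t : ℝ => ∫ p, r p / (freqNorm p : ℂ) * starRingEnd ℂ
      (fourierT (fun x => n (x + shift j t) - n x) p / (freqNorm p : ℂ)) ∂freqMeasure)
      (-∫ x, gj x * starRingEnd ℂ (n x)) 0 := by
  have hN := measurable_freqNorm
  have hv := measurable_freqVec j
  have hF := memLp_fourierT hn1 hn2
  set A : Freq → ℂ := fun p => r p / (freqNorm p : ℂ) * starRingEnd ℂ
    (fourierT n p / (freqNorm p : ℂ)) with hA
  have hAm : AEStronglyMeasurable A freqMeasure :=
    hr'.1.mul (hF.1.mul (by fun_prop : Measurable fun p : Freq =>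
      (freqNorm p : ℂ)⁻¹).aestronglyMeasurable).star
  have hexp : ∀ s : ℝ, starRingEnd ℂ (Complex.exp (-(Complex.I * (s : ℂ))))
      = Complex.exp (Complex.I * (s : ℂ)) := fun s => by
    rw [← Complex.exp_conj]
    simp
  have e1 : ∀ (t : ℝ) (p : Freq), r p / (freqNorm p : ℂ) * starRingEnd ℂ
      (fourierT (fun x => n (x + shift j t) - n x) p / (freqNorm p : ℂ))
      = A p * (Complex.exp (Complex.I * ((freqVec p j * t : ℝ) : ℂ)) - 1) := fun t p => by
    rw [fourierT_shift_sub hn1, map_div₀, map_mul, map_sub, hexp, map_one, hA]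
    simp only [map_div₀]
    ring
  simp only [e1]
  -- The majorant of the `t`-derivative: the factor `p_j` it produces is absorbed by one of the two
  -- factors `1/|p|`.
  have hB : Integrable (fun p => ‖r p / (freqNorm p : ℂ)‖ * ‖fourierT n p‖) freqMeasure :=
    hr'.norm.integrable_mul hF.norm
  have hmain := hasDerivAt_integral_of_dominated_loc_of_deriv_le (μ := freqMeasure) (𝕜 := ℝ)
    (F := fun t p => A p * (Complex.exp (Complex.I * ((freqVec p j * t : ℝ) : ℂ)) - 1))
    (F' := fun t p => A p * (Complex.exp (Complex.I * ((freqVec p j * t : ℝ) : ℂ))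
      * (Complex.I * freqVec p j)))
    (bound := fun p => ‖r p / (freqNorm p : ℂ)‖ * ‖fourierT n p‖) (x₀ := 0) (s := Set.univ)
    Filter.univ_mem
    (Eventually.of_forall fun t => hAm.mul (by fun_prop : Measurable _).aestronglyMeasurable)
    (by simp) (hAm.mul (by fun_prop : Measurable _).aestronglyMeasurable)
    (Eventually.of_forall fun p t _ => ?_) hB (Eventually.of_forall fun p t _ => ?_)
  · refine hmain.2.congr_deriv ?_
    rw [hg.parseval (isInvFourier_fourierT hn1 hn2), ← integral_neg]
    refine integral_congr_ae (Eventually.of_forall fun p => ?_)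
    simp only [hA, mul_zero, Complex.ofReal_zero, Complex.exp_zero, map_div₀, Complex.conj_ofReal]
    push_cast
    ring
  · have h1 : ‖Complex.exp (Complex.I * ((freqVec p j * t : ℝ) : ℂ))‖ = 1 := by
      rw [mul_comm]
      exact Complex.norm_exp_ofReal_mul_I _
    have h2 : ‖fourierT n p / (freqNorm p : ℂ)‖ * |freqVec p j| ≤ ‖fourierT n p‖ := by
      rw [norm_div, Complex.norm_real, Real.norm_of_nonneg (freqNorm_nonneg p), div_mul_eq_mul_div]
      exact div_le_of_le_mul₀ (freqNorm_nonneg p) (norm_nonneg _)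
        (mul_le_mul_of_nonneg_left (abs_freqVec_le p j) (norm_nonneg _))
    rw [hA]
    simp only [norm_mul, RCLike.norm_conj, h1, Complex.norm_I, one_mul, Complex.norm_real,
      Real.norm_eq_abs, mul_assoc]
    exact mul_le_mul_of_nonneg_left h2 (norm_nonneg _)
  · refine HasDerivAt.const_mul _ ?_
    have h1 : HasDerivAt (fun t : ℝ => Complex.I * ((freqVec p j * t : ℝ) : ℂ))
        (Complex.I * freqVec p j) t := by
      have := (((hasDerivAt_id' t).const_mul (freqVec p j)).ofReal_comp).const_mul Complex.I
      simpa using this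
    exact h1.cexp.sub_const 1

variable {e Z : ℝ} {σ : CylCell → ℝ} {ψ g : CylCell → ℂ} {G : Fin 3 → CylCell → ℂ}

/-- Only the electrons move while `σ` stays, so mass and gradient norms are unchanged and the field
changes by `-e` times that of the density difference. -/
theorem IsState.shift (h : IsState e Z σ ψ G g) {j : Fin 3} {t : ℝ} {d : CylCell → ℂ}
    (hd : IsLambda (fun x => ((‖ψ (x + CylCell.shift j t)‖ ^ 2 : ℝ) : ℂ) - ((‖ψ x‖ ^ 2 : ℝ) : ℂ)) d) :
    IsState e Z σ (fun x => ψ (x + CylCell.shift j t)) (fun i x => G i (x + CylCell.shift j t))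
      (fun x => g x + ((-e : ℝ) : ℂ) * d x) := by
  refine ⟨MemLp.comp_add_right h.memLp _,
    fun i => (h.hasWeakPartial i).comp_add_right h.memLp (h.memLp_grad i) _,
    fun i => MemLp.comp_add_right (h.memLp_grad i) _, ?_, ?_⟩
  · convert h.isLambda.add (hd.const_mul ((-e : ℝ) : ℂ)) using 2 with x
    simp only [charge]
    push_cast
    ring
  · rw [integral_add_right_eq_self (fun x => ‖ψ x‖ ^ 2), h.mass]

/-- The force of the electrons on themselves and the ions vanishes. -/
theorem IsMinimalState.integral_grad_mul_norm_sq {a : ℝ} (h : IsMinimalState a e Z σ ψ G g)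
    (he : e ≠ 0) {j : Fin 3} {gj : CylCell → ℂ}
    (hg : IsInvFourier (fun p => -(Complex.I * freqVec p j) *
      (fourierT (fun x => (charge e σ ψ x : ℂ)) p / ((freqNorm p ^ 2 : ℝ) : ℂ))) gj) :
    ∫ x, gj x * starRingEnd ℂ ((‖ψ x‖ ^ 2 : ℝ) : ℂ) = 0 := by
  have hs := h.toIsState
  set n : CylCell → ℂ := fun x => ((‖ψ x‖ ^ 2 : ℝ) : ℂ) with hn
  have hn1 : Integrable n := integrable_norm_sq_ofReal hs.memLp
  have hn2 : MemLp n 2 := hs.memH1.memLp_norm_sq_ofReal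
  have hder := hasDerivAt_integral_shift hs.isLambda.inv.left hn1 hn2 hg
  have hre := Complex.reCLM.hasFDerivAt.comp_hasDerivAt (0 : ℝ) hder
  set F : ℝ → ℂ := fun t => ∫ p, fourierT (fun x => (charge e σ ψ x : ℂ)) p / (freqNorm p : ℂ) *
    starRingEnd ℂ (fourierT (fun x => n (x + CylCell.shift j t) - n x) p / (freqNorm p : ℂ))
      ∂freqMeasure with hF
  -- Twice the energy change under translation by `t` is at most `-2e Re F(t) + e² t² ‖n‖²`. By
  -- minimality this bound is nonnegative, and it vanishes at `t = 0`, so its derivative there is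
  -- zero.
  have hQ := (hre.const_mul (-2 * e)).fun_add
    (((hasDerivAt_id' (0 : ℝ)).fun_pow 2).mul_const (e ^ 2 * ∫ x, ‖n x‖ ^ 2))
  have hmin := (show IsLocalMin _ (0 : ℝ) from by
    refine Eventually.of_forall fun t => ?_
    obtain ⟨d, hd⟩ := exists_isLambda_shift_sub hn1 hn2 j t
    have key := h.le _ _ _ (hs.shift hd)
    unfold stateEnergy at key
    have e1 : ∀ i, ∫ x, ‖G i (x + CylCell.shift j t)‖ ^ 2 = ∫ x, ‖G i x‖ ^ 2 := fun i =>
      integral_add_right_eq_self (fun x => ‖G i x‖ ^ 2) _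
    simp only [e1] at key
    rw [integral_norm_add_real_mul_sq hs.isLambda.inv.right hd.inv.right,
      hs.isLambda.inv.parseval hd.inv] at key
    have h1 := hd.integral_norm_sq_shift_le hn1 hn2
    have h2 : e ^ 2 * ∫ x, ‖d x‖ ^ 2 ≤ e ^ 2 * (t ^ 2 * ∫ x, ‖n x‖ ^ 2) :=
      mul_le_mul_of_nonneg_left h1 (sq_nonneg e)
    have h0 : F 0 = 0 := by simp [hF, CylCell.shift, proj_zero, fourierT]
    simp only [Function.comp, Complex.reCLM_apply, h0, Complex.zero_re]
    have h3 : 0 ≤ -e * (2 * (F t).re) + (-e) ^ 2 * ∫ x, ‖d x‖ ^ 2 := by linarith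
    nlinarith).hasDerivAt_eq_zero hQ
  have hz : (∫ x, gj x * starRingEnd ℂ (n x)).re = 0 := by
    simp at hmin
    rcases hmin with h | h
    · exact absurd h he
    · exact h
  -- Minimality gives only the real part; the integral is real by the symmetry `p ↦ -p`.
  refine Complex.ext hz ?_
  rw [hg.parseval (isInvFourier_fourierT hn1 hn2), Complex.zero_im, ← Complex.conj_eq_iff_im,
    ← integral_conj, ← integral_neg_freq]
  refine integral_congr_ae (Eventually.of_forall fun p => ?_)
  simp only [freqVec_neg, freqNorm_neg, fourierT_charge_neg,
    fourierT_neg (f := n) fun x => Complex.conj_ofReal _, map_mul, map_neg, map_div₀,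
    Complex.conj_conj, Complex.conj_ofReal, Complex.conj_I, Complex.ofReal_neg]
  ring

/-- Since `σ = ρ + e|ψ|²`, the force on the ion is the self-force of the total charge plus a
multiple of the force on the electrons, and both vanish. Integrability holds because `∇φ` and `σ`
are in `L²`. -/
theorem IsMinimalState.newton {a : ℝ} (h : IsMinimalState a e Z σ ψ G g)
    (he : e ≠ 0) (hσ2 : MemLp σ 2) (j : Fin 3) :
    ∃ gj, HasWeakPartial j (statePotential e σ ψ) gj ∧ Integrable (fun x => gj x * (σ x : ℂ)) ∧
      ∫ x, gj x * (σ x : ℂ) = 0 := by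
  have hs := h.toIsState
  have hr := hs.memLp_fourierT_charge
  obtain ⟨gj, hg⟩ := exists_isInvFourier_of_freq (memLp_freqVec_mul_div hs.isLambda.inv.left hr.1 j)
  have hσ : MemLp (fun x => (σ x : ℂ)) 2 := hσ2.ofReal
  have i1 := integrable_mul_star hg.right hs.isLambda.memLp
  have i2 := integrable_mul_star hg.right hs.memH1.memLp_norm_sq_ofReal
  refine ⟨gj, hasWeakPartial_potential hr hs.isLambda.inv.left hg, ?_, ?_⟩
  · simpa only [Complex.conj_ofReal] using integrable_mul_star hg.right hσ
  · have e1 := integral_grad_potential_mul_self (isInvFourier_fourierT hs.isLambda.integrable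
      hs.isLambda.memLp) (fourierT_charge_neg e σ ψ) hg
    have e2 := h.integral_grad_mul_norm_sq he hg
    have : ∫ x, gj x * (σ x : ℂ) = (∫ x, gj x * starRingEnd ℂ (charge e σ ψ x : ℂ))
        + (e : ℂ) * ∫ x, gj x * starRingEnd ℂ ((‖ψ x‖ ^ 2 : ℝ) : ℂ) := by
      rw [← integral_const_mul, ← integral_add i1 (i2.const_mul _)]
      refine integral_congr_ae (Eventually.of_forall fun x => ?_)
      simp only [Complex.conj_ofReal]
      rw [ofReal_charge]
      ring
    rw [this, e1, e2]
    simp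

end CylCell

end

/-! ### The theorem -/

theorem mainTheorem6 (ħ m e Z : ℝ) (hħ : 0 < ħ) (hm : 0 < m) (he : 0 < e) (hZ : 0 < Z)
    (σ : CylCell → ℝ)
    (hσ1 : MeasureTheory.MemLp σ 1) (hσ2 : MeasureTheory.MemLp σ 2)
    (hσZ : ∫ x, σ x = e * Z)
    (hII : MeasureTheory.MemLp
      (fun ξ : ℝ => (CylCell.fourierT (fun x => (σ x : ℂ)) (0, 0, ξ)
        - ((e * Z / Real.sqrt (2 * Real.pi) : ℝ) : ℂ)) / ((|ξ| : ℝ) : ℂ))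
      2 (MeasureTheory.volume.restrict (Set.Ioo (-1 : ℝ) 1))) :
    ∃ ψ₀ ∈ CylCell.neutralManifold Z,
      (CylCell.energy ħ m e σ ψ₀ = ⨅ ψ ∈ CylCell.neutralManifold Z, CylCell.energy ħ m e σ ψ) ∧
      CylCell.energy ħ m e σ ψ₀ < ⊤ ∧
      CylCell.MemH2loc ψ₀ ∧
      ∃ (φ₀ : CylCell → ℝ) (ω₀ : ℝ),
        CylCell.MemH2loc (fun x => (φ₀ x : ℂ)) ∧
        Continuous φ₀ ∧
        CylCell.IsStationary ħ m e σ ψ₀ φ₀ ω₀ ∧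
        ∃ C : ℝ, ∀ x : CylCell, |φ₀ x| ≤ C * (1 + |x.2.2|) ^ (1 / 2 : ℝ) := by
  have ha : 0 < ħ ^ 2 / (2 * m) := by positivity
  have hl := CylCell.lowSq_of_condition hσZ hII
  obtain ⟨ψ, G, g, hs, hmin⟩ := CylCell.exists_minimal_state ha he.ne' hZ hσ1 hσ2 hσZ hl
  have h : CylCell.IsMinimalState (ħ ^ 2 / (2 * m)) e Z σ ψ G g := ⟨hs, hmin⟩
  obtain ⟨lam, hL⟩ := h.exists_hasWeakLaplacian ha.ne' hZ he.ne' hσ1 hl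
  have hr := hs.memLp_fourierT_charge
  have hr' := hs.isLambda.inv.left
  have hφ : (fun x => ((CylCell.statePotential e σ ψ x).re : ℂ)) = CylCell.statePotential e σ ψ :=
    funext (CylCell.ofReal_re_statePotential e σ ψ)
  -- The frequency is the Lagrange multiplier divided by `ħ`. Taking the real part of the potential
  -- loses nothing, as `statePotential` is real valued.
  refine ⟨ψ, hs.mem_neutralManifold, CylCell.energy_eq_iInf_of_minimal hm hs hmin, ?_,
    hs.memH2loc hL, fun x => (CylCell.statePotential e σ ψ x).re, lam / ħ, ?_,
    Complex.continuous_re.comp hs.continuous_statePotential, ⟨?_, ?_, fun j => ?_⟩, ?_⟩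
  · rw [hs.energy_eq hm]
    exact ENNReal.ofReal_lt_top
  · rw [hφ]
    exact CylCell.memH2loc_potential hr hr'
  · refine ⟨_, hL, Filter.Eventually.of_forall fun x => ?_⟩
    have ha' : ((ħ ^ 2 / (2 * m) : ℝ) : ℂ) ≠ 0 := by exact_mod_cast ha.ne'
    rw [mul_div_cancel₀ _ hħ.ne', Complex.ofReal_mul e, CylCell.ofReal_re_statePotential]
    generalize ((ħ ^ 2 / (2 * m) : ℝ) : ℂ) = c at ha' ⊢
    field_simp
    ring
  · rw [hφ]
    exact ⟨_, CylCell.hasWeakLaplacian_potential (CylCell.isInvFourier_fourierT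
      hs.isLambda.integrable hs.isLambda.memLp) hr', Filter.Eventually.of_forall fun x => neg_neg _⟩
  · rw [hφ]
    obtain ⟨gj, h1, h2, h3⟩ := h.newton he.ne' hσ2 j
    exact ⟨gj, h1, h2, by rw [h3, neg_zero]⟩
  · obtain ⟨C, hC⟩ := CylCell.exists_norm_potential_le hr hr'
    exact ⟨C, fun x => (Complex.abs_re_le_norm _).trans (hC x)⟩
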